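/- Let $b>0$ and $\Pi_j=-i\frac{\partial}{\partial x_j}-A_{0,j}$, $j=1,2$, with $(A_{0,1},A_{0,2})=\frac b2(-x_2,x_1)$, and let $\Lambda_q=b(2q+1)$, $q\in\mathbb Z_+=\{0,1,2,\dots\}$, be the Landau levels, i.e. the points of the spectrum of $H_0=\Pi_1^2+\Pi_2^2$ in $L^2(\mathbb R^2)$; put $\Lambda_{-1}=-\infty$. Let $m=\{m_{jk}\}_{j,k=1,2}$ be a $C^\infty$ function on $\mathbb R^2$ whose values are Hermitian non-negative $2\times2$ complex matrices. Let $$H_\pm=\sum_{j,k=1,2}\Pi_j(\delta_{jk}\pm m_{jk})\Pi_k$$ be the self-adjoint operators in $L^2(\mathbb R^2)$ that are the closures of these differential expressions defined on $C_0^\infty(\mathbb R^2)$, where in the case of $H_-$ it is assumed in addition that $\sup_{x\in\mathbb R^2}|m(x)|<1$ ($|\cdot|$ being the operator norm). Assume that the support of $m$ is compact, and that the smaller eigenvalue $m_<(x)$ of the matrix $m(x)$ does not vanish identically in $x \in \mathbb R^2$. Fix $q\in\mathbb Z_+$. Then the eigenvalues of $H_+$ in $(\Lambda_q,\Lambda_{q+1})$,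 counted with multiplicities, form an infinite non-increasing sequence $\{\lambda^+_{k,q}\}_{k\in\mathbb Z_+}$, the eigenvalues of $H_-$ in $(\Lambda_{q-1},\Lambda_q)$, counted with multiplicities, form an infinite non-decreasing sequence $\{\lambda^-_{k,q}\}_{k\in\mathbb Z_+}$, and $$\ln\left(\pm\left(\lambda^\pm_{k,q}-\Lambda_q\right)\right)=-k\ln k+O(k),\qquad k\to\infty .$$ -/

import Mathlib

open MeasureTheory Set
open scoped ContDiff ComplexOrder Asymptotics

noncomputable section

/-- The Euclidean plane. -/
abbrev Plane : Type := EuclideanSpace ℝ (Fin 2)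

/-- The Hilbert space of square integrable complex functions on the plane. -/
abbrev L2Plane : Type := Lp ℂ 2 (volume : Measure Plane)

/-- The magnetic vector potential `(b/2) (-x₂, x₁)`. -/
def magPotential (b : ℝ) (x : Plane) : Fin 2 → ℝ := ![-(b / 2) * x 1, b / 2 * x 0]

/-- The magnetic momentum `Π_j = -i ∂_j - A_j`, acting on functions. -/
def magMomentum (b : ℝ) (j : Fin 2) (f : Plane → ℂ) (x : Plane) : ℂ :=
  -Complex.I * fderiv ℝ f x (EuclideanSpace.single j 1) - (magPotential b x j : ℂ) * f x

/-- The differential expression `∑_{j,k} Π_j g_{jk} Π_k`, acting on functions. -/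
def metricExpr (b : ℝ) (g : Plane → Matrix (Fin 2) (Fin 2) ℂ) (f : Plane → ℂ) (x : Plane) : ℂ :=
  ∑ j, ∑ k, magMomentum b j (fun y => g y j k * magMomentum b k f y) x

/-- The space of smooth compactly supported complex functions on the plane. -/
def testFunctions : Submodule ℂ (Plane → ℂ) where
  carrier := {f | ContDiff ℝ ∞ f ∧ HasCompactSupport f}
  add_mem' := fun hf hg => ⟨hf.1.add hg.1, hf.2.add hg.2⟩
  zero_mem' := ⟨contDiff_const, HasCompactSupport.zero⟩
  smul_mem' := fun c _ hf => ⟨hf.1.const_smul c, hf.2.smul_left (f := fun _ => c)⟩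

theorem contDiff_magPotential (b : ℝ) (j : Fin 2) :
    ContDiff ℝ ∞ (fun x : Plane => (magPotential b x j : ℂ)) := by
  apply Complex.ofRealCLM.contDiff.comp
  fin_cases j
  · change ContDiff ℝ ∞ (fun x : Plane => -(b / 2) * x 1)
    fun_prop
  · change ContDiff ℝ ∞ (fun x : Plane => b / 2 * x 0)
    fun_prop

theorem magMomentum_mem (b : ℝ) (j : Fin 2) {f : Plane → ℂ} (hf : f ∈ testFunctions) :
    magMomentum b j f ∈ testFunctions := by
  obtain ⟨h1, h2⟩ := hf
  refine ⟨?_, ?_⟩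
  · have h3 : ContDiff ℝ ∞ (fun x => fderiv ℝ f x (EuclideanSpace.single j 1)) :=
      (h1.fderiv_right (m := ∞) (by simp)).clm_apply contDiff_const
    exact (contDiff_const.mul h3).sub ((contDiff_magPotential b j).mul h1)
  · have h3 : HasCompactSupport (fun x => fderiv ℝ f x (EuclideanSpace.single j 1)) :=
      h2.fderiv_apply ℝ _
    exact HasCompactSupport.sub (h3.mul_left (f := fun _ => -Complex.I))
      (h2.mul_left (f := fun x => (magPotential b x j : ℂ)))

theorem mul_mem_testFunctions {a f : Plane → ℂ} (ha : ContDiff ℝ ∞ a) (hf : f ∈ testFunctions) :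
    (fun x => a x * f x) ∈ testFunctions :=
  ⟨ha.mul hf.1, hf.2.mul_left (f := a)⟩

theorem metricExpr_mem (b : ℝ) {g : Plane → Matrix (Fin 2) (Fin 2) ℂ}
    (hg : ∀ j k, ContDiff ℝ ∞ fun x => g x j k) {f : Plane → ℂ} (hf : f ∈ testFunctions) :
    metricExpr b g f ∈ testFunctions := by
  have h : metricExpr b g f =
      ∑ j, ∑ k, magMomentum b j (fun y => g y j k * magMomentum b k f y) := by
    ext x; simp [metricExpr, Finset.sum_apply]
  rw [h]
  exact Submodule.sum_mem _ fun j _ => Submodule.sum_mem _ fun k _ =>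
    magMomentum_mem b j (mul_mem_testFunctions (hg j k) (magMomentum_mem b k hf))

theorem magMomentum_add (b : ℝ) (j : Fin 2) {f h : Plane → ℂ} (hf : f ∈ testFunctions)
    (hh : h ∈ testFunctions) :
    magMomentum b j (f + h) = magMomentum b j f + magMomentum b j h := by
  ext x
  have e := fderiv_add (x := x) ((hf.1.differentiable (by simp)) x)
    ((hh.1.differentiable (by simp)) x)
  simp only [magMomentum, e, Pi.add_apply, add_apply]
  ring

theorem magMomentum_smul (b : ℝ) (j : Fin 2) (c : ℂ) {f : Plane → ℂ} (hf : f ∈ testFunctions) :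
    magMomentum b j (c • f) = c • magMomentum b j f := by
  ext x
  have e := fderiv_const_smul (x := x) ((hf.1.differentiable (by simp)) x) c
  simp only [magMomentum, e, Pi.smul_apply, smul_apply, smul_eq_mul]
  ring

theorem metricExpr_add (b : ℝ) {g : Plane → Matrix (Fin 2) (Fin 2) ℂ}
    (hg : ∀ j k, ContDiff ℝ ∞ fun x => g x j k) {f h : Plane → ℂ} (hf : f ∈ testFunctions)
    (hh : h ∈ testFunctions) :
    metricExpr b g (f + h) = metricExpr b g f + metricExpr b g h := by
  ext x
  simp only [metricExpr, Pi.add_apply, ← Finset.sum_add_distrib]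
  refine Finset.sum_congr rfl fun j _ => Finset.sum_congr rfl fun k _ => ?_
  rw [magMomentum_add b k hf hh, ← Pi.add_apply, ← magMomentum_add b j
    (mul_mem_testFunctions (hg j k) (magMomentum_mem b k hf))
    (mul_mem_testFunctions (hg j k) (magMomentum_mem b k hh))]
  congr 1
  ext y
  simp [mul_add]

theorem metricExpr_smul (b : ℝ) {g : Plane → Matrix (Fin 2) (Fin 2) ℂ}
    (hg : ∀ j k, ContDiff ℝ ∞ fun x => g x j k) (c : ℂ) {f : Plane → ℂ}
    (hf : f ∈ testFunctions) :
    metricExpr b g (c • f) = c • metricExpr b g f := by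
  ext x
  simp only [metricExpr, Pi.smul_apply, Finset.smul_sum]
  refine Finset.sum_congr rfl fun j _ => Finset.sum_congr rfl fun k _ => ?_
  have h := congrFun (magMomentum_smul b j c
    (mul_mem_testFunctions (hg j k) (magMomentum_mem b k hf))) x
  rw [Pi.smul_apply] at h
  rw [magMomentum_smul b k c hf, ← h]
  congr 1
  ext y
  simp [mul_left_comm]

/-- The differential expression as a linear map on test functions. -/
def metricLin (b : ℝ) (g : Plane → Matrix (Fin 2) (Fin 2) ℂ)
    (hg : ∀ j k, ContDiff ℝ ∞ fun x => g x j k) : testFunctions →ₗ[ℂ] testFunctions where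
  toFun f := ⟨metricExpr b g f, metricExpr_mem b hg f.2⟩
  map_add' f h := Subtype.ext (metricExpr_add b hg f.2 h.2)
  map_smul' c f := Subtype.ext (metricExpr_smul b hg c f.2)

theorem memLp_of_testFunction {f : Plane → ℂ} (hf : f ∈ testFunctions) :
    MemLp f 2 (volume : Measure Plane) :=
  hf.1.continuous.memLp_of_hasCompactSupport hf.2

/-- The inclusion of test functions into `L²`. -/
def testToL2 : testFunctions →ₗ[ℂ] L2Plane where
  toFun f := (memLp_of_testFunction f.2).toLp f
  map_add' _ _ := rfl
  map_smul' _ _ := rfl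

theorem testToL2_injective : Function.Injective testToL2 := by
  intro f h e
  have e' : (f : Plane → ℂ) =ᵐ[volume] h :=
    (MemLp.toLp_eq_toLp_iff (memLp_of_testFunction f.2) (memLp_of_testFunction h.2)).1 e
  exact Subtype.ext ((f.2.1.continuous.ae_eq_iff_eq _ h.2.1.continuous).1 e')

/-- The operator `∑_{j,k} Π_j g_{jk} Π_k` in `L²` with domain the test functions. -/
def metricMin (b : ℝ) (g : Plane → Matrix (Fin 2) (Fin 2) ℂ)
    (hg : ∀ j k, ContDiff ℝ ∞ fun x => g x j k) : L2Plane →ₗ.[ℂ] L2Plane where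
  domain := LinearMap.range testToL2
  toFun := testToL2 ∘ₗ metricLin b g hg ∘ₗ
    (LinearEquiv.ofInjective testToL2 testToL2_injective).symm.toLinearMap

/-- The operator `∑_{j,k} Π_j g_{jk} Π_k` in `L²`: the closure of its restriction to
test functions (on which it is essentially self-adjoint when `g - 1` is bounded together with
all its derivatives and `g` is Hermitian and uniformly positive definite). -/
def metricOp (b : ℝ) (g : Plane → Matrix (Fin 2) (Fin 2) ℂ)
    (hg : ∀ j k, ContDiff ℝ ∞ fun x => g x j k) : L2Plane →ₗ.[ℂ] L2Plane :=
  (metricMin b g hg).closure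

theorem contDiff_one_add {m : Plane → Matrix (Fin 2) (Fin 2) ℂ}
    (hm : ∀ j k, ContDiff ℝ ∞ fun x => m x j k) :
    ∀ j k, ContDiff ℝ ∞ fun x => (1 + m x) j k :=
  fun j k => contDiff_const.add (hm j k)

theorem contDiff_one_sub {m : Plane → Matrix (Fin 2) (Fin 2) ℂ}
    (hm : ∀ j k, ContDiff ℝ ∞ fun x => m x j k) :
    ∀ j k, ContDiff ℝ ∞ fun x => (1 - m x) j k :=
  fun j k => contDiff_const.sub (hm j k)

/-- `H₊ = ∑_{j,k} Π_j (δ_{jk} + m_{jk}) Π_k`. -/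
def landauPlus (b : ℝ) (m : Plane → Matrix (Fin 2) (Fin 2) ℂ)
    (hm : ∀ j k, ContDiff ℝ ∞ fun x => m x j k) : L2Plane →ₗ.[ℂ] L2Plane :=
  metricOp b (fun x => 1 + m x) (contDiff_one_add hm)

/-- `H₋ = ∑_{j,k} Π_j (δ_{jk} - m_{jk}) Π_k`. -/
def landauMinus (b : ℝ) (m : Plane → Matrix (Fin 2) (Fin 2) ℂ)
    (hm : ∀ j k, ContDiff ℝ ∞ fun x => m x j k) : L2Plane →ₗ.[ℂ] L2Plane :=
  metricOp b (fun x => 1 - m x) (contDiff_one_sub hm)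

/-- The Landau levels `Λ_q = b (2 q + 1)`. -/
def landauLevel (b : ℝ) (q : ℕ) : ℝ := b * (2 * q + 1)

/-- The interval `(Λ_q, Λ_{q+1})`. -/
def gapAbove (b : ℝ) (q : ℕ) : Set ℝ := Ioo (landauLevel b q) (landauLevel b (q + 1))

/-- The interval `(Λ_{q-1}, Λ_q)`, where `Λ_{-1} = -∞`. -/
def gapBelow (b : ℝ) : ℕ → Set ℝ
  | 0 => Iio (landauLevel b 0)
  | q + 1 => Ioo (landauLevel b q) (landauLevel b (q + 1))

/-- The smaller eigenvalue of a Hermitian `2 × 2` matrix. -/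
def smallerEigenvalue {A : Matrix (Fin 2) (Fin 2) ℂ} (hA : A.IsHermitian) : ℝ :=
  min (hA.eigenvalues 0) (hA.eigenvalues 1)

/-- The space of all `u` in the domain of `T` with `T u = μ u`. -/
def opEigenspace (T : L2Plane →ₗ.[ℂ] L2Plane) (μ : ℝ) : Submodule ℂ L2Plane :=
  T.graph.comap (LinearMap.id.prod ((μ : ℂ) • LinearMap.id))

theorem mem_opEigenspace (T : L2Plane →ₗ.[ℂ] L2Plane) (μ : ℝ) (u : L2Plane) :
    u ∈ opEigenspace T μ ↔ ∃ h : u ∈ T.domain, T ⟨u, h⟩ = (μ : ℂ) • u := by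
  simp only [opEigenspace, Submodule.mem_comap, LinearPMap.mem_graph_iff]
  constructor
  · rintro ⟨y, rfl, h⟩
    exact ⟨y.2, h⟩
  · rintro ⟨h, e⟩
    exact ⟨⟨u, h⟩, rfl, e⟩

/-- The multiplicity of `μ` as an eigenvalue of `T` (zero if `μ` is not an eigenvalue). -/
def eigenMultiplicity (T : L2Plane →ₗ.[ℂ] L2Plane) (μ : ℝ) : ℕ∞ :=
  Cardinal.toENat (Module.rank ℂ (opEigenspace T μ))

/-- The sequence `lam` lists exactly the eigenvalues of `T` lying in `I`, each one repeated
according to its multiplicity. -/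
structure ListsEigenvalues (T : L2Plane →ₗ.[ℂ] L2Plane) (I : Set ℝ) (lam : ℕ → ℝ) : Prop where
  mem : ∀ k, lam k ∈ I
  card : ∀ μ ∈ I, {k | lam k = μ}.encard = eigenMultiplicity T μ

end

/-! Write W for the perturbation `∑ Π_j m_jk Π_k`, σ = ±1, and pass to inverses: A₀ = H₀⁻¹, A = (H₀
+ σW)⁻¹. Then A = A₀ - σK with K non-negative and compact, and an eigenvalue μ of H₊ or H₋ is an
eigenvalue 1/μ of A. Put β = 1/Λ_q and let α be the inverse of the neighbouring Landau level (for H₋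
and q = 0, a number larger than ‖A‖). The eigenvalues of A strictly between α and β are the t with
-(t - α)(t - β) > 0, so they are the positive eigenvalues of the bounded operator -(A - α)(A - β),
`gapOp`, and can be counted by comparing its quadratic form on subspaces of finite dimension or
codimension (`finite_and_sum_finrank_le`, `exists_finset_le_sum_finrank`).

Up to finitely many dimensions that form is bounded above by a multiple of K[P_q u], where P_q
projects onto the Landau level q (`quadForm_gapOp_le`), and on the level itself it is bounded below
by a multiple of K[u] (`quadForm_gapOp_ge`). A variational principle for inverses shows that K[H₀f]
is comparable to W[f] = ∫ ⟨m Πf, Πf⟩ (`exists_quadForm_resolventDiff_bounds`). What remains is W on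
a single Landau level, a Toeplitz-type form.

The level q has an orthogonal basis a*^q (z^k e^{-b|z|²/4}), up to constants, with squared norms of
order (2b)^k k!, whereas on the compact support of m these functions grow at most like C^k. Hence W
≤ C^{k+1}/k! on normalized combinations of indices ≥ k (`exists_metricForm_combination_le`).
Conversely, m is positive definite on some disc, because its smaller eigenvalue is non-zero
somewhere. There W controls a*f, and pairing with suitable test functions recovers the coefficients
in powers of z - z₀, which are orthogonal for radial weights; this gives W ≥ c^{k+1}/k! on
combinations of the first k states (`exists_sum_sq_le_metricForm`).

So, up to bounded shifts of the index, the k-th distance to Λ_q lies between c^k/k! and C^k/k!, and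
elementary bounds on log k! finish the proof (`lists_asymptotics`). To identify H₊ and H₋, defined
as closures from test functions, with the inverse of A, an elliptic estimate and the continuity
method show that H₀ + σW has dense range on Schwartz functions (`isElliptic_perturbedOp`,
`mem_graph_metricOp`). -/

open scoped SchwartzMap LineDeriv

/-! ### Quadratic forms of `-(A - α)(A - β)` for a compact perturbation of an operator with an
eigenbasis. -/

section AbstractForms

variable {H : Type*} [NormedAddCommGroup H] [InnerProductSpace ℂ H]

/-- The real quadratic form of a bounded operator. -/
noncomputable def quadForm (T : H →L[ℂ] H) (u : H) : ℝ := (inner ℂ (T u) u).re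

/-- The quadratic form of `T` is arbitrarily small on subspaces of finite codimension. -/
def FormSmall (T : H →L[ℂ] H) : Prop :=
  ∀ δ > 0, ∃ F : Submodule ℂ H, FiniteDimensional ℂ F ∧ ∀ u ∈ Fᗮ, quadForm T u ≤ δ * ‖u‖ ^ 2

theorem continuous_quadForm (T : H →L[ℂ] H) : Continuous (quadForm T) := by
  unfold quadForm
  exact Complex.continuous_re.comp (by fun_prop)

variable [CompleteSpace H]

theorem exists_selfAdjoint_sqrt {K : H →L[ℂ] H} (hK : K.IsPositive) :
    ∃ S : H →L[ℂ] H, IsSelfAdjoint S ∧ S * S = K := by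
  have h0 : 0 ≤ K := (ContinuousLinearMap.nonneg_iff_isPositive K).2 hK
  exact ⟨CFC.sqrt K, (CFC.sqrt_nonneg K).isSelfAdjoint, CFC.sqrt_mul_sqrt_self K h0⟩

theorem inner_mul_self_apply {S K : H →L[ℂ] H} (hS : IsSelfAdjoint S) (h : S * S = K) (x y : H) :
    inner ℂ (K x) y = inner ℂ (S x) (S y) := by
  subst h
  exact hS.isSymmetric (S x) y

theorem quadForm_eq_norm_sq {S K : H →L[ℂ] H} (hS : IsSelfAdjoint S) (h : S * S = K) (x : H) :
    quadForm K x = ‖S x‖ ^ 2 := by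
  rw [quadForm, inner_mul_self_apply hS h, inner_self_eq_norm_sq_to_K]
  norm_cast

/-- The space `G` is the image of `F` under the adjoint. This is what allows a condition `T u ∈ Fᗮ`
to be imposed at the cost of finitely many dimensions. -/
theorem finiteDimensional_preimage_orthogonal {F : Submodule ℂ H} [FiniteDimensional ℂ F]
    (T : H →L[ℂ] H) :
    ∃ G : Submodule ℂ H, FiniteDimensional ℂ G ∧ ∀ u ∈ Gᗮ, T u ∈ Fᗮ := by
  refine ⟨F.map (ContinuousLinearMap.adjoint T).toLinearMap, inferInstance, fun u hu => ?_⟩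
  rw [Submodule.mem_orthogonal] at hu ⊢
  intro v hv
  rw [← ContinuousLinearMap.adjoint_inner_left]
  exact hu _ (Submodule.mem_map_of_mem hv)

/-- The operator `-(A - α)(A - β)`. -/
noncomputable def gapOp (A : H →L[ℂ] H) (α β : ℝ) : H →L[ℂ] H :=
  -((A - (α : ℂ) • (1 : H →L[ℂ] H)) * (A - (β : ℂ) • (1 : H →L[ℂ] H)))

theorem isSelfAdjoint_sub_real {A : H →L[ℂ] H} (hA : IsSelfAdjoint A) (α : ℝ) :
    IsSelfAdjoint (A - (α : ℂ) • (1 : H →L[ℂ] H)) := by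
  refine hA.sub ?_
  rw [IsSelfAdjoint, star_smul, star_one]
  simp

theorem quadForm_gapOp {A : H →L[ℂ] H} (hA : IsSelfAdjoint A) (α β : ℝ) (u : H) :
    quadForm (gapOp A α β) u = -(inner ℂ (A u - (β : ℂ) • u) (A u - (α : ℂ) • u)).re := by
  have h := (isSelfAdjoint_sub_real hA α).isSymmetric ((A - (β : ℂ) • (1 : H →L[ℂ] H)) u) u
  change (inner ℂ (-((A - (α : ℂ) • (1 : H →L[ℂ] H)) ((A - (β : ℂ) • (1 : H →L[ℂ] H)) u))) u).re = _
  rw [inner_neg_left, Complex.neg_re]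
  exact congrArg (fun z : ℂ => -z.re) h

/-- For `A0 u = β u` one has `(A - β)u = -σKu` and `(A - α)u = (β - α)u - σKu`, so the form equals
`σ(β - α) K[u] - ‖Ku‖²`. With `S² = K`, `‖Ku‖² ≤ ‖Su‖ ‖SKu‖`, and smallness of the form of `K` at
`Ku ∈ Fᗮ` makes the last term at most half of the first. -/
theorem quadForm_gapOp_ge {A A0 K : H →L[ℂ] H} {σ α β : ℝ} (hσ : σ ^ 2 = 1)
    (hA : IsSelfAdjoint A) (hAK : A = A0 - (σ : ℂ) • K) (hK : K.IsPositive)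
    (hs : 0 < σ * (β - α)) (hsmall : FormSmall K) :
    ∃ F : Submodule ℂ H, FiniteDimensional ℂ F ∧ ∀ u, A0 u = (β : ℂ) • u → K u ∈ Fᗮ →
      σ * (β - α) / 2 * quadForm K u ≤ quadForm (gapOp A α β) u := by
  obtain ⟨S, hS, hSK⟩ := exists_selfAdjoint_sqrt hK
  obtain ⟨F, hF, hFs⟩ := hsmall _ (half_pos hs)
  refine ⟨F, hF, fun u hu hKu => ?_⟩
  have h1 := hFs _ hKu
  rw [quadForm_eq_norm_sq hS hSK] at h1
  have h2 : ‖K u‖ ^ 2 ≤ ‖S u‖ * ‖S (K u)‖ := by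
    have := norm_inner_le_norm (𝕜 := ℂ) (S u) (S (K u))
    rw [← inner_mul_self_apply hS hSK, inner_self_eq_norm_sq_to_K] at this
    simpa using this
  have h3 : ‖K u‖ ^ 2 ≤ σ * (β - α) / 2 * ‖S u‖ ^ 2 := by
    by_cases h0 : ‖K u‖ = 0
    · rw [h0, zero_pow two_ne_zero]; positivity
    have hp : 0 < ‖K u‖ ^ 2 := by
      have := lt_of_le_of_ne (norm_nonneg (K u)) (Ne.symm h0)
      positivity
    have h4 : (‖K u‖ ^ 2) ^ 2 ≤ ‖S u‖ ^ 2 * (σ * (β - α) / 2 * ‖K u‖ ^ 2) := by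
      calc (‖K u‖ ^ 2) ^ 2 ≤ (‖S u‖ * ‖S (K u)‖) ^ 2 := by gcongr
        _ = ‖S u‖ ^ 2 * ‖S (K u)‖ ^ 2 := by ring
        _ ≤ _ := by gcongr
    nlinarith
  have h5 : quadForm (gapOp A α β) u = σ * (β - α) * ‖S u‖ ^ 2 - ‖K u‖ ^ 2 := by
    rw [quadForm_gapOp hA, ← quadForm_eq_norm_sq hS hSK u]
    have e1 : A u - (β : ℂ) • u = -(σ : ℂ) • K u := by
      rw [hAK]; simp [hu]
    have e2 : A u - (α : ℂ) • u = ((β - α : ℝ) : ℂ) • u - (σ : ℂ) • K u := by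
      rw [hAK]; simp [hu, sub_smul]; abel
    have e3 : inner ℂ (K u) (K u) = ((‖K u‖ ^ 2 : ℝ) : ℂ) := by
      rw [inner_self_eq_norm_sq_to_K]; norm_cast
    rw [e1, e2, inner_sub_right, inner_smul_left, inner_smul_left, inner_smul_right,
      inner_smul_right, e3, quadForm]
    have : ((starRingEnd ℂ) (-(σ : ℂ))) = ((-σ : ℝ) : ℂ) := by simp
    rw [this]
    simp only [Complex.sub_re, Complex.re_ofReal_mul]
    rw [Complex.ofReal_re]
    linear_combination (-‖K u‖ ^ 2) * hσ
  rw [h5, quadForm_eq_norm_sq hS hSK]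
  linarith

/-- In the eigenbasis the right-hand side is the sum of `(ev i - α)(ev i - β) |⟨e i, w⟩|²`, and the
coefficients with eigenvalue `α` or `β` vanish. -/
theorem re_inner_sub_apply_ge {ι : Type*} (e : HilbertBasis ι ℂ H) {A0 : H →L[ℂ] H}
    (hA0 : IsSelfAdjoint A0) {ev : ι → ℝ} (he : ∀ i, A0 (e i) = (ev i : ℂ) • e i) {α β η : ℝ}
    (hη : ∀ i, ev i = α ∨ ev i = β ∨ η ≤ (ev i - α) * (ev i - β)) {w : H}
    (hα : ∀ v, A0 v = (α : ℂ) • v → inner ℂ v w = 0)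
    (hβ : ∀ v, A0 v = (β : ℂ) • v → inner ℂ v w = 0) :
    η * ‖w‖ ^ 2 ≤ (inner ℂ (A0 w - (β : ℂ) • w) (A0 w - (α : ℂ) • w)).re := by
  have hs := hA0.isSymmetric
  have h1 : ∀ i, (inner ℂ (A0 w - (β : ℂ) • w) (e i) * inner ℂ (e i) (A0 w - (α : ℂ) • w)).re
      = (ev i - α) * (ev i - β) * ‖inner ℂ (e i) w‖ ^ 2 := by
    intro i
    have a1 : inner ℂ (A0 w) (e i) = (ev i : ℂ) * inner ℂ w (e i) := by
      rw [show inner ℂ (A0 w) (e i) = inner ℂ w (A0 (e i)) from hs w (e i), he, inner_smul_right]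
    have a2 : inner ℂ (e i) (A0 w) = (ev i : ℂ) * inner ℂ (e i) w := by
      rw [show inner ℂ (e i) (A0 w) = inner ℂ (A0 (e i)) w from (hs (e i) w).symm, he,
        inner_smul_left, Complex.conj_ofReal]
    have a3 : inner ℂ w (e i) * inner ℂ (e i) w = ((‖inner ℂ (e i) w‖ ^ 2 : ℝ) : ℂ) := by
      rw [← inner_conj_symm, ← Complex.normSq_eq_norm_sq, mul_comm, Complex.mul_conj]
    rw [inner_sub_left, inner_sub_right, a1, a2, inner_smul_left, inner_smul_right,
      Complex.conj_ofReal]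
    have : ((ev i : ℂ) * inner ℂ w (e i) - (β : ℂ) * inner ℂ w (e i)) *
        ((ev i : ℂ) * inner ℂ (e i) w - (α : ℂ) * inner ℂ (e i) w)
        = (((ev i - α) * (ev i - β) : ℝ) : ℂ) * (inner ℂ w (e i) * inner ℂ (e i) w) := by
      push_cast; ring
    rw [this, a3, ← Complex.ofReal_mul, Complex.ofReal_re]
  have h2 := Complex.hasSum_re (e.hasSum_inner_mul_inner (A0 w - (β : ℂ) • w) (A0 w - (α : ℂ) • w))
  have h3 : HasSum (fun i => η * ‖inner ℂ (e i) w‖ ^ 2) (η * ‖w‖ ^ 2) := by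
    have h4 := Complex.hasSum_re (e.hasSum_inner_mul_inner w w)
    rw [inner_self_eq_norm_sq_to_K] at h4
    have : (((‖w‖ : ℂ) ^ 2).re) = ‖w‖ ^ 2 := by norm_cast
    simp only [Complex.coe_algebraMap, this] at h4
    have h5 : ∀ i, (inner ℂ w (e i) * inner ℂ (e i) w).re = ‖inner ℂ (e i) w‖ ^ 2 := fun i => by
      rw [← inner_conj_symm, mul_comm, Complex.mul_conj, Complex.normSq_eq_norm_sq,
        Complex.ofReal_re]
    simp only [h5] at h4
    exact h4.mul_left η
  refine hasSum_le (fun i => ?_) h3 h2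
  rw [h1]
  rcases hη i with h | h | h
  · have := hα (e i) (by rw [he, h])
    rw [this]; simp
  · have := hβ (e i) (by rw [he, h])
    rw [this]; simp
  · gcongr

theorem inner_eq_zero_of_eigen {A0 : H →L[ℂ] H} (hA0 : IsSelfAdjoint A0) {α β : ℝ} (h : α ≠ β)
    {x y : H} (hx : A0 x = (α : ℂ) • x) (hy : A0 y = (β : ℂ) • y) : inner ℂ x y = 0 := by
  have := hA0.isSymmetric x y
  simp only [ContinuousLinearMap.coe_coe] at this
  rw [hx, hy, inner_smul_left, inner_smul_right, Complex.conj_ofReal] at this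
  have h2 : ((α : ℂ) - β) * inner ℂ x y = 0 := by rw [sub_mul, this, sub_self]
  rcases mul_eq_zero.1 h2 with h3 | h3
  · exact absurd (by exact_mod_cast sub_eq_zero.1 h3) h
  · exact h3

/-- The eigenspace of a bounded operator, as the kernel of a bounded operator. -/
noncomputable def eigenKer (A : H →L[ℂ] H) (μ : ℝ) : Submodule ℂ H :=
  (A - (μ : ℂ) • (1 : H →L[ℂ] H)).ker

theorem mem_eigenKer {A : H →L[ℂ] H} {μ : ℝ} {x : H} : x ∈ eigenKer A μ ↔ A x = (μ : ℂ) • x := by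
  rw [eigenKer, LinearMap.mem_ker]
  change A x - (μ : ℂ) • x = 0 ↔ _
  rw [sub_eq_zero]

instance (A : H →L[ℂ] H) (μ : ℝ) : CompleteSpace (eigenKer A μ) :=
  (A - (μ : ℂ) • (1 : H →L[ℂ] H)).isClosed_ker.completeSpace_coe

/-- The scalar core of `quadForm_gapOp_le`: `a`, `a'`, `n` stand for the norms of `S` on the β-part,
the α-part and the remainder, and `d` bounds `n`. The mixed terms `(s + 2)(a + a')d` are split into
`s(a² + a'²)` and a multiple of `d²`; the former is compensated by `-s a'²` at the price of doubling
`s a²`, the latter by `E`. -/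
theorem gapOp_scalar_bound {s a a' n d E e t1 t2 x1 x2 k : ℝ} (hs : 0 < s) (ha : 0 ≤ a)
    (ha' : 0 ≤ a') (hn : n ≤ d) (hd : ((s + 2) ^ 2 / (2 * s) + 2) * d ^ 2 = e) (hE : e ≤ E)
    (ht : a' ^ 2 - a ^ 2 - (a + a') * n ≤ t1 - t2) (h1 : x1 ≤ (a + a' + d) * d)
    (h2 : x2 ≤ (a + a' + d) * d) (hk : 0 ≤ k) :
    -(E + s * t1 - x1 - s * t2 - x2 + k) ≤ 2 * s * a ^ 2 := by
  have f1 : s * ((a + a') * n) ≤ s * ((a + a') * d) := by gcongr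
  have f3 : (s + 2) * ((a + a') * d) ≤ s / 2 * (a + a') ^ 2 + (s + 2) ^ 2 / (2 * s) * d ^ 2 := by
    have : s / 2 * (a + a') ^ 2 + (s + 2) ^ 2 / (2 * s) * d ^ 2 - (s + 2) * ((a + a') * d) =
        (s * (a + a') - (s + 2) * d) ^ 2 / (2 * s) := by field_simp; ring
    have : 0 ≤ (s * (a + a') - (s + 2) * d) ^ 2 / (2 * s) := by positivity
    linarith
  have f4 : s / 2 * (a + a') ^ 2 ≤ s * (a ^ 2 + a' ^ 2) := by nlinarith [sq_nonneg (a - a')]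
  have f5 := mul_le_mul_of_nonneg_left ht hs.le
  generalize (s + 2) ^ 2 / (2 * s) = c at *
  linarith

set_option maxHeartbeats 1000000 in
-- Decompose `u = p + p' + w` along the β-eigenspace, the α-eigenspace and the rest. The unperturbed
-- form is at most `-η‖w‖²` on `w`. To first order `K` contributes `+s K[p]` and `-s K[p']`, so the
-- α-part has the favourable sign. All cross terms with `w` are small once `w`, `L1 w` and `L2 w`
-- are orthogonal to a large finite-dimensional space.
theorem quadForm_gapOp_le {ι : Type*} (e : HilbertBasis ι ℂ H) {A A0 K : H →L[ℂ] H}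
    {σ α β η : ℝ} (hσ : σ ^ 2 = 1)
    (hA0 : IsSelfAdjoint A0) {ev : ι → ℝ} (he : ∀ i, A0 (e i) = (ev i : ℂ) • e i)
    (hA : IsSelfAdjoint A) (hAK : A = A0 - (σ : ℂ) • K) (hK : K.IsPositive)
    (hs : 0 < σ * (β - α)) (hsmall : FormSmall K) (hη0 : 0 < η)
    (hη : ∀ i, ev i = α ∨ ev i = β ∨ η ≤ (ev i - α) * (ev i - β)) :
    ∃ F : Submodule ℂ H, FiniteDimensional ℂ F ∧ ∀ u ∈ Fᗮ,
      quadForm (gapOp A α β) u ≤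
        2 * (σ * (β - α)) * quadForm K ((eigenKer A0 β).starProjection u) := by
  obtain ⟨S, hS, hSK⟩ := exists_selfAdjoint_sqrt hK
  set s := σ * (β - α) with hs_def
  set L1 : H →L[ℂ] H := A0 - (β : ℂ) • (1 : H →L[ℂ] H) with hL1
  set L2 : H →L[ℂ] H := A0 - (α : ℂ) • (1 : H →L[ℂ] H) with hL2
  set Q : H →L[ℂ] H := 1 - (eigenKer A0 β).starProjection - (eigenKer A0 α).starProjection with hQ
  set M : ℝ := 1 + ‖L1‖ + ‖L2‖ with hM
  have hM1 : 0 < M := by positivity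
  -- Chosen so that the `d²` terms of `gapOp_scalar_bound`, with `d = √D2 ‖w‖`, add up to exactly
  -- `η‖w‖²`.
  set D2 : ℝ := η / ((s + 2) ^ 2 / (2 * s) + 2) with hD2
  have hD2p : 0 < D2 := by positivity
  have hαβ : α ≠ β := by rintro rfl; simp [hs_def] at hs
  obtain ⟨F, hF, hFs⟩ := hsmall (D2 / M ^ 2) (by positivity)
  obtain ⟨G0, hG0, hG0'⟩ := finiteDimensional_preimage_orthogonal (F := F) Q
  obtain ⟨G1, hG1, hG1'⟩ := finiteDimensional_preimage_orthogonal (F := F) (L1 * Q)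
  obtain ⟨G2, hG2, hG2'⟩ := finiteDimensional_preimage_orthogonal (F := F) (L2 * Q)
  refine ⟨G0 ⊔ G1 ⊔ G2, inferInstance, fun u hu => ?_⟩
  have hu0 : Q u ∈ Fᗮ := hG0' u (Submodule.orthogonal_le (le_sup_left.trans le_sup_left) hu)
  have hu1 : L1 (Q u) ∈ Fᗮ := hG1' u (Submodule.orthogonal_le (le_sup_right.trans le_sup_left) hu)
  have hu2 : L2 (Q u) ∈ Fᗮ := hG2' u (Submodule.orthogonal_le le_sup_right hu)
  set p := (eigenKer A0 β).starProjection u with hp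
  set p' := (eigenKer A0 α).starProjection u with hp'
  set w := Q u with hw
  have hpm : A0 p = (β : ℂ) • p := mem_eigenKer.1 (Submodule.starProjection_apply_mem _ _)
  have hpm' : A0 p' = (α : ℂ) • p' := mem_eigenKer.1 (Submodule.starProjection_apply_mem _ _)
  have hdec : u = p + p' + w := by
    change u = p + p' + (u - p - p'); abel
  have hwβ : ∀ v, A0 v = (β : ℂ) • v → inner ℂ v w = 0 := by
    intro v hv
    have h1 : inner ℂ v (u - p) = 0 :=
      Submodule.inner_right_of_mem_orthogonal (mem_eigenKer.2 hv)
        (Submodule.sub_starProjection_mem_orthogonal u)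
    have h2 : inner ℂ v p' = 0 := inner_eq_zero_of_eigen hA0 hαβ.symm hv hpm'
    change inner ℂ v (u - p - p') = 0
    rw [inner_sub_right, h1, h2, sub_zero]
  have hwα : ∀ v, A0 v = (α : ℂ) • v → inner ℂ v w = 0 := by
    intro v hv
    have h1 : inner ℂ v (u - p') = 0 :=
      Submodule.inner_right_of_mem_orthogonal (mem_eigenKer.2 hv)
        (Submodule.sub_starProjection_mem_orthogonal u)
    have h2 : inner ℂ v p = 0 := inner_eq_zero_of_eigen hA0 hαβ hv hpm
    have : w = u - p' - p := by change u - p - p' = _; abel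
    rw [this, inner_sub_right, h1, h2, sub_zero]
  have hmain := re_inner_sub_apply_ge e hA0 he hη hwα hwβ
  have hL1w : L1 w = A0 w - (β : ℂ) • w := rfl
  have hL2w : L2 w = A0 w - (α : ℂ) • w := rfl
  rw [← hL1w, ← hL2w] at hmain
  have hL1s : ∀ x y, inner ℂ (L1 x) y = inner ℂ x (L1 y) :=
    (isSelfAdjoint_sub_real hA0 β).isSymmetric
  have hL2s : ∀ x y, inner ℂ (L2 x) y = inner ℂ x (L2 y) :=
    (isSelfAdjoint_sub_real hA0 α).isSymmetric
  have hL1p : L1 p = 0 := by change A0 p - (β : ℂ) • p = 0; rw [hpm, sub_self]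
  have hL2p : L2 p' = 0 := by change A0 p' - (α : ℂ) • p' = 0; rw [hpm', sub_self]
  have o1 : inner ℂ (L1 w) p = 0 := by rw [hL1s, hL1p, inner_zero_right]
  have o2 : inner ℂ p' (L2 w) = 0 := by rw [← hL2s, hL2p, inner_zero_left]
  have o3 : inner ℂ p' p = 0 := inner_eq_zero_of_eigen hA0 hαβ hpm' hpm
  have e1 : A u - (β : ℂ) • u = ((α - β : ℝ) : ℂ) • p' + L1 w - (σ : ℂ) • K u := by
    rw [hAK]
    change A0 u - (σ : ℂ) • K u - (β : ℂ) • u = _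
    have : A0 u - (β : ℂ) • u = ((α - β : ℝ) : ℂ) • p' + L1 w := by
      change L1 u = _
      conv_lhs => rw [hdec]
      rw [map_add, map_add, hL1p, zero_add]
      congr 1
      change A0 p' - (β : ℂ) • p' = _
      rw [hpm', Complex.ofReal_sub, sub_smul]
    rw [← this]; abel
  have e2 : A u - (α : ℂ) • u = ((β - α : ℝ) : ℂ) • p + L2 w - (σ : ℂ) • K u := by
    rw [hAK]
    change A0 u - (σ : ℂ) • K u - (α : ℂ) • u = _
    have : A0 u - (α : ℂ) • u = ((β - α : ℝ) : ℂ) • p + L2 w := by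
      change L2 u = _
      conv_lhs => rw [hdec]
      rw [map_add, map_add, hL2p, add_zero]
      congr 1
      change A0 p - (α : ℂ) • p = _
      rw [hpm, Complex.ofReal_sub, sub_smul]
    rw [← this]; abel
  have hK1 : ∀ x, inner ℂ (K u) x = inner ℂ (S u) (S x) := inner_mul_self_apply hS hSK u
  have hK2 : ∀ x, (inner ℂ x (K u)).re = (inner ℂ (S u) (S x)).re := fun x => by
    rw [← hK1, ← inner_conj_symm, Complex.conj_re]
  have hSu : S u = S p + S p' + S w := by rw [← map_add, ← map_add, ← hdec]
  have hKK : (inner ℂ (K u) (K u)).re = ‖K u‖ ^ 2 := by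
    rw [inner_self_eq_norm_sq_to_K]; norm_cast
  have hSK' : (inner ℂ (S u) (S (K u))).re = ‖K u‖ ^ 2 := by rw [← hK1, hKK]
  have hexp : (inner ℂ (A u - (β : ℂ) • u) (A u - (α : ℂ) • u)).re =
      (inner ℂ (L1 w) (L2 w)).re + s * (inner ℂ (S u) (S p')).re - σ * (inner ℂ (S u) (S (L1 w))).re
        - s * (inner ℂ (S u) (S p)).re - σ * (inner ℂ (S u) (S (L2 w))).re + ‖K u‖ ^ 2 := by
    rw [e1, e2]
    simp only [inner_sub_left, inner_sub_right, inner_add_left, inner_add_right, inner_smul_left,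
      inner_smul_right, Complex.conj_ofReal, o1, o2, o3, mul_zero, Complex.add_re, Complex.sub_re,
      Complex.re_ofReal_mul, hK2, hK1, Complex.zero_re]
    rw [hSK', hs_def]
    linear_combination (‖K u‖ ^ 2) * hσ
  have hn : ∀ x y : H, |(inner ℂ x y).re| ≤ ‖x‖ * ‖y‖ := fun x y =>
    (Complex.abs_re_le_norm _).trans (norm_inner_le_norm x y)
  have hbd : ∀ x ∈ Fᗮ, ‖x‖ ≤ M * ‖w‖ → ‖S x‖ ≤ √D2 * ‖w‖ := by
    intro x hx hxM
    have h1 := hFs x hx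
    rw [quadForm_eq_norm_sq hS hSK] at h1
    refine abs_le_of_sq_le_sq' ?_ (by positivity) |>.2
    rw [mul_pow, Real.sq_sqrt hD2p.le]
    calc ‖S x‖ ^ 2 ≤ D2 / M ^ 2 * ‖x‖ ^ 2 := h1
      _ ≤ D2 / M ^ 2 * (M * ‖w‖) ^ 2 := by gcongr
      _ = D2 * ‖w‖ ^ 2 := by field_simp
  have b0 : ‖S w‖ ≤ √D2 * ‖w‖ := hbd w hu0 (by
    have : 1 ≤ M := by rw [hM]; linarith [norm_nonneg L1, norm_nonneg L2]
    nlinarith [norm_nonneg w])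
  have b1 : ‖S (L1 w)‖ ≤ √D2 * ‖w‖ := hbd _ hu1 ((L1.le_opNorm w).trans (by
    gcongr; rw [hM]; linarith [norm_nonneg L2]))
  have b2 : ‖S (L2 w)‖ ≤ √D2 * ‖w‖ := hbd _ hu2 ((L2.le_opNorm w).trans (by
    gcongr; rw [hM]; linarith [norm_nonneg L1]))
  rw [quadForm_gapOp hA, hexp, quadForm_eq_norm_sq hS hSK]
  have c1 : (inner ℂ (S u) (S p')).re - (inner ℂ (S u) (S p)).re ≥
      ‖S p'‖ ^ 2 - ‖S p‖ ^ 2 - (‖S p‖ + ‖S p'‖) * ‖S w‖ := by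
    have x1 : (inner ℂ (S p) (S p')).re = (inner ℂ (S p') (S p)).re := by
      rw [← inner_conj_symm, Complex.conj_re]
    have x2 : ∀ z : H, (inner ℂ z z).re = ‖z‖ ^ 2 := fun z => by
      rw [inner_self_eq_norm_sq_to_K]; norm_cast
    rw [hSu]
    simp only [inner_add_left, Complex.add_re, x2, x1]
    have y1 := abs_le.1 (hn (S w) (S p))
    have y2 := abs_le.1 (hn (S w) (S p'))
    linarith [y1.2, y2.1]
  have hSun : ‖S u‖ ≤ ‖S p‖ + ‖S p'‖ + ‖S w‖ := by
    rw [hSu]; exact norm_add₃_le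
  have hσ1 : |σ| = 1 := by rw [← Real.sqrt_sq_eq_abs, hσ, Real.sqrt_one]
  have c2 : ∀ x, ‖S x‖ ≤ √D2 * ‖w‖ → σ * (inner ℂ (S u) (S x)).re ≤
      (‖S p‖ + ‖S p'‖ + √D2 * ‖w‖) * (√D2 * ‖w‖) := by
    intro x hx
    calc σ * (inner ℂ (S u) (S x)).re ≤ |σ * (inner ℂ (S u) (S x)).re| := le_abs_self _
      _ = |(inner ℂ (S u) (S x)).re| := by rw [abs_mul, hσ1, one_mul]
      _ ≤ ‖S u‖ * ‖S x‖ := hn _ _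
      _ ≤ _ := by gcongr; exact hSun.trans (by gcongr)
  have d1 := c2 _ b1
  have d2 := c2 _ b2
  have hd2 : ((s + 2) ^ 2 / (2 * s) + 2) * (√D2 * ‖w‖) ^ 2 = η * ‖w‖ ^ 2 := by
    rw [mul_pow, Real.sq_sqrt hD2p.le, hD2]
    have : (s + 2) ^ 2 / (2 * s) + 2 ≠ 0 := by positivity
    field_simp
  exact gapOp_scalar_bound hs (norm_nonneg _) (norm_nonneg _) b0 hd2 hmain c1.le d1 d2 (sq_nonneg _)

end AbstractForms

/-! ### Counting eigenvalues of `A` between `α` and `β` by the form of `gapOp`. -/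

section SpectralCounting

variable {H : Type*} [NormedAddCommGroup H] [InnerProductSpace ℂ H] [CompleteSpace H]

/-- `K` is a norm limit of the finite-rank operators `K * F.starProjection`: with `K = S²`, on `Fᗮ`
the norm of `S v` is small, and `‖K v‖ ≤ ‖S‖ ‖S v‖`. -/
theorem isCompactOperator_of_formSmall {K : H →L[ℂ] H} (hK : K.IsPositive) (hs : FormSmall K) :
    IsCompactOperator K := by
  obtain ⟨S, hS, hSK⟩ := exists_selfAdjoint_sqrt hK
  have hcl := isClosed_setOfPred_isCompactOperator (𝕜₁ := ℂ) (𝕜₂ := ℂ) (σ₁₂ := RingHom.id ℂ)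
    (M₁ := H) (M₂ := H)
  refine hcl.closure_subset (Metric.mem_closure_iff.2 fun ε hε => ?_)
  set δ : ℝ := (ε / (2 * (‖S‖ + 1))) ^ 2 with hδ
  obtain ⟨F, hF, hFs⟩ := hs δ (by positivity)
  have hc : IsCompactOperator (K * F.starProjection : H →L[ℂ] H) := by
    have : ProperSpace F := FiniteDimensional.proper ℂ F
    have h1 : IsCompactOperator (F.orthogonalProjectionOnto : H →L[ℂ] F) :=
      isCompactOperator_of_locallyCompactSpace_dom _
    exact h1.clm_comp (K ∘L F.subtypeL)
  refine ⟨K * F.starProjection, hc, ?_⟩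
  rw [dist_eq_norm]
  refine lt_of_le_of_lt (ContinuousLinearMap.opNorm_le_bound _ (M := ε / 2) (by positivity)
    fun u => ?_) (half_lt_self hε)
  have h1 : (K - K * F.starProjection) u = K (u - F.starProjection u) := by
    rw [map_sub]; rfl
  have h2 : u - F.starProjection u ∈ Fᗮ := Submodule.sub_starProjection_mem_orthogonal u
  have h3 := hFs _ h2
  rw [quadForm_eq_norm_sq hS hSK] at h3
  have h4 : ‖u - F.starProjection u‖ ≤ ‖u‖ := by
    have := Submodule.norm_sq_eq_add_norm_sq_starProjection u F
    rw [Submodule.starProjection_orthogonal_val] at this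
    exact abs_le_of_sq_le_sq' (by nlinarith [sq_nonneg ‖F.starProjection u‖]) (norm_nonneg _) |>.2
  set v := u - F.starProjection u
  have h5 : ‖S v‖ ≤ ε / (2 * (‖S‖ + 1)) * ‖u‖ := by
    refine abs_le_of_sq_le_sq' ?_ (by positivity) |>.2
    rw [mul_pow, ← hδ]
    exact h3.trans (by gcongr)
  rw [h1, ← hSK]
  calc ‖(S * S) v‖ = ‖S (S v)‖ := rfl
    _ ≤ ‖S‖ * ‖S v‖ := S.le_opNorm _
    _ ≤ (‖S‖ + 1) * (ε / (2 * (‖S‖ + 1)) * ‖u‖) := by gcongr; linarith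
    _ = ε / 2 * ‖u‖ := by field_simp

theorem quadForm_mono {S T : H →L[ℂ] H} (h : S ≤ T) (u : H) : quadForm S u ≤ quadForm T u := by
  have := ((ContinuousLinearMap.le_def S T).1 h).2 u
  rw [ContinuousLinearMap.reApplyInnerSelf] at this
  have e : (inner ℂ ((T - S) u) u) = inner ℂ (T u) u - inner ℂ (S u) u := by
    rw [← inner_sub_left]; rfl
  rw [e] at this
  simpa [quadForm] using this

theorem quadForm_add (S T : H →L[ℂ] H) (u : H) :
    quadForm (S + T) u = quadForm S u + quadForm T u := by
  have e : (inner ℂ ((S + T) u) u) = inner ℂ (S u) u + inner ℂ (T u) u := by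
    rw [← inner_add_left]; rfl
  rw [quadForm, e, Complex.add_re]; rfl

theorem quadForm_real_smul (c : ℝ) (T : H →L[ℂ] H) (u : H) :
    quadForm (c • T) u = c * quadForm T u := by
  have e : (inner ℂ ((c • T) u) u) = (c : ℂ) * inner ℂ (T u) u := by
    rw [show (c • T) u = (c : ℂ) • T u from rfl, inner_smul_left, Complex.conj_ofReal]
  rw [quadForm, e, Complex.re_ofReal_mul]; rfl

theorem quadForm_one (u : H) : quadForm (1 : H →L[ℂ] H) u = ‖u‖ ^ 2 := by
  rw [quadForm, one_apply_eq_self, inner_self_eq_norm_sq_to_K]; norm_cast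

theorem quadForm_sandwich {S : H →L[ℂ] H} (hS : IsSelfAdjoint S) (B : H →L[ℂ] H) (u : H) :
    quadForm (S * B * S) u = quadForm B (S u) := by
  rw [quadForm, show (S * B * S) u = S (B (S u)) from rfl]
  exact congrArg Complex.re (hS.isSymmetric (B (S u)) u)

/-- The quadratic polynomial `-(x - α)(x - β)`. -/
def gapPoly (α β x : ℝ) : ℝ := -((x - α) * (x - β))

theorem continuous_gapPoly (α β : ℝ) : Continuous (gapPoly α β) := by
  unfold gapPoly; fun_prop

theorem gapOp_eq_cfc {A : H →L[ℂ] H} (hA : IsSelfAdjoint A) (α β : ℝ) :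
    gapOp A α β = cfc (gapPoly α β) A := by
  have h1 : ∀ γ : ℝ, cfc (fun x : ℝ => x - γ) A = A - (γ : ℂ) • (1 : H →L[ℂ] H) := fun γ => by
    rw [cfc_sub (fun x : ℝ => x) (fun _ => γ) A, cfc_id' ℝ A, cfc_const γ A]
    rfl
  unfold gapPoly
  rw [cfc_neg, cfc_mul (fun x : ℝ => x - α) (fun x : ℝ => x - β) A, h1, h1]
  rfl

/-- The positive part of `-(A - α)(A - β) - s`. -/
noncomputable def gapPos (A : H →L[ℂ] H) (α β s : ℝ) : H →L[ℂ] H :=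
  cfc (fun x => max 0 (gapPoly α β x - s)) A

theorem continuous_gapPosFun (α β s : ℝ) : Continuous fun x => max 0 (gapPoly α β x - s) :=
  continuous_const.max ((continuous_gapPoly α β).sub continuous_const)

theorem gapPos_nonneg (A : H →L[ℂ] H) (α β s : ℝ) : 0 ≤ gapPos A α β s :=
  cfc_nonneg fun _ _ => le_max_left _ _

theorem isSelfAdjoint_gapPos (A : H →L[ℂ] H) (α β s : ℝ) : IsSelfAdjoint (gapPos A α β s) :=
  (gapPos_nonneg A α β s).isSelfAdjoint

/-- With `y = g - s`, this is `y₊ g = y₊² + s y₊`. It serves to read off the value of `g` on an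
eigenvector of `gapPos` with non-zero eigenvalue. -/
theorem gapPos_mul {A : H →L[ℂ] H} (hA : IsSelfAdjoint A) (α β s : ℝ) :
    gapPos A α β s * gapOp A α β =
      gapPos A α β s * gapPos A α β s + s • gapPos A α β s := by
  have c1 := (continuous_gapPosFun α β s).continuousOn (s := spectrum ℝ A)
  have c2 := (continuous_gapPoly α β).continuousOn (s := spectrum ℝ A)
  rw [gapOp_eq_cfc hA, gapPos, ← cfc_mul _ _ A c1 c2, ← cfc_mul _ _ A c1 c1,
    ← cfc_smul s _ A c1, ← cfc_add A (fun x => max 0 (gapPoly α β x - s) *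
      max 0 (gapPoly α β x - s)) (fun x => s • max 0 (gapPoly α β x - s)) (c1.mul c1)
      (c1.const_smul s)]
  congr 1
  ext x
  simp only [smul_eq_mul]
  rcases le_total 0 (gapPoly α β x - s) with h | h
  · rw [max_eq_right h]; ring
  · rw [max_eq_left h]; ring

theorem gapPos_commute {A : H →L[ℂ] H} (hA : IsSelfAdjoint A) (α β s : ℝ) :
    Commute (gapPos A α β s) A := by
  have := cfc_commute_cfc (fun x => max 0 (gapPoly α β x - s)) id A
  rwa [cfc_id ℝ A] at this

/-- The upper bound on the form of `gapOp` does not pass directly to its positive part, since the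
subspaces involved are not spectral. The inequality `y ≤ k + y³/k²` gives `S ≤ k + k⁻² S (gapOp) S`,
so that the form of `gapOp` is evaluated at `S u`, which can be kept in a space of finite
codimension. -/
theorem gapPos_formSmall {A : H →L[ℂ] H} (hA : IsSelfAdjoint A) {α β s : ℝ} (hs : 0 ≤ s)
    (hB : FormSmall (gapOp A α β)) : FormSmall (gapPos A α β s) := by
  intro ε hε
  set S := gapPos A α β s with hS
  have hSsa : IsSelfAdjoint S := isSelfAdjoint_gapPos A α β s
  have c1 := (continuous_gapPosFun α β s).continuousOn (s := spectrum ℝ A)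
  have c2 := (continuous_gapPoly α β).continuousOn (s := spectrum ℝ A)
  have c3 : ContinuousOn (fun x => max 0 (gapPoly α β x - s) * gapPoly α β x *
      max 0 (gapPoly α β x - s)) (spectrum ℝ A) := (c1.mul c2).mul c1
  set k : ℝ := ε / 2 with hk
  have hk0 : 0 < k := half_pos hε
  have hle : S ≤ k • (1 : H →L[ℂ] H) + (k ^ 2)⁻¹ • (S * gapOp A α β * S) := by
    have e1 : k • (1 : H →L[ℂ] H) = cfc (fun _ : ℝ => k) A := by
      rw [cfc_const k A]; rfl
    rw [e1, gapOp_eq_cfc hA, hS, gapPos, ← cfc_mul _ _ A c1 c2,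
      ← cfc_mul (fun x => max 0 (gapPoly α β x - s) * gapPoly α β x) _ A (c1.mul c2) c1,
      ← cfc_smul _ (fun x => max 0 (gapPoly α β x - s) * gapPoly α β x *
        max 0 (gapPoly α β x - s)) A c3, ← cfc_add A (fun _ => k)
        (fun x => (k ^ 2)⁻¹ • (max 0 (gapPoly α β x - s) * gapPoly α β x *
        max 0 (gapPoly α β x - s))) continuousOn_const (c3.const_smul (k ^ 2)⁻¹)]
    refine cfc_mono (fun x _ => ?_) c1
      (continuousOn_const.add (c3.const_smul (k ^ 2)⁻¹))
    simp only [smul_eq_mul]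
    rcases le_total 0 (gapPoly α β x - s) with h | h
    · rw [max_eq_right h]
      set y := gapPoly α β x - s with hy
      have hy2 : gapPoly α β x = y + s := by rw [hy]; ring
      rw [hy2]
      have h1 : (k ^ 2)⁻¹ * y ^ 3 ≤ (k ^ 2)⁻¹ * (y * (y + s) * y) := by
        gcongr; nlinarith [mul_nonneg (mul_nonneg h h) hs]
      have h2 : y ≤ k + (k ^ 2)⁻¹ * y ^ 3 := by
        rcases le_total y k with h3 | h3
        · have : 0 ≤ (k ^ 2)⁻¹ * y ^ 3 := by positivity
          linarith
        · have : y ≤ (k ^ 2)⁻¹ * y ^ 3 := by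
            rw [le_inv_mul_iff₀ (by positivity)]
            have : k ^ 2 ≤ y ^ 2 := by gcongr
            nlinarith
          linarith
      exact h2.trans (by linarith)
    · rw [max_eq_left h]; simp; linarith
  obtain ⟨F, hF, hFs⟩ := hB (k ^ 3 / (‖S‖ + 1) ^ 2) (by positivity)
  obtain ⟨G, hG, hG'⟩ := finiteDimensional_preimage_orthogonal (F := F) S
  refine ⟨G, hG, fun u hu => ?_⟩
  have h1 := quadForm_mono hle u
  rw [quadForm_add, quadForm_real_smul, quadForm_one, quadForm_real_smul,
    quadForm_sandwich hSsa] at h1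
  have h2 := hFs _ (hG' u hu)
  have h3 : ‖S u‖ ≤ (‖S‖ + 1) * ‖u‖ := (S.le_opNorm u).trans (by gcongr; linarith)
  have h4 : (k ^ 2)⁻¹ * quadForm (gapOp A α β) (S u) ≤ k * ‖u‖ ^ 2 := by
    calc (k ^ 2)⁻¹ * quadForm (gapOp A α β) (S u)
        ≤ (k ^ 2)⁻¹ * (k ^ 3 / (‖S‖ + 1) ^ 2 * ((‖S‖ + 1) * ‖u‖) ^ 2) := by
          gcongr; exact h2.trans (by gcongr)
      _ = k * ‖u‖ ^ 2 := by field_simp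
  calc quadForm S u ≤ k * ‖u‖ ^ 2 + k * ‖u‖ ^ 2 := h1.trans (by linarith)
    _ = ε * ‖u‖ ^ 2 := by rw [hk]; ring

theorem quadForm_gapOp_le_gapPos {A : H →L[ℂ] H} (hA : IsSelfAdjoint A) (α β s : ℝ) (u : H) :
    quadForm (gapOp A α β) u ≤ s * ‖u‖ ^ 2 + quadForm (gapPos A α β s) u := by
  have c1 := (continuous_gapPosFun α β s).continuousOn (s := spectrum ℝ A)
  have c2 := (continuous_gapPoly α β).continuousOn (s := spectrum ℝ A)
  have hle : gapOp A α β ≤ s • (1 : H →L[ℂ] H) + gapPos A α β s := by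
    have e1 : s • (1 : H →L[ℂ] H) = cfc (fun _ : ℝ => s) A := by
      rw [cfc_const s A]; rfl
    rw [e1, gapOp_eq_cfc hA, gapPos, ← cfc_add A _ _ continuousOn_const c1]
    refine cfc_mono (fun x _ => ?_) c2 (continuousOn_const.add c1)
    linarith [le_max_right 0 (gapPoly α β x - s)]
  have := quadForm_mono hle u
  rwa [quadForm_add, quadForm_real_smul, quadForm_one] at this

theorem gapOp_apply_of_eigen {A : H →L[ℂ] H} {α β t : ℝ} {v : H} (hv : A v = (t : ℂ) • v) :
    gapOp A α β v = (gapPoly α β t : ℂ) • v := by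
  have h1 : ∀ γ : ℝ, (A - (γ : ℂ) • (1 : H →L[ℂ] H)) v = ((t - γ : ℝ) : ℂ) • v := fun γ => by
    change A v - (γ : ℂ) • v = _
    rw [hv, Complex.ofReal_sub, sub_smul]
  change -((A - (α : ℂ) • (1 : H →L[ℂ] H)) ((A - (β : ℂ) • (1 : H →L[ℂ] H)) v)) = _
  rw [h1, map_smul, h1, smul_smul, gapPoly, ← neg_smul]
  congr 1
  push_cast; ring

/-- On the orthogonal complement `N` of the eigenspaces with `gapPoly > s` the compact operator `S =
gapPos` has no non-zero eigenvalue, hence vanishes there, and `gapOp ≤ s + S` gives the bound. -/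
theorem quadForm_gapOp_le_of_orthogonal {A : H →L[ℂ] H} (hA : IsSelfAdjoint A) {α β s : ℝ}
    (hs : 0 ≤ s) (hB : FormSmall (gapOp A α β)) {u : H}
    (hu : ∀ t, s < gapPoly α β t → ∀ v ∈ eigenKer A t, inner ℂ v u = 0) :
    quadForm (gapOp A α β) u ≤ s * ‖u‖ ^ 2 := by
  set S := gapPos A α β s with hS
  have hSsa : IsSelfAdjoint S := isSelfAdjoint_gapPos A α β s
  have hSp : S.IsPositive := (ContinuousLinearMap.nonneg_iff_isPositive S).1 (gapPos_nonneg A α β s)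
  have hSc : IsCompactOperator S := isCompactOperator_of_formSmall hSp (gapPos_formSmall hA hs hB)
  have hcomm : ∀ x, S (A x) = A (S x) := fun x =>
    congrArg (fun T : H →L[ℂ] H => T x) (gapPos_commute hA α β s).eq
  set N : Submodule ℂ H := (⨆ t : {t : ℝ // s < gapPoly α β t}, eigenKer A t)ᗮ with hN
  have hNmem : ∀ x, x ∈ N ↔ ∀ t, s < gapPoly α β t → ∀ v ∈ eigenKer A t, inner ℂ v x = 0 := by
    intro x
    rw [hN, ← Submodule.iInf_orthogonal, Submodule.mem_iInf]
    simp only [Submodule.mem_orthogonal, Subtype.forall]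
  have hNS : ∀ x ∈ N, S x ∈ N := by
    intro x hx
    rw [hNmem] at hx ⊢
    intro t ht v hv
    rw [← show inner ℂ (S v) x = inner ℂ v (S x) from hSsa.isSymmetric v x]
    refine hx t ht _ (mem_eigenKer.2 ?_)
    rw [← hcomm, mem_eigenKer.1 hv, map_smul]
  have hNA : ∀ x ∈ N, A x ∈ N := by
    intro x hx
    rw [hNmem] at hx ⊢
    intro t ht v hv
    rw [← show inner ℂ (A v) x = inner ℂ v (A x) from hA.isSymmetric v x, mem_eigenKer.1 hv,
      inner_smul_left, hx t ht v hv, mul_zero]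
  have hNc : CompleteSpace N := (Submodule.isClosed_orthogonal _).completeSpace_coe
  let S' : N →L[ℂ] N := S.restrict hNS
  have hS'c : IsCompactOperator S' := hSc.restrict' hNS
  have hS's : S'.IsSymmetric := hSsa.isSymmetric.restrict_invariant hNS
  have hzero : S' = 0 := by
    rw [← ContinuousLinearMap.eq_zero_of_forall_hasEigenvalue_eq_zero hS'c hS's]
    intro μ hμ
    by_contra hμ0
    let A' : N →ₗ[ℂ] N := A.toLinearMap.restrict hNA
    have hfd : FiniteDimensional ℂ (Module.End.eigenspace (S' : N →ₗ[ℂ] N) μ) :=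
      ContinuousLinearMap.finite_dimensional_eigenspace hS'c μ hμ0
    -- Since `S` commutes with `A`, this finite-dimensional space is invariant under `A` and
    -- contains a common eigenvector of `A` and `S`.
    have hinv : ∀ x ∈ Module.End.eigenspace (S' : N →ₗ[ℂ] N) μ,
        A' x ∈ Module.End.eigenspace (S' : N →ₗ[ℂ] N) μ := by
      intro x hx
      rw [Module.End.mem_eigenspace_iff] at hx ⊢
      apply Subtype.ext
      have hx' : S (x : H) = μ • (x : H) := congrArg Subtype.val hx
      change S (A (x : H)) = μ • A (x : H)
      rw [hcomm, hx', map_smul]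
    have hnt : Nontrivial (Module.End.eigenspace (S' : N →ₗ[ℂ] N) μ) := by
      rw [Submodule.nontrivial_iff_ne_bot]; exact hμ
    obtain ⟨t, ht⟩ := Module.End.exists_eigenvalue (A'.restrict hinv)
    obtain ⟨v, hv⟩ := ht.exists_hasEigenvector
    have hv0 : ((v : N) : H) ≠ 0 := by
      have := hv.2
      simpa using this
    have hAv : A ((v : N) : H) = t • ((v : N) : H) :=
      congrArg (fun z : Module.End.eigenspace (S' : N →ₗ[ℂ] N) μ => ((z : N) : H)) hv.apply_eq_smul
    have hSv : S ((v : N) : H) = μ • ((v : N) : H) :=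
      congrArg (fun z : N => (z : H)) (Module.End.mem_eigenspace_iff.1 v.2)
    have hreal : ∀ {T : H →L[ℂ] H} {z : ℂ} {x : H}, IsSelfAdjoint T → x ≠ 0 → T x = z • x →
        ((z.re : ℝ) : ℂ) = z := by
      intro T z x hT hx hTx
      have hz : Module.End.HasEigenvalue T.toLinearMap z :=
        Module.End.hasEigenvalue_of_hasEigenvector (x := x) ⟨Module.End.mem_eigenspace_iff.2 hTx, hx⟩
      exact Complex.conj_eq_iff_re.1 (hT.isSymmetric.conj_eigenvalue_eq_self hz)
    have htr := hreal hA hv0 hAv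
    have hμr := hreal hSsa hv0 hSv
    rw [← htr] at hAv
    replace hSv : S ((v : N) : H) = ((μ.re : ℝ) : ℂ) • ((v : N) : H) := by rw [hμr]; exact hSv
    -- On the common eigenvector this reads `g μ = μ² + s μ`, so `g = μ + s > s`: the vector lies in
    -- one of the eigenspaces to which `N` is orthogonal.
    have hprod := congrArg (fun T : H →L[ℂ] H => T ((v : N) : H)) (gapPos_mul hA α β s)
    change S (gapOp A α β ((v : N) : H)) = S (S ((v : N) : H)) + (s : ℂ) • S ((v : N) : H) at hprod
    rw [gapOp_apply_of_eigen hAv, map_smul, hSv, map_smul, hSv, smul_smul, smul_smul, smul_smul,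
      ← add_smul] at hprod
    have hprod2 := smul_left_injective ℂ hv0 hprod
    have hprod3 : gapPoly α β t.re * μ.re = μ.re * μ.re + s * μ.re := by exact_mod_cast hprod2
    have hμre : μ.re ≠ 0 := fun h => hμ0 (by rw [← hμr, h]; simp)
    have hμpos : 0 < μ.re := by
      have h1 : 0 ≤ quadForm S ((v : N) : H) := hSp.2 _
      rw [quadForm, hSv, inner_smul_left, inner_self_eq_norm_sq_to_K, Complex.conj_ofReal,
        Complex.re_ofReal_mul] at h1
      have h2 : (((‖((v : N) : H)‖ : ℝ) : ℂ) ^ 2).re = ‖((v : N) : H)‖ ^ 2 := by norm_cast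
      simp only [Complex.coe_algebraMap, h2] at h1
      have h3 : 0 < ‖((v : N) : H)‖ ^ 2 := by positivity
      exact lt_of_le_of_ne (nonneg_of_mul_nonneg_left h1 h3) hμre.symm
    have hg : gapPoly α β t.re = μ.re + s := by
      have : gapPoly α β t.re * μ.re = (μ.re + s) * μ.re := by rw [hprod3]; ring
      exact mul_right_cancel₀ hμre this
    have := (hNmem _).1 (v : N).2 t.re (by rw [hg]; linarith) _ (mem_eigenKer.2 hAv)
    exact hv0 (inner_self_eq_zero.1 this)
  have huN : u ∈ N := (hNmem u).2 hu
  have hSu : S u = 0 := by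
    have := congrArg (fun T : N →L[ℂ] N => ((T ⟨u, huN⟩ : N) : H)) hzero
    exact this
  have := quadForm_gapOp_le_gapPos hA α β s u
  rw [← hS] at this
  rw [quadForm, quadForm, hSu, inner_zero_left] at this
  simpa [quadForm] using this

theorem quadForm_gapOp_sum {A : H →L[ℂ] H} (hA : IsSelfAdjoint A) {α β s : ℝ} (S : Finset ℝ)
    (hS : ∀ t ∈ S, s ≤ gapPoly α β t) (v : ∀ t : S, eigenKer A t) :
    s * ∑ t, ‖(v t : H)‖ ^ 2 ≤ quadForm (gapOp A α β) (∑ t, (v t : H)) ∧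
      ‖∑ t, (v t : H)‖ ^ 2 = ∑ t, ‖(v t : H)‖ ^ 2 := by
  have horth : ∀ t t' : S, t ≠ t' → inner ℂ (v t : H) (v t' : H) = 0 := fun t t' h =>
    inner_eq_zero_of_eigen hA (fun h' => h (Subtype.ext h')) (mem_eigenKer.1 (v t).2)
      (mem_eigenKer.1 (v t').2)
  have hkey : ∀ c : S → ℝ, (inner ℂ (∑ t, (c t : ℂ) • (v t : H)) (∑ t, (v t : H))).re
      = ∑ t, c t * ‖(v t : H)‖ ^ 2 := by
    intro c
    rw [sum_inner, Complex.re_sum]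
    refine Finset.sum_congr rfl fun t _ => ?_
    rw [inner_smul_left, inner_sum, Finset.sum_eq_single t (fun t' _ h => horth t t' h.symm)
      (fun h => absurd (Finset.mem_univ t) h), inner_self_eq_norm_sq_to_K, Complex.conj_ofReal,
      Complex.re_ofReal_mul]
    norm_cast
  constructor
  · have h1 : gapOp A α β (∑ t, (v t : H)) = ∑ t : S, ((gapPoly α β t : ℝ) : ℂ) • (v t : H) := by
      rw [map_sum]
      exact Finset.sum_congr rfl fun t _ => gapOp_apply_of_eigen (mem_eigenKer.1 (v t).2)
    rw [quadForm, h1, hkey fun t => gapPoly α β t, Finset.mul_sum]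
    exact Finset.sum_le_sum fun t _ => by gcongr; exact hS t t.2
  · have h1 := hkey fun _ => 1
    simp only [Complex.ofReal_one, one_smul, one_mul] at h1
    rw [← h1, inner_self_eq_norm_sq_to_K]
    norm_cast

/-- Orthogonal projection to `F` is injective on the sum of the eigenspaces: on a non-zero vector of
its kernel the form would be both at least and less than `s` times the squared norm. -/
theorem finite_and_sum_finrank_le {A : H →L[ℂ] H} (hA : IsSelfAdjoint A) {α β s : ℝ}
    {F : Submodule ℂ H} [FiniteDimensional ℂ F]
    (hF : ∀ u ∈ Fᗮ, u ≠ 0 → quadForm (gapOp A α β) u < s * ‖u‖ ^ 2) (S : Finset ℝ)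
    (hS : ∀ t ∈ S, s ≤ gapPoly α β t) :
    (∀ t ∈ S, FiniteDimensional ℂ (eigenKer A t)) ∧
      ∑ t ∈ S, Module.finrank ℂ (eigenKer A t) ≤ Module.finrank ℂ F := by
  classical
  let Φ : (∀ t : S, eigenKer A t) →ₗ[ℂ] F :=
    (F.orthogonalProjectionOnto : H →ₗ[ℂ] F) ∘ₗ
      ∑ t : S, (eigenKer A t).subtype ∘ₗ LinearMap.proj t
  have hΦ : Function.Injective Φ := by
    rw [injective_iff_map_eq_zero]
    intro v hv
    obtain ⟨h1, h2⟩ := quadForm_gapOp_sum hA S hS v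
    have hv' : F.orthogonalProjectionOnto (∑ t, (v t : H)) = 0 := by
      simpa [Φ] using hv
    rw [Submodule.orthogonalProjectionOnto_eq_zero_iff] at hv'
    have h3 : ∑ t, (v t : H) = 0 := by
      by_contra h
      have := hF _ hv' h
      rw [h2] at this
      linarith
    rw [h3, norm_zero, zero_pow two_ne_zero] at h2
    have h4 := (Finset.sum_eq_zero_iff_of_nonneg (fun t _ => by positivity)).1 h2.symm
    funext t
    have := h4 t (Finset.mem_univ t)
    simpa using this
  have hfin : FiniteDimensional ℂ (∀ t : S, eigenKer A t) := Module.Finite.of_injective Φ hΦ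
  have hfin1 : ∀ t : S, FiniteDimensional ℂ (eigenKer A t) := fun t =>
    Module.Finite.of_surjective (LinearMap.proj t : (∀ t : S, eigenKer A t) →ₗ[ℂ] _)
      (LinearMap.proj_surjective t)
  refine ⟨fun t ht => hfin1 ⟨t, ht⟩, ?_⟩
  have := LinearMap.finrank_le_finrank_of_injective hΦ
  rwa [Module.finrank_pi_fintype, Finset.sum_coe_sort S
    (fun t => Module.finrank ℂ (eigenKer A t))] at this

/-- Only finitely many eigenvalues have `gapPoly > s`. Projecting `L` to the sum of their
eigenspaces is injective, since a vector of the kernel is subject to the bound of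
`quadForm_gapOp_le_of_orthogonal`. -/
theorem exists_finset_le_sum_finrank {A : H →L[ℂ] H} (hA : IsSelfAdjoint A) {α β s : ℝ}
    (hs : 0 < s) (hB : FormSmall (gapOp A α β)) {L : Submodule ℂ H} [FiniteDimensional ℂ L]
    (hL : ∀ u ∈ L, u ≠ 0 → s * ‖u‖ ^ 2 < quadForm (gapOp A α β) u) :
    ∃ S : Finset ℝ, (∀ t ∈ S, s < gapPoly α β t) ∧
      Module.finrank ℂ L ≤ ∑ t ∈ S, Module.finrank ℂ (eigenKer A t) := by
  classical
  -- Half of `s` makes the comparison with `s` strict, as the upper count requires.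
  obtain ⟨F, hF, hFs⟩ := hB (s / 2) (by positivity)
  have hF' : ∀ u ∈ Fᗮ, u ≠ 0 → quadForm (gapOp A α β) u < s * ‖u‖ ^ 2 := by
    intro u hu hu0
    have : 0 < ‖u‖ ^ 2 := by positivity
    exact (hFs u hu).trans_lt (by nlinarith)
  have hfd : ∀ t, s < gapPoly α β t → FiniteDimensional ℂ (eigenKer A t) := fun t ht =>
    (finite_and_sum_finrank_le hA hF' {t} (by simpa using ht.le)).1 t (by simp)
  set T : Set ℝ := {t | s < gapPoly α β t ∧ eigenKer A t ≠ ⊥} with hT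
  have hTfin : T.Finite := by
    by_contra hinf
    obtain ⟨S, hS, hcard⟩ := Set.Infinite.exists_subset_card_eq hinf (Module.finrank ℂ F + 1)
    have h1 := (finite_and_sum_finrank_le hA hF' S fun t ht => (hS ht).1.le).2
    have h2 : ∑ t ∈ S, 1 ≤ ∑ t ∈ S, Module.finrank ℂ (eigenKer A t) := by
      refine Finset.sum_le_sum fun t ht => ?_
      have := hfd t (hS ht).1
      exact Nat.one_le_iff_ne_zero.2 fun h => (hS ht).2 (Submodule.finrank_eq_zero.1 h)
    rw [Finset.sum_const, hcard, smul_eq_mul, mul_one] at h2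
    omega
  set S := hTfin.toFinset with hS
  have hSmem : ∀ t ∈ S, s < gapPoly α β t := fun t ht => (hTfin.mem_toFinset.1 ht).1
  refine ⟨S, hSmem, ?_⟩
  by_contra! hlt
  have hfd' : ∀ t : S, FiniteDimensional ℂ (eigenKer A t) := fun t => hfd t (hSmem t t.2)
  let Ψ : L →ₗ[ℂ] (∀ t : S, eigenKer A t) :=
    LinearMap.pi fun t => ((eigenKer A t).orthogonalProjectionOnto : H →ₗ[ℂ] eigenKer A t) ∘ₗ L.subtype
  have hker : LinearMap.ker Ψ ≠ ⊥ := LinearMap.ker_ne_bot_of_finrank_lt (by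
    rwa [Module.finrank_pi_fintype, Finset.sum_coe_sort S
      (fun t => Module.finrank ℂ (eigenKer A t))])
  obtain ⟨u, hu, hu0⟩ := Submodule.exists_mem_ne_zero_of_ne_bot hker
  have hu0' : (u : H) ≠ 0 := by simpa using hu0
  have h1 := hL u u.2 hu0'
  refine absurd (quadForm_gapOp_le_of_orthogonal hA hs.le hB (u := u) ?_) (not_le.2 h1)
  intro t ht v hv
  by_cases hbot : eigenKer A t = ⊥
  · rw [hbot, Submodule.mem_bot] at hv
    rw [hv, inner_zero_left]
  have htS : t ∈ S := hTfin.mem_toFinset.2 ⟨ht, hbot⟩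
  have h2 : (eigenKer A t).orthogonalProjectionOnto (u : H) = 0 :=
    congrFun (LinearMap.mem_ker.1 hu) ⟨t, htS⟩
  rw [Submodule.orthogonalProjectionOnto_eq_zero_iff] at h2
  exact Submodule.inner_right_of_mem_orthogonal hv h2

end SpectralCounting

/-! ### Multiplication, derivatives and magnetic momenta on Schwartz functions. -/

section SchwartzOperators

/-- Complex Schwartz functions on the plane. -/
abbrev PlaneSchwartz : Type := 𝓢(Plane, ℂ)

/-- The inclusion of Schwartz functions into `L²`. -/
noncomputable def toL2 : PlaneSchwartz →L[ℂ] L2Plane := SchwartzMap.toLpCLM ℂ ℂ 2 volume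

theorem inner_toL2 (f g : PlaneSchwartz) :
    inner ℂ (toL2 f) (toL2 g) = ∫ x, inner ℂ (f x) (g x) :=
  SchwartzMap.inner_toL2_toL2_eq f g volume

theorem norm_toL2_sq (f : PlaneSchwartz) : ‖toL2 f‖ ^ 2 = ∫ x, ‖f x‖ ^ 2 := by
  have h1 : ((‖toL2 f‖ ^ 2 : ℝ) : ℂ) = ((∫ x, ‖f x‖ ^ 2 : ℝ) : ℂ) := by
    have := inner_toL2 f f
    rw [inner_self_eq_norm_sq_to_K] at this
    push_cast
    rw [← integral_complex_ofReal]
    rw [← Complex.coe_algebraMap, this]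
    refine integral_congr_ae (Filter.Eventually.of_forall fun x => ?_)
    simp only [inner_self_eq_norm_sq_to_K]
    norm_cast
  exact_mod_cast h1

theorem integrable_norm_sq (f : PlaneSchwartz) : Integrable fun x => ‖f x‖ ^ 2 := by
  have := (SchwartzMap.memLp f 2 (volume : Measure Plane)).integrable_norm_pow (by norm_num)
  simpa using this

/-- Multiplication by a function of temperate growth. -/
noncomputable def mulOp (g : Plane → ℂ) : PlaneSchwartz →L[ℂ] PlaneSchwartz :=
  SchwartzMap.smulLeftCLM ℂ g

/-- Partial derivatives. -/
noncomputable def partialOp (j : Fin 2) : PlaneSchwartz →L[ℂ] PlaneSchwartz :=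
  LineDeriv.lineDerivOpCLM ℂ PlaneSchwartz (EuclideanSpace.single j (1 : ℝ))

theorem mulOp_apply {g : Plane → ℂ} (hg : g.HasTemperateGrowth) (f : PlaneSchwartz) (x : Plane) :
    mulOp g f x = g x * f x := by
  simp [mulOp, hg]

theorem partialOp_apply (j : Fin 2) (f : PlaneSchwartz) (x : Plane) :
    partialOp j f x = fderiv ℝ f x (EuclideanSpace.single j 1) := by
  simp [partialOp, SchwartzMap.lineDerivOp_apply_eq_fderiv]

theorem partialOp_mulOp {j : Fin 2} {g g' : Plane → ℂ} (hg : g.HasTemperateGrowth)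
    (hg' : g'.HasTemperateGrowth) (h : ∀ x, fderiv ℝ g x (EuclideanSpace.single j 1) = g' x)
    (f : PlaneSchwartz) :
    partialOp j (mulOp g f) = mulOp g (partialOp j f) + mulOp g' f := by
  ext x
  rw [partialOp_apply, add_apply, mulOp_apply hg, mulOp_apply hg', partialOp_apply, ← h]
  have e : (mulOp g f : Plane → ℂ) = fun x => g x * f x := funext fun y => mulOp_apply hg f y
  rw [e, fderiv_fun_mul ((hg.1.differentiable (by simp)) x) f.differentiableAt]
  simp [mul_comm]

theorem partialOp_comm (i j : Fin 2) (f : PlaneSchwartz) :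
    partialOp i (partialOp j f) = partialOp j (partialOp i f) := by
  ext x
  have key : ∀ i j : Fin 2, partialOp i (partialOp j f) x =
      fderiv ℝ (fderiv ℝ f) x (EuclideanSpace.single i 1) (EuclideanSpace.single j 1) := by
    intro i j
    rw [partialOp_apply]
    have e : (partialOp j f : Plane → ℂ) = fun y => fderiv ℝ f y (EuclideanSpace.single j 1) :=
      funext fun y => partialOp_apply j f y
    have hd : DifferentiableAt ℝ (fderiv ℝ f) x :=
      (((f.smooth ⊤).fderiv_right (m := 1) (by norm_cast)).differentiable (by simp)) x
    rw [e, fderiv_clm_apply hd (differentiableAt_const _)]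
    simp
  rw [key, key]
  exact ((f.smooth 2).contDiffAt.isSymmSndFDerivAt (by simp)) _ _

theorem mulOp_comm {g h : Plane → ℂ} (hg : g.HasTemperateGrowth) (hh : h.HasTemperateGrowth)
    (f : PlaneSchwartz) : mulOp g (mulOp h f) = mulOp h (mulOp g f) := by
  ext x
  rw [mulOp_apply hg, mulOp_apply hh, mulOp_apply hh, mulOp_apply hg]; ring

theorem inner_partialOp (j : Fin 2) (f g : PlaneSchwartz) :
    inner ℂ (toL2 (partialOp j f)) (toL2 g) = -inner ℂ (toL2 f) (toL2 (partialOp j g)) := by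
  rw [inner_toL2, inner_toL2]
  have := SchwartzMap.integral_bilinear_lineDerivOp_right_eq_neg_left (μ := volume) f g
    ((ContinuousLinearMap.mul ℝ ℂ).comp (Complex.conjCLE : ℂ →L[ℝ] ℂ))
    (EuclideanSpace.single j (1 : ℝ))
  simp only [ContinuousLinearMap.comp_apply, ContinuousLinearMap.mul_apply',
    ContinuousLinearEquiv.coe_coe, Complex.conjCLE_apply] at this
  simp only [RCLike.inner_apply']
  exact (neg_eq_iff_eq_neg.2 this).symm

theorem inner_mulOp {g : Plane → ℂ} (hg : g.HasTemperateGrowth) {g' : Plane → ℂ}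
    (hg' : g'.HasTemperateGrowth) (h : ∀ x, g' x = starRingEnd ℂ (g x)) (f k : PlaneSchwartz) :
    inner ℂ (toL2 (mulOp g f)) (toL2 k) = inner ℂ (toL2 f) (toL2 (mulOp g' k)) := by
  rw [inner_toL2, inner_toL2]
  refine integral_congr_ae (Filter.Eventually.of_forall fun x => ?_)
  simp only [mulOp_apply hg, mulOp_apply hg', RCLike.inner_apply', map_mul, h]
  ring

theorem hasTemperateGrowth_magPotential (b : ℝ) (j : Fin 2) :
    (fun x : Plane => (magPotential b x j : ℂ)).HasTemperateGrowth := by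
  let L : Plane →L[ℝ] ℂ := Complex.ofRealCLM.comp
    (![-(b / 2) • (EuclideanSpace.proj 1 : Plane →L[ℝ] ℝ),
      (b / 2) • (EuclideanSpace.proj 0 : Plane →L[ℝ] ℝ)] j)
  have : (fun x : Plane => (magPotential b x j : ℂ)) = L := by
    ext x; fin_cases j <;> simp [L, magPotential]
  rw [this]
  exact L.hasTemperateGrowth

/-- The magnetic momentum as an operator on Schwartz functions. -/
noncomputable def momOp (b : ℝ) (j : Fin 2) : PlaneSchwartz →L[ℂ] PlaneSchwartz :=
  -Complex.I • partialOp j - mulOp fun x => (magPotential b x j : ℂ)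

theorem momOp_apply (b : ℝ) (j : Fin 2) (f : PlaneSchwartz) (x : Plane) :
    momOp b j f x = magMomentum b j f x := by
  change (-Complex.I • partialOp j f - mulOp (fun x => (magPotential b x j : ℂ)) f) x = _
  rw [sub_apply, smul_apply, partialOp_apply,
    mulOp_apply (hasTemperateGrowth_magPotential b j)]
  rfl

theorem momOp_eq (b : ℝ) (j : Fin 2) (f : PlaneSchwartz) :
    momOp b j f = -Complex.I • partialOp j f - mulOp (fun x => (magPotential b x j : ℂ)) f := rfl

theorem inner_momOp (b : ℝ) (j : Fin 2) (f g : PlaneSchwartz) :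
    inner ℂ (toL2 (momOp b j f)) (toL2 g) = inner ℂ (toL2 f) (toL2 (momOp b j g)) := by
  rw [momOp_eq, momOp_eq, map_sub, map_sub, inner_sub_left, inner_sub_right, map_smul, map_smul,
    inner_smul_left, inner_smul_right, inner_partialOp,
    inner_mulOp (hasTemperateGrowth_magPotential b j) (hasTemperateGrowth_magPotential b j)
      (fun x => (Complex.conj_ofReal _).symm)]
  simp

theorem momOp_mulOp (b : ℝ) {j : Fin 2} {g g' : Plane → ℂ} (hg : g.HasTemperateGrowth)
    (hg' : g'.HasTemperateGrowth) (h : ∀ x, fderiv ℝ g x (EuclideanSpace.single j 1) = g' x)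
    (f : PlaneSchwartz) :
    momOp b j (mulOp g f) = mulOp g (momOp b j f) - Complex.I • mulOp g' f := by
  rw [momOp_eq, momOp_eq, partialOp_mulOp hg hg' h,
    mulOp_comm (hasTemperateGrowth_magPotential b j) hg, map_sub, map_smul]
  module

theorem fderiv_magPotential (b : ℝ) (x : Plane) (j k : Fin 2) :
    fderiv ℝ (fun x : Plane => (magPotential b x j : ℂ)) x (EuclideanSpace.single k 1) =
      ![![0, -(b / 2 : ℂ)], ![(b / 2 : ℂ), 0]] j k := by
  let L : Plane →L[ℝ] ℂ := Complex.ofRealCLM.comp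
    (![-(b / 2) • (EuclideanSpace.proj 1 : Plane →L[ℝ] ℝ),
      (b / 2) • (EuclideanSpace.proj 0 : Plane →L[ℝ] ℝ)] j)
  have : (fun x : Plane => (magPotential b x j : ℂ)) = L := by
    ext x; fin_cases j <;> simp [L, magPotential]
  rw [this, ContinuousLinearMap.fderiv]
  fin_cases j <;> fin_cases k <;> simp [L]

/-- Only the derivatives of the potential survive; each of its two components contributes one half
of `I * b`. -/
theorem momOp_commutator (b : ℝ) (f : PlaneSchwartz) :
    momOp b 0 (momOp b 1 f) - momOp b 1 (momOp b 0 f) = (Complex.I * b) • f := by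
  have tg := hasTemperateGrowth_magPotential b
  have h1 : momOp b 0 (mulOp (fun x => (magPotential b x 1 : ℂ)) f) =
      mulOp (fun x => (magPotential b x 1 : ℂ)) (momOp b 0 f) -
        Complex.I • mulOp (fun _ => (b / 2 : ℂ)) f :=
    momOp_mulOp b (tg 1) (.const _) (fun x => by rw [fderiv_magPotential]; simp) f
  have h2 : momOp b 1 (mulOp (fun x => (magPotential b x 0 : ℂ)) f) =
      mulOp (fun x => (magPotential b x 0 : ℂ)) (momOp b 1 f) -
        Complex.I • mulOp (fun _ => (-(b / 2) : ℂ)) f :=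
    momOp_mulOp b (tg 0) (.const _) (fun x => by rw [fderiv_magPotential]; simp) f
  have c : ∀ c : ℂ, mulOp (fun _ => c) f = c • f := fun c => by
    ext x; rw [mulOp_apply (.const _)]; rfl
  rw [c] at h1 h2
  have e0 : momOp b 0 (momOp b 1 f) = -Complex.I • momOp b 0 (partialOp 1 f)
      - momOp b 0 (mulOp (fun x => (magPotential b x 1 : ℂ)) f) := by
    rw [momOp_eq b 1 f, map_sub, map_smul]
  have e1 : momOp b 1 (momOp b 0 f) = -Complex.I • momOp b 1 (partialOp 0 f)
      - momOp b 1 (mulOp (fun x => (magPotential b x 0 : ℂ)) f) := by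
    rw [momOp_eq b 0 f, map_sub, map_smul]
  rw [e0, e1, h1, h2, momOp_eq b 0 (partialOp 1 f), momOp_eq b 1 (partialOp 0 f), momOp_eq b 0 f,
    momOp_eq b 1 f, map_sub, map_sub, map_smul, map_smul,
    mulOp_comm (tg 1) (tg 0), partialOp_comm 0 1]
  module

end SchwartzOperators

/-! ### The two commuting pairs of ladder operators. -/

section Ladder

/-- The complex coordinate on the plane. -/
noncomputable def coordZ (x : Plane) : ℂ := x 0 + Complex.I * x 1

/-- The complex coordinate as a real linear map. -/
noncomputable def coordZL : Plane →L[ℝ] ℂ :=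
  Complex.ofRealCLM.comp (EuclideanSpace.proj 0 : Plane →L[ℝ] ℝ) +
    Complex.I • Complex.ofRealCLM.comp (EuclideanSpace.proj 1 : Plane →L[ℝ] ℝ)

theorem coordZL_apply (x : Plane) : coordZL x = coordZ x := by simp [coordZL, coordZ]

theorem norm_coordZ (x : Plane) : ‖coordZ x‖ = ‖x‖ := by
  rw [EuclideanSpace.norm_eq, Complex.norm_def, Complex.normSq_apply]
  simp [coordZ, Fin.sum_univ_two, sq]

theorem hasTemperateGrowth_coordZ : coordZ.HasTemperateGrowth := by
  have : coordZ = coordZL := funext fun x => (coordZL_apply x).symm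
  rw [this]; exact coordZL.hasTemperateGrowth

theorem fderiv_coordZ (x v : Plane) : fderiv ℝ coordZ x v = coordZ v := by
  have : coordZ = coordZL := funext fun x => (coordZL_apply x).symm
  rw [this, ContinuousLinearMap.fderiv]

/-- The conjugate complex coordinate on the plane. -/
noncomputable def coordZbar (x : Plane) : ℂ := starRingEnd ℂ (coordZ x)

theorem coordZbar_eq :
    coordZbar = ((Complex.conjCLE : ℂ →L[ℝ] ℂ).comp coordZL : Plane →L[ℝ] ℂ) := by
  ext x; simp [coordZbar, coordZL_apply]

theorem hasTemperateGrowth_coordZbar : coordZbar.HasTemperateGrowth := by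
  rw [coordZbar_eq]; exact ContinuousLinearMap.hasTemperateGrowth _

theorem fderiv_coordZbar (x v : Plane) : fderiv ℝ coordZbar x v = coordZbar v := by
  rw [coordZbar_eq, ContinuousLinearMap.fderiv]

/-- Multiplication by `z`. -/
noncomputable def zOp : PlaneSchwartz →L[ℂ] PlaneSchwartz := mulOp coordZ

/-- Multiplication by `z̄`. -/
noncomputable def zbarOp : PlaneSchwartz →L[ℂ] PlaneSchwartz := mulOp coordZbar

/-- The annihilation operator `Π₁ + i Π₂`. -/
noncomputable def annOp (b : ℝ) : PlaneSchwartz →L[ℂ] PlaneSchwartz :=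
  momOp b 0 + Complex.I • momOp b 1

/-- The creation operator `Π₁ - i Π₂`. -/
noncomputable def creOp (b : ℝ) : PlaneSchwartz →L[ℂ] PlaneSchwartz :=
  momOp b 0 - Complex.I • momOp b 1

/-- The Landau Hamiltonian on Schwartz functions. -/
noncomputable def landauOp (b : ℝ) : PlaneSchwartz →L[ℂ] PlaneSchwartz :=
  (momOp b 0).comp (momOp b 0) + (momOp b 1).comp (momOp b 1)

theorem annOp_apply (b : ℝ) (f : PlaneSchwartz) :
    annOp b f = momOp b 0 f + Complex.I • momOp b 1 f := rfl

theorem creOp_apply (b : ℝ) (f : PlaneSchwartz) :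
    creOp b f = momOp b 0 f - Complex.I • momOp b 1 f := rfl

theorem landauOp_apply (b : ℝ) (f : PlaneSchwartz) :
    landauOp b f = momOp b 0 (momOp b 0 f) + momOp b 1 (momOp b 1 f) := rfl

theorem inner_annOp (b : ℝ) (f g : PlaneSchwartz) :
    inner ℂ (toL2 (annOp b f)) (toL2 g) = inner ℂ (toL2 f) (toL2 (creOp b g)) := by
  rw [annOp_apply, creOp_apply, map_add, map_sub, inner_add_left, inner_sub_right, map_smul,
    map_smul, inner_smul_left, inner_smul_right, inner_momOp, inner_momOp, Complex.conj_I]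
  ring

theorem inner_creOp (b : ℝ) (f g : PlaneSchwartz) :
    inner ℂ (toL2 (creOp b f)) (toL2 g) = inner ℂ (toL2 f) (toL2 (annOp b g)) := by
  rw [← inner_conj_symm, ← inner_annOp, inner_conj_symm]

theorem inner_landauOp (b : ℝ) (f g : PlaneSchwartz) :
    inner ℂ (toL2 (landauOp b f)) (toL2 g) = inner ℂ (toL2 f) (toL2 (landauOp b g)) := by
  simp only [landauOp_apply, map_add, inner_add_left, inner_add_right, inner_momOp]

theorem landauOp_eq (b : ℝ) (f : PlaneSchwartz) :
    landauOp b f = creOp b (annOp b f) + (b : ℂ) • f := by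
  have h := momOp_commutator b f
  have h1 : (b : ℂ) • f = -Complex.I • (Complex.I * b : ℂ) • f := by
    rw [smul_smul]; congr 1; rw [← mul_assoc]; simp
  rw [h1, ← h, creOp_apply, annOp_apply, landauOp_apply, map_add, map_add, map_smul, map_smul]
  have hI : Complex.I * Complex.I = -1 := Complex.I_mul_I
  simp only [smul_add, smul_sub, smul_smul, hI, neg_smul, one_smul]
  abel

theorem annOp_creOp (b : ℝ) (f : PlaneSchwartz) :
    annOp b (creOp b f) = creOp b (annOp b f) + (2 * b : ℂ) • f := by
  have h := momOp_commutator b f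
  have h1 : (2 * b : ℂ) • f = (-2 * Complex.I) • (Complex.I * b : ℂ) • f := by
    rw [smul_smul]; congr 1; linear_combination (2 * b : ℂ) * Complex.I_mul_I
  rw [h1, ← h, creOp_apply, annOp_apply, annOp_apply, creOp_apply]
  simp only [map_add, map_sub, map_smul]
  module

theorem momOp_zOp (b : ℝ) (j : Fin 2) (f : PlaneSchwartz) :
    momOp b j (zOp f) = zOp (momOp b j f) - (Complex.I * ![1, Complex.I] j) • f := by
  have := momOp_mulOp b (j := j) hasTemperateGrowth_coordZ (.const (![1, Complex.I] j))
    (fun x => by rw [fderiv_coordZ]; fin_cases j <;> simp [coordZ]) f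
  rw [zOp, this, mul_smul]
  congr 2
  ext x; rw [mulOp_apply (.const _)]; rfl

theorem momOp_zbarOp (b : ℝ) (j : Fin 2) (f : PlaneSchwartz) :
    momOp b j (zbarOp f) = zbarOp (momOp b j f) - (Complex.I * ![1, -Complex.I] j) • f := by
  have := momOp_mulOp b (j := j) hasTemperateGrowth_coordZbar (.const (![1, -Complex.I] j))
    (fun x => by rw [fderiv_coordZbar]; fin_cases j <;> simp [coordZbar, coordZ]) f
  rw [zbarOp, this, mul_smul]
  congr 2
  ext x; rw [mulOp_apply (.const _)]; rfl

theorem annOp_zOp (b : ℝ) (f : PlaneSchwartz) : annOp b (zOp f) = zOp (annOp b f) := by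
  rw [annOp_apply, annOp_apply, momOp_zOp, momOp_zOp, map_add, map_smul]
  simp only [Matrix.cons_val_zero, Matrix.cons_val_one, Complex.I_mul_I, mul_one]
  module

theorem creOp_zOp (b : ℝ) (f : PlaneSchwartz) :
    creOp b (zOp f) = zOp (creOp b f) - (2 * Complex.I) • f := by
  rw [creOp_apply, creOp_apply, momOp_zOp, momOp_zOp, map_sub, map_smul]
  simp only [Matrix.cons_val_zero, Matrix.cons_val_one, Complex.I_mul_I, mul_one]
  module

theorem annOp_zbarOp (b : ℝ) (f : PlaneSchwartz) :
    annOp b (zbarOp f) = zbarOp (annOp b f) - (2 * Complex.I) • f := by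
  rw [annOp_apply, annOp_apply, momOp_zbarOp, momOp_zbarOp, map_add, map_smul]
  simp only [Matrix.cons_val_zero, Matrix.cons_val_one, mul_neg, Complex.I_mul_I, mul_one]
  module

theorem creOp_zbarOp (b : ℝ) (f : PlaneSchwartz) :
    creOp b (zbarOp f) = zbarOp (creOp b f) := by
  rw [creOp_apply, creOp_apply, momOp_zbarOp, momOp_zbarOp, map_sub, map_smul]
  simp only [Matrix.cons_val_zero, Matrix.cons_val_one, mul_neg, Complex.I_mul_I, mul_one]
  module

theorem zOp_zbarOp (f : PlaneSchwartz) : zOp (zbarOp f) = zbarOp (zOp f) :=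
  mulOp_comm hasTemperateGrowth_coordZ hasTemperateGrowth_coordZbar f

theorem inner_zOp (f g : PlaneSchwartz) :
    inner ℂ (toL2 (zOp f)) (toL2 g) = inner ℂ (toL2 f) (toL2 (zbarOp g)) :=
  inner_mulOp hasTemperateGrowth_coordZ hasTemperateGrowth_coordZbar (fun _ => rfl) f g

/-- The creation operator commuting with `Π₁` and `Π₂`. -/
noncomputable def guideCreOp (b : ℝ) : PlaneSchwartz →L[ℂ] PlaneSchwartz :=
  annOp b + (Complex.I * b) • zOp

/-- The annihilation operator commuting with `Π₁` and `Π₂`. -/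
noncomputable def guideAnnOp (b : ℝ) : PlaneSchwartz →L[ℂ] PlaneSchwartz :=
  creOp b - (Complex.I * b) • zbarOp

theorem guideCreOp_apply (b : ℝ) (f : PlaneSchwartz) :
    guideCreOp b f = annOp b f + (Complex.I * b) • zOp f := rfl

theorem guideAnnOp_apply (b : ℝ) (f : PlaneSchwartz) :
    guideAnnOp b f = creOp b f - (Complex.I * b) • zbarOp f := rfl

theorem inner_guideAnnOp (b : ℝ) (f g : PlaneSchwartz) :
    inner ℂ (toL2 (guideAnnOp b f)) (toL2 g) = inner ℂ (toL2 f) (toL2 (guideCreOp b g)) := by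
  have h : inner ℂ (toL2 (zbarOp f)) (toL2 g) = inner ℂ (toL2 f) (toL2 (zOp g)) := by
    rw [← inner_conj_symm, ← inner_zOp, inner_conj_symm]
  rw [guideAnnOp_apply, guideCreOp_apply, map_add, map_sub, inner_sub_left, inner_add_right,
    map_smul, map_smul, inner_smul_left, inner_smul_right, inner_creOp, h]
  simp

theorem annOp_guideCreOp (b : ℝ) (f : PlaneSchwartz) :
    annOp b (guideCreOp b f) = guideCreOp b (annOp b f) := by
  rw [guideCreOp_apply, guideCreOp_apply, map_add, map_smul, annOp_zOp]

theorem annOp_guideAnnOp (b : ℝ) (f : PlaneSchwartz) :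
    annOp b (guideAnnOp b f) = guideAnnOp b (annOp b f) := by
  rw [guideAnnOp_apply, guideAnnOp_apply, map_sub, map_smul, annOp_zbarOp, annOp_creOp, smul_sub,
    smul_smul]
  have : Complex.I * (b : ℂ) * (2 * Complex.I) = -(2 * b) := by
    linear_combination (2 * b : ℂ) * Complex.I_mul_I
  rw [this]
  module

theorem creOp_guideCreOp (b : ℝ) (f : PlaneSchwartz) :
    creOp b (guideCreOp b f) = guideCreOp b (creOp b f) := by
  rw [guideCreOp_apply, guideCreOp_apply, map_add, map_smul, creOp_zOp, annOp_creOp, smul_sub,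
    smul_smul]
  have : Complex.I * (b : ℂ) * (2 * Complex.I) = -(2 * b) := by
    linear_combination (2 * b : ℂ) * Complex.I_mul_I
  rw [this]
  module

theorem creOp_guideAnnOp (b : ℝ) (f : PlaneSchwartz) :
    creOp b (guideAnnOp b f) = guideAnnOp b (creOp b f) := by
  rw [guideAnnOp_apply, guideAnnOp_apply, map_sub, map_smul, creOp_zbarOp]

theorem guideAnnOp_guideCreOp (b : ℝ) (f : PlaneSchwartz) :
    guideAnnOp b (guideCreOp b f) = guideCreOp b (guideAnnOp b f) + (2 * b : ℂ) • f := by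
  rw [guideCreOp_apply, map_add, map_smul, ← annOp_guideAnnOp, guideCreOp_apply b (guideAnnOp b f)]
  rw [guideAnnOp_apply b (zOp f), guideAnnOp_apply b f, creOp_zOp, ← zOp_zbarOp, map_sub zOp,
    map_smul zOp]
  have : Complex.I * (b : ℂ) * (2 * Complex.I) = -(2 * b) := by
    linear_combination (2 * b : ℂ) * Complex.I_mul_I
  rw [smul_sub, smul_sub, smul_sub, smul_smul, this]
  module

/-- Multiplications by `z` and `z̄` are combinations of ladder operators, so the span of the Landau
states is stable under multiplication by polynomials. -/
theorem zOp_eq {b : ℝ} (hb : b ≠ 0) (f : PlaneSchwartz) :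
    zOp f = (Complex.I * b : ℂ)⁻¹ • (guideCreOp b f - annOp b f) := by
  have h : (Complex.I * b : ℂ) ≠ 0 := mul_ne_zero Complex.I_ne_zero (by exact_mod_cast hb)
  rw [guideCreOp_apply, add_sub_cancel_left, inv_smul_smul₀ h]

theorem zbarOp_eq {b : ℝ} (hb : b ≠ 0) (f : PlaneSchwartz) :
    zbarOp f = (Complex.I * b : ℂ)⁻¹ • (creOp b f - guideAnnOp b f) := by
  have h : (Complex.I * b : ℂ) ≠ 0 := mul_ne_zero Complex.I_ne_zero (by exact_mod_cast hb)
  rw [guideAnnOp_apply, sub_sub_cancel, inv_smul_smul₀ h]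

end Ladder

/-! ### The Gaussian ground state as a Schwartz function. -/

section Gaussian

theorem one_add_pow_mul_exp_le {c : ℝ} (hc : 0 < c) (m : ℕ) {t : ℝ} (ht : 0 ≤ t) :
    (1 + t) ^ m * Real.exp (-c * t ^ 2) ≤ m.factorial * (c ^ m)⁻¹ * Real.exp (2 * c) := by
  have h1 := Real.pow_div_factorial_le_exp (c * (1 + t)) (by positivity) m
  have hf : (0 : ℝ) < m.factorial := by positivity
  rw [div_le_iff₀ hf, mul_pow] at h1
  have h2 : (1 + t) ^ m ≤ m.factorial * (c ^ m)⁻¹ * Real.exp (c * (1 + t)) := by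
    have : (1 + t) ^ m = (c ^ m)⁻¹ * (c ^ m * (1 + t) ^ m) := by field_simp
    rw [this]
    calc (c ^ m)⁻¹ * (c ^ m * (1 + t) ^ m) ≤ (c ^ m)⁻¹ * (Real.exp (c * (1 + t)) * m.factorial) := by
          gcongr
      _ = _ := by ring
  calc (1 + t) ^ m * Real.exp (-c * t ^ 2)
      ≤ m.factorial * (c ^ m)⁻¹ * Real.exp (c * (1 + t)) * Real.exp (-c * t ^ 2) := by gcongr
    _ = m.factorial * (c ^ m)⁻¹ * Real.exp (c * (1 + t) + -c * t ^ 2) := by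
        rw [Real.exp_add]; ring
    _ ≤ _ := by
        gcongr
        nlinarith [mul_nonneg hc.le (sq_nonneg (t - 1 / 2))]

theorem norm_iteratedFDeriv_exp_le {c : ℝ} (hc : 0 < c) (n : ℕ) :
    ∃ C : ℝ, 0 ≤ C ∧ ∃ m : ℕ, ∀ x : Plane,
      ‖iteratedFDeriv ℝ n (fun x : Plane => Real.exp (-c * ‖x‖ ^ 2)) x‖ ≤
        C * (1 + ‖x‖) ^ m * Real.exp (-c * ‖x‖ ^ 2) := by
  obtain ⟨k, C, hC, hk⟩ := (Function.hasTemperateGrowth_norm_sq Plane).norm_iteratedFDeriv_le_uniform n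
  refine ⟨n.factorial * (1 + c) ^ n * (1 + C) ^ n, by positivity, k * n, fun x => ?_⟩
  have h := norm_iteratedFDeriv_comp_le (g := fun t : ℝ => Real.exp (-c * t))
    (f := fun x : Plane => ‖x‖ ^ 2) (n := n) (N := n) (x := x)
    (C := (1 + c) ^ n * Real.exp (-c * ‖x‖ ^ 2)) (D := (1 + C) * (1 + ‖x‖) ^ k) (by fun_prop)
    (contDiff_norm_sq ℝ) le_rfl ?_ ?_
  · refine h.trans (le_of_eq ?_)
    rw [mul_pow, ← pow_mul]; ring
  · intro i hi
    rw [norm_iteratedFDeriv_eq_norm_iteratedDeriv, iteratedDeriv_exp_const_mul, norm_mul, norm_pow,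
      Real.norm_eq_abs, abs_neg, abs_of_pos hc, Real.norm_eq_abs, Real.abs_exp]
    gcongr
    calc c ^ i ≤ (1 + c) ^ i := by gcongr; linarith
      _ ≤ (1 + c) ^ n := by gcongr; linarith
  · intro i hi1 hi
    have h1 : 1 ≤ (1 + C) * (1 + ‖x‖) ^ k :=
      one_le_mul_of_one_le_of_one_le (by linarith) (one_le_pow₀ (by linarith [norm_nonneg x]))
    calc _ ≤ C * (1 + ‖x‖) ^ k := hk i hi x
      _ ≤ (1 + C) * (1 + ‖x‖) ^ k := by gcongr; linarith
      _ ≤ _ := le_self_pow₀ h1 (by omega)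

/-- The Gaussian `exp (-c |x|²)` as a Schwartz function. -/
noncomputable def gaussSchwartz (c : ℝ) (hc : 0 < c) : PlaneSchwartz where
  toFun x := (Real.exp (-c * ‖x‖ ^ 2) : ℂ)
  smooth' := by
    have h : ContDiff ℝ ∞ fun x : Plane => Real.exp (-c * ‖x‖ ^ 2) :=
      (contDiff_const.mul (contDiff_norm_sq ℝ)).exp
    exact Complex.ofRealCLM.contDiff.comp h
  decay' := by
    intro k n
    obtain ⟨C, hC, m, h⟩ := norm_iteratedFDeriv_exp_le hc n
    refine ⟨C * ((m + k).factorial * (c ^ (m + k))⁻¹ * Real.exp (2 * c)), fun x => ?_⟩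
    have e : ‖iteratedFDeriv ℝ n (fun x : Plane => (Real.exp (-c * ‖x‖ ^ 2) : ℂ)) x‖ =
        ‖iteratedFDeriv ℝ n (fun x : Plane => Real.exp (-c * ‖x‖ ^ 2)) x‖ :=
      Complex.ofRealLI.norm_iteratedFDeriv_comp_left
        (((contDiff_const.mul (contDiff_norm_sq ℝ)).exp : ContDiff ℝ ∞ fun x : Plane =>
          Real.exp (-c * ‖x‖ ^ 2)).contDiffAt) (by exact_mod_cast le_top)
    rw [e]
    calc ‖x‖ ^ k * _ ≤ (1 + ‖x‖) ^ k * (C * (1 + ‖x‖) ^ m * Real.exp (-c * ‖x‖ ^ 2)) := by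
          gcongr
          · linarith
          · exact h x
      _ = C * ((1 + ‖x‖) ^ (m + k) * Real.exp (-c * ‖x‖ ^ 2)) := by rw [pow_add]; ring
      _ ≤ _ := mul_le_mul_of_nonneg_left (one_add_pow_mul_exp_le hc _ (norm_nonneg x)) hC

theorem gaussSchwartz_apply {c : ℝ} (hc : 0 < c) (x : Plane) :
    gaussSchwartz c hc x = (Real.exp (-c * ‖x‖ ^ 2) : ℂ) := rfl

theorem partialOp_gaussSchwartz {c : ℝ} (hc : 0 < c) (j : Fin 2) (x : Plane) :
    partialOp j (gaussSchwartz c hc) x = -(2 * c * x j : ℂ) * gaussSchwartz c hc x := by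
  rw [partialOp_apply]
  have h1 : HasFDerivAt (fun x : Plane => ‖x‖ ^ 2) (2 • (innerSL ℝ x)) x :=
    (hasStrictFDerivAt_norm_sq x).hasFDerivAt
  have h2 := Complex.ofRealCLM.hasFDerivAt.comp x ((h1.const_mul (-c)).exp)
  have h3 : (gaussSchwartz c hc : Plane → ℂ) = fun x => (Real.exp (-c * ‖x‖ ^ 2) : ℂ) := rfl
  rw [h3, HasFDerivAt.fderiv (f := fun x : Plane => (Real.exp (-c * ‖x‖ ^ 2) : ℂ)) h2]
  simp [EuclideanSpace.inner_single_right]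
  ring

/-- The ground state `exp (-b |x|² / 4)`. -/
noncomputable def groundState (b : ℝ) (hb : 0 < b) : PlaneSchwartz :=
  gaussSchwartz (b / 4) (by positivity)

theorem momOp_groundState {b : ℝ} (hb : 0 < b) (j : Fin 2) (x : Plane) :
    momOp b j (groundState b hb) x =
      (Complex.I * (b / 2) * x j - magPotential b x j) * groundState b hb x := by
  rw [momOp_eq, sub_apply, smul_apply, groundState, partialOp_gaussSchwartz,
    mulOp_apply (hasTemperateGrowth_magPotential b j), smul_eq_mul]
  push_cast
  ring

theorem annOp_groundState {b : ℝ} (hb : 0 < b) : annOp b (groundState b hb) = 0 := by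
  ext x
  rw [annOp_apply, add_apply, smul_apply, momOp_groundState, momOp_groundState]
  simp only [magPotential, Matrix.cons_val_zero, Matrix.cons_val_one, smul_eq_mul]
  push_cast
  change _ = (0 : ℂ)
  linear_combination (b / 2 * x 1 * groundState b hb x : ℂ) * Complex.I_mul_I

theorem guideAnnOp_groundState {b : ℝ} (hb : 0 < b) : guideAnnOp b (groundState b hb) = 0 := by
  ext x
  rw [guideAnnOp_apply, sub_apply, smul_apply, creOp_apply, sub_apply, smul_apply,
    momOp_groundState, momOp_groundState, zbarOp, mulOp_apply hasTemperateGrowth_coordZbar]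
  simp only [magPotential, Matrix.cons_val_zero, Matrix.cons_val_one, smul_eq_mul, coordZbar,
    coordZ, map_add, map_mul, Complex.conj_ofReal, Complex.conj_I]
  push_cast
  change _ = (0 : ℂ)
  linear_combination (b / 2 * x 1 * groundState b hb x : ℂ) * Complex.I_mul_I

end Gaussian

/-! ### Orthonormality and completeness of the Landau states. -/

section LandauBasis

theorem ladder_lower {A C : PlaneSchwartz →L[ℂ] PlaneSchwartz} {κ : ℝ}
    (hc : ∀ f, A (C f) = C (A f) + (κ : ℂ) • f) {f : PlaneSchwartz} (hf : A f = 0) (n : ℕ) :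
    A ((C ^ (n + 1)) f) = (κ * (n + 1) : ℂ) • (C ^ n) f := by
  induction n with
  | zero => simp [hc, hf]
  | succ n ih =>
    rw [pow_succ' C (n + 1), mul_apply_eq_comp, hc, ih, map_smul, pow_succ' C n, mul_apply_eq_comp,
      ← add_smul]
    push_cast
    congr 1; ring

/-- Moving one `C` across the inner product as `A` and lowering reduces both exponents by one. It is
applied to the Landau pair and then to the guiding-centre pair. -/
theorem ladder_inner {A C : PlaneSchwartz →L[ℂ] PlaneSchwartz} {κ : ℝ}
    (hadj : ∀ f g, inner ℂ (toL2 (A f)) (toL2 g) = inner ℂ (toL2 f) (toL2 (C g)))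
    (hc : ∀ f, A (C f) = C (A f) + (κ : ℂ) • f) {f g : PlaneSchwartz} (hf : A f = 0)
    (hg : A g = 0) (n k : ℕ) :
    inner ℂ (toL2 ((C ^ n) f)) (toL2 ((C ^ k) g)) =
      if n = k then (κ ^ n * n.factorial : ℂ) * inner ℂ (toL2 f) (toL2 g) else 0 := by
  have hadj' : ∀ f g, inner ℂ (toL2 (C f)) (toL2 g) = inner ℂ (toL2 f) (toL2 (A g)) := fun f g => by
    rw [← inner_conj_symm, ← hadj, inner_conj_symm]
  induction n generalizing k with
  | zero =>
    cases k with
    | zero => simp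
    | succ k =>
      rw [pow_succ' C k, mul_apply_eq_comp, ← hadj, pow_zero, one_apply_eq_self, hf, map_zero,
        inner_zero_left]
      simp
  | succ n ih =>
    cases k with
    | zero =>
      rw [pow_succ' C n, mul_apply_eq_comp, hadj', pow_zero, one_apply_eq_self, hg, map_zero,
        inner_zero_right]
      simp
    | succ k =>
      rw [pow_succ' C n, mul_apply_eq_comp, hadj', ladder_lower hc hg, map_smul, inner_smul_right,
        ih]
      by_cases h : n = k
      · subst h
        simp only [if_true, Nat.factorial_succ]
        push_cast; ring
      · simp [h]

/-- The (unnormalized) states of the Landau levels. -/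
noncomputable def landauState (b : ℝ) (hb : 0 < b) (q k : ℕ) : PlaneSchwartz :=
  (creOp b ^ q) ((guideCreOp b ^ k) (groundState b hb))

theorem annOp_guideCreOp_pow {b : ℝ} {f : PlaneSchwartz} (hf : annOp b f = 0) (k : ℕ) :
    annOp b ((guideCreOp b ^ k) f) = 0 := by
  induction k with
  | zero => simpa using hf
  | succ k ih => rw [pow_succ', mul_apply_eq_comp, annOp_guideCreOp, ih, map_zero]

theorem annOp_creOp' (b : ℝ) (f : PlaneSchwartz) :
    annOp b (creOp b f) = creOp b (annOp b f) + ((2 * b : ℝ) : ℂ) • f := by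
  rw [annOp_creOp]; push_cast; rfl

theorem guideAnnOp_guideCreOp' (b : ℝ) (f : PlaneSchwartz) :
    guideAnnOp b (guideCreOp b f) = guideCreOp b (guideAnnOp b f) + ((2 * b : ℝ) : ℂ) • f := by
  rw [guideAnnOp_guideCreOp]; push_cast; rfl

theorem landauState_inner {b : ℝ} (hb : 0 < b) (q k q' k' : ℕ) :
    inner ℂ (toL2 (landauState b hb q k)) (toL2 (landauState b hb q' k')) =
      if q = q' ∧ k = k' then
        (((2 * b) ^ (q + k) * q.factorial * k.factorial * ‖toL2 (groundState b hb)‖ ^ 2 : ℝ) : ℂ)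
      else 0 := by
  rw [landauState, landauState, ladder_inner (inner_annOp b) (annOp_creOp' b)
    (annOp_guideCreOp_pow (annOp_groundState hb) k)
    (annOp_guideCreOp_pow (annOp_groundState hb) k') q q',
    ladder_inner (inner_guideAnnOp b) (guideAnnOp_guideCreOp' b) (guideAnnOp_groundState hb)
      (guideAnnOp_groundState hb) k k', inner_self_eq_norm_sq_to_K]
  by_cases h1 : q = q' <;> by_cases h2 : k = k' <;> simp [h1, h2]
  ring

theorem creOp_landauState {b : ℝ} (hb : 0 < b) (q k : ℕ) :
    creOp b (landauState b hb q k) = landauState b hb (q + 1) k := by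
  rw [landauState, landauState, pow_succ' _ q, mul_apply_eq_comp]

theorem annOp_landauState_succ {b : ℝ} (hb : 0 < b) (q k : ℕ) :
    annOp b (landauState b hb (q + 1) k) = (2 * b * (q + 1) : ℂ) • landauState b hb q k := by
  rw [landauState, landauState, ladder_lower (annOp_creOp' b)
    (annOp_guideCreOp_pow (annOp_groundState hb) k)]
  push_cast; rfl

theorem annOp_landauState_zero {b : ℝ} (hb : 0 < b) (k : ℕ) :
    annOp b (landauState b hb 0 k) = 0 := by
  rw [landauState, pow_zero, one_apply_eq_self]
  exact annOp_guideCreOp_pow (annOp_groundState hb) k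

theorem creOp_pow_commute {b : ℝ} {T : PlaneSchwartz →L[ℂ] PlaneSchwartz}
    (h : ∀ f, creOp b (T f) = T (creOp b f)) (q : ℕ) (f : PlaneSchwartz) :
    (creOp b ^ q) (T f) = T ((creOp b ^ q) f) := by
  induction q with
  | zero => simp
  | succ q ih => rw [pow_succ', mul_apply_eq_comp, ih, h, mul_apply_eq_comp]

theorem guideCreOp_landauState {b : ℝ} (hb : 0 < b) (q k : ℕ) :
    guideCreOp b (landauState b hb q k) = landauState b hb q (k + 1) := by
  rw [landauState, landauState, ← creOp_pow_commute (creOp_guideCreOp b), pow_succ' _ k,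
    mul_apply_eq_comp]

theorem guideAnnOp_landauState_succ {b : ℝ} (hb : 0 < b) (q k : ℕ) :
    guideAnnOp b (landauState b hb q (k + 1)) = (2 * b * (k + 1) : ℂ) • landauState b hb q k := by
  rw [landauState, landauState, ← creOp_pow_commute (creOp_guideAnnOp b),
    ladder_lower (guideAnnOp_guideCreOp' b) (guideAnnOp_groundState hb), map_smul]
  push_cast; rfl

theorem guideAnnOp_landauState_zero {b : ℝ} (hb : 0 < b) (q : ℕ) :
    guideAnnOp b (landauState b hb q 0) = 0 := by
  rw [landauState, ← creOp_pow_commute (creOp_guideAnnOp b), pow_zero, one_apply_eq_self,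
    guideAnnOp_groundState, map_zero]

theorem landauOp_eq_of_annOp_eq_zero {b : ℝ} {f : PlaneSchwartz} (hf : annOp b f = 0) (q : ℕ) :
    landauOp b ((creOp b ^ q) f) = (landauLevel b q : ℂ) • (creOp b ^ q) f := by
  rw [landauOp_eq]
  cases q with
  | zero => simp [hf, landauLevel]
  | succ q =>
    rw [ladder_lower (annOp_creOp' b) hf, map_smul, pow_succ' _ q, mul_apply_eq_comp, ← add_smul]
    congr 1
    simp only [landauLevel]; push_cast; ring

theorem landauOp_landauState {b : ℝ} (hb : 0 < b) (q k : ℕ) :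
    landauOp b (landauState b hb q k) = (landauLevel b q : ℂ) • landauState b hb q k :=
  landauOp_eq_of_annOp_eq_zero (annOp_guideCreOp_pow (annOp_groundState hb) k) q

/-- The span of the Landau states. -/
noncomputable def landauSpan (b : ℝ) (hb : 0 < b) : Submodule ℂ PlaneSchwartz :=
  Submodule.span ℂ (Set.range fun i : ℕ × ℕ => landauState b hb i.1 i.2)

theorem landauState_mem {b : ℝ} (hb : 0 < b) (q k : ℕ) : landauState b hb q k ∈ landauSpan b hb :=
  Submodule.subset_span ⟨(q, k), rfl⟩

theorem landauSpan_stable {b : ℝ} (hb : 0 < b) {T : PlaneSchwartz →L[ℂ] PlaneSchwartz}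
    (h : ∀ q k, T (landauState b hb q k) ∈ landauSpan b hb) {f : PlaneSchwartz}
    (hf : f ∈ landauSpan b hb) : T f ∈ landauSpan b hb := by
  have : landauSpan b hb ≤ (landauSpan b hb).comap T.toLinearMap := by
    rw [landauSpan, Submodule.span_le]
    rintro _ ⟨i, rfl⟩
    exact h i.1 i.2
  exact this hf

theorem zOp_mem_landauSpan {b : ℝ} (hb : 0 < b) {f : PlaneSchwartz} (hf : f ∈ landauSpan b hb) :
    zOp f ∈ landauSpan b hb := by
  refine landauSpan_stable hb (fun q k => ?_) hf
  rw [zOp_eq hb.ne', guideCreOp_landauState]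
  refine Submodule.smul_mem _ _ (Submodule.sub_mem _ (landauState_mem hb _ _) ?_)
  cases q with
  | zero => rw [annOp_landauState_zero]; exact Submodule.zero_mem _
  | succ q =>
    rw [annOp_landauState_succ]; exact Submodule.smul_mem _ _ (landauState_mem hb _ _)

theorem zbarOp_mem_landauSpan {b : ℝ} (hb : 0 < b) {f : PlaneSchwartz}
    (hf : f ∈ landauSpan b hb) : zbarOp f ∈ landauSpan b hb := by
  refine landauSpan_stable hb (fun q k => ?_) hf
  rw [zbarOp_eq hb.ne', creOp_landauState]
  refine Submodule.smul_mem _ _ (Submodule.sub_mem _ (landauState_mem hb _ _) ?_)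
  cases k with
  | zero => rw [guideAnnOp_landauState_zero]; exact Submodule.zero_mem _
  | succ q =>
    rw [guideAnnOp_landauState_succ]; exact Submodule.smul_mem _ _ (landauState_mem hb _ _)

/-- The linear form `⟨x, w⟩` is `(w̄ z + w z̄)/2`. Its powers are the Taylor coefficients of the
Fourier character. -/
theorem exists_mem_landauSpan_pow {b : ℝ} (hb : 0 < b) (w : Plane) (n : ℕ) :
    ∃ f ∈ landauSpan b hb, ∀ x : Plane,
      f x = ((inner ℝ x w : ℝ) : ℂ) ^ n * groundState b hb x := by
  induction n with
  | zero =>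
    refine ⟨groundState b hb, ?_, fun x => by simp⟩
    simpa [landauState] using landauState_mem hb 0 0
  | succ n ih =>
    obtain ⟨f, hf, h⟩ := ih
    refine ⟨(((w 0 : ℝ) - Complex.I * (w 1 : ℝ)) / 2 : ℂ) • zOp f +
      (((w 0 : ℝ) + Complex.I * (w 1 : ℝ)) / 2 : ℂ) • zbarOp f,
      Submodule.add_mem _ (Submodule.smul_mem _ _ (zOp_mem_landauSpan hb hf))
        (Submodule.smul_mem _ _ (zbarOp_mem_landauSpan hb hf)), fun x => ?_⟩
    rw [add_apply, smul_apply, smul_apply, zOp, zbarOp, mulOp_apply hasTemperateGrowth_coordZ,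
      mulOp_apply hasTemperateGrowth_coordZbar, h]
    have e : (inner ℝ x w : ℝ) = x 0 * w 0 + x 1 * w 1 := by
      rw [PiLp.inner_apply, Fin.sum_univ_two]
      simp [mul_comm]
    rw [e, pow_succ]
    simp only [coordZ, coordZbar, map_add, map_mul, Complex.conj_ofReal, Complex.conj_I,
      smul_eq_mul]
    push_cast
    linear_combination (-(x 1 * w 1) * ((x 0 * w 0 + x 1 * w 1) ^ n * groundState b hb x) : ℂ) *
      Complex.I_mul_I

theorem exp_mul_gauss_le {c : ℝ} (hc : 0 < c) {r : ℝ} (t : ℝ) :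
    Real.exp (r * t) * Real.exp (-(2 * c) * t ^ 2) ≤
      Real.exp (r ^ 2 / (4 * c)) * Real.exp (-c * t ^ 2) := by
  rw [← Real.exp_add, ← Real.exp_add]
  apply Real.exp_le_exp.2
  have : r ^ 2 / (4 * c) + -c * t ^ 2 - (r * t + -(2 * c) * t ^ 2) =
      (r - 2 * c * t) ^ 2 / (4 * c) := by field_simp; ring
  have : 0 ≤ (r - 2 * c * t) ^ 2 / (4 * c) := by positivity
  linarith

theorem integrable_exp_mul_groundState {b : ℝ} (hb : 0 < b) (f : L2Plane) (r : ℝ) :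
    Integrable fun x => Real.exp (r * ‖x‖) * (‖groundState b hb x‖ * ‖f x‖) := by
  have h1 : Integrable fun x => Real.exp (r ^ 2 / (4 * (b / 8))) *
      (‖gaussSchwartz (b / 8) (by positivity) x‖ * ‖f x‖) := by
    refine Integrable.const_mul ?_ _
    exact (SchwartzMap.memLp _ 2 (volume : Measure Plane)).norm.integrable_mul (Lp.memLp f).norm
  refine h1.mono' ?_ (Filter.Eventually.of_forall fun x => ?_)
  · refine AEStronglyMeasurable.mul (by fun_prop) (AEStronglyMeasurable.mul ?_ ?_)
    · exact (groundState b hb).continuous.norm.aestronglyMeasurable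
    · exact (Lp.aestronglyMeasurable f).norm
  · have hn : ∀ (c : ℝ) (hc : 0 < c), ‖gaussSchwartz c hc x‖ = Real.exp (-c * ‖x‖ ^ 2) :=
      fun c hc => by rw [gaussSchwartz_apply, Complex.norm_real, Real.norm_eq_abs, Real.abs_exp]
    rw [groundState, hn, hn, Real.norm_of_nonneg (by positivity), ← mul_assoc, ← mul_assoc]
    refine mul_le_mul_of_nonneg_right ?_ (norm_nonneg _)
    have := exp_mul_gauss_le (c := b / 8) (by positivity) (r := r) ‖x‖
    rwa [show -(b / 4) = -(2 * (b / 8)) by ring]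

/-- The character is expanded in its power series. The Gaussian beats the dominating function
`exp(‖c‖ ‖w‖ ‖x‖)`, and each term vanishes because `f` is orthogonal to polynomials times the ground
state. -/
theorem fourier_groundState_mul_eq_zero {b : ℝ} (hb : 0 < b) {f : L2Plane}
    (hf : ∀ g ∈ landauSpan b hb, inner ℂ (toL2 g) f = 0) (w : Plane) :
    ∫ x, Complex.exp (-(2 * Real.pi * Complex.I) * ((inner ℝ x w : ℝ) : ℂ)) *
      (groundState b hb x * f x) = 0 := by
  set c : ℂ := -(2 * Real.pi * Complex.I) with hc
  set F : ℕ → Plane → ℂ := fun n x =>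
    (c * ((inner ℝ x w : ℝ) : ℂ)) ^ n / n.factorial * (groundState b hb x * f x) with hF
  set bd : ℕ → Plane → ℝ := fun n x =>
    (‖c‖ * ‖w‖ * ‖x‖) ^ n / n.factorial * (‖groundState b hb x‖ * ‖f x‖) with hbd
  have hfm := Lp.aestronglyMeasurable f
  have hgm : Continuous (groundState b hb) := (groundState b hb).continuous
  have hbs : ∀ x, HasSum (fun n => bd n x)
      (Real.exp (‖c‖ * ‖w‖ * ‖x‖) * (‖groundState b hb x‖ * ‖f x‖)) := fun x => by
    have h := NormedSpace.expSeries_div_hasSum_exp (‖c‖ * ‖w‖ * ‖x‖)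
    rw [← Real.exp_eq_exp_ℝ] at h
    exact h.mul_right _
  have hsum : HasSum (fun n => ∫ x, F n x)
      (∫ x, Complex.exp (c * ((inner ℝ x w : ℝ) : ℂ)) * (groundState b hb x * f x)) := by
    refine hasSum_integral_of_dominated_convergence bd (fun n => ?_) (fun n => ?_) ?_ ?_ ?_
    · refine AEStronglyMeasurable.mul (by fun_prop)
        (AEStronglyMeasurable.mul hgm.aestronglyMeasurable hfm)
    · refine Filter.Eventually.of_forall fun x => ?_
      simp only [hF, hbd, norm_mul, norm_div, norm_pow, Complex.norm_natCast, Complex.norm_real]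
      have hle : ‖c‖ * ‖(inner ℝ x w : ℝ)‖ ≤ ‖c‖ * ‖w‖ * ‖x‖ := by
        rw [mul_assoc]
        refine mul_le_mul_of_nonneg_left ?_ (norm_nonneg c)
        rw [mul_comm]
        exact norm_inner_le_norm x w
      gcongr
    · exact Filter.Eventually.of_forall fun x => (hbs x).summable
    · simp_rw [fun x => (hbs x).tsum_eq]
      exact integrable_exp_mul_groundState hb f _
    · refine Filter.Eventually.of_forall fun x => ?_
      have h := NormedSpace.expSeries_div_hasSum_exp (c * ((inner ℝ x w : ℝ) : ℂ))
      rw [← Complex.exp_eq_exp_ℂ] at h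
      exact h.mul_right _
  have hz : ∀ n, ∫ x, F n x = 0 := fun n => by
    obtain ⟨g, hg, hgx⟩ := exists_mem_landauSpan_pow hb w n
    have h1 := hf g hg
    have h2 : inner ℂ (toL2 g) f =
        ∫ x, ((inner ℝ x w : ℝ) : ℂ) ^ n * (groundState b hb x * f x) := by
      rw [L2.inner_def]
      refine integral_congr_ae ?_
      filter_upwards [SchwartzMap.coeFn_toLp g 2 (volume : Measure Plane)] with x hx
      change inner ℂ ((g.toLp 2 volume : Plane → ℂ) x) (f x) = _
      rw [hx, hgx, RCLike.inner_apply', map_mul, map_pow, Complex.conj_ofReal, groundState,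
        gaussSchwartz_apply, Complex.conj_ofReal]
      ring
    rw [h2] at h1
    have h3 : ∀ x, F n x = c ^ n / n.factorial *
        (((inner ℝ x w : ℝ) : ℂ) ^ n * (groundState b hb x * f x)) := fun x => by
      simp only [hF]; rw [mul_pow]; ring
    simp_rw [h3]
    rw [integral_const_mul, h1, mul_zero]
  simp_rw [hz] at hsum
  exact (hasSum_zero.unique hsum).symm

/-- The integrable function `groundState * f` has zero Fourier transform. Every test function is the
transform of a Schwartz function, so moving the transform across the pairing shows that this product
is zero almost everywhere, and the Gaussian never vanishes. -/
theorem eq_zero_of_orthogonal_landauSpan {b : ℝ} (hb : 0 < b) {f : L2Plane}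
    (hf : ∀ g ∈ landauSpan b hb, inner ℂ (toL2 g) f = 0) : f = 0 := by
  set g : Plane → ℂ := fun x => groundState b hb x * f x with hg
  have hgi : Integrable g := by
    have := integrable_exp_mul_groundState hb f 0
    simp only [zero_mul, Real.exp_zero, one_mul] at this
    refine this.mono' ?_ (Filter.Eventually.of_forall fun x => by simp [hg])
    exact (groundState b hb).continuous.aestronglyMeasurable.mul (Lp.aestronglyMeasurable f)
  have hF : ∀ w, FourierTransform.fourier g w = 0 := fun w => by
    rw [Real.fourier_eq']
    have := fourier_groundState_mul_eq_zero hb hf w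
    rw [← this]
    refine integral_congr_ae (Filter.Eventually.of_forall fun x => ?_)
    simp only [smul_eq_mul]
    congr 2
    push_cast; ring
  have hae : ∀ᵐ x, g x = 0 := by
    refine ae_eq_zero_of_integral_contDiff_smul_eq_zero hgi.locallyIntegrable fun φ hφ1 hφ2 => ?_
    have c1 : ContDiff ℝ ∞ fun x => (φ x : ℂ) := Complex.ofRealCLM.contDiff.comp hφ1
    have c2 : HasCompactSupport fun x => (φ x : ℂ) := hφ2.comp_left (g := fun t : ℝ => (t : ℂ)) (by simp)
    set Φ : PlaneSchwartz := c2.toSchwartzMap c1 with hΦ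
    set Ψ : PlaneSchwartz := FourierTransformInv.fourierInv Φ with hΨ
    have hΨΦ : FourierTransform.fourier Ψ = Φ := FourierTransform.fourier_fourierInv_eq Φ
    have h := VectorFourier.integral_fourierIntegral_smul_eq_flip (L := innerₗ Plane)
      (μ := volume) (ν := volume) (f := (Ψ : Plane → ℂ)) (g := g)
      Real.continuous_fourierChar continuous_inner Ψ.integrable hgi
    rw [flip_innerₗ] at h
    have e1 : ∀ x, VectorFourier.fourierIntegral Real.fourierChar volume (innerₗ Plane) g x = 0 := hF
    have e2 : ∀ x, VectorFourier.fourierIntegral Real.fourierChar volume (innerₗ Plane) Ψ x =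
        (φ x : ℂ) := fun x => by
      have := congrArg (fun F : PlaneSchwartz => F x) hΨΦ
      exact this
    simp only [e1, e2, integral_zero, smul_eq_mul, mul_zero] at h
    simpa [Complex.real_smul] using h
  have : (f : Plane → ℂ) =ᵐ[volume] 0 := by
    filter_upwards [hae] with x hx
    have hne : groundState b hb x ≠ 0 := by
      rw [groundState, gaussSchwartz_apply]
      exact_mod_cast (Real.exp_pos _).ne'
    exact (mul_eq_zero.1 hx).resolve_left hne
  exact (Lp.eq_zero_iff_ae_eq_zero).2 this

theorem toL2_landauState_ne_zero {b : ℝ} (hb : 0 < b) (q k : ℕ) :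
    toL2 (landauState b hb q k) ≠ 0 := by
  have he : toL2 (groundState b hb) ≠ 0 := by
    intro h
    have h1 : ∀ q k, toL2 (landauState b hb q k) = 0 := fun q k => by
      rw [← inner_self_eq_zero (𝕜 := ℂ), landauState_inner]
      simp [h]
    have h2 : ∀ f : L2Plane, f = 0 := fun f => by
      refine eq_zero_of_orthogonal_landauSpan hb fun g hg => ?_
      have : toL2 g = 0 := by
        have hle : landauSpan b hb ≤ LinearMap.ker toL2.toLinearMap := by
          rw [landauSpan, Submodule.span_le]
          rintro _ ⟨i, rfl⟩
          exact h1 i.1 i.2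
        exact hle hg
      rw [this, inner_zero_left]
    have h3 := h2 (toL2 (groundState b hb))
    have h4 := SchwartzMap.injective_toLp (F := ℂ) 2 (volume : Measure Plane)
      (h3.trans (map_zero toL2).symm)
    have h5 := congrArg (fun F : PlaneSchwartz => F 0) h4
    simp only [groundState, gaussSchwartz_apply] at h5
    change _ = (0 : ℂ) at h5
    simp at h5
  intro h
  have h1 := landauState_inner hb q k q k
  rw [h, inner_zero_left, if_pos ⟨rfl, rfl⟩] at h1
  have : (0 : ℝ) < (2 * b) ^ (q + k) * q.factorial * k.factorial *
      ‖toL2 (groundState b hb)‖ ^ 2 := by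
    have := norm_pos_iff.2 he
    positivity
  exact this.ne (by exact_mod_cast h1)

/-- The normalized states of the Landau levels. -/
noncomputable def landauFun (b : ℝ) (hb : 0 < b) (i : ℕ × ℕ) : PlaneSchwartz :=
  ((‖toL2 (landauState b hb i.1 i.2)‖⁻¹ : ℝ) : ℂ) • landauState b hb i.1 i.2

theorem orthonormal_landauFun {b : ℝ} (hb : 0 < b) :
    Orthonormal ℂ fun i : ℕ × ℕ => toL2 (landauFun b hb i) := by
  constructor
  · intro i
    have h := norm_pos_iff.2 (toL2_landauState_ne_zero hb i.1 i.2)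
    simp only [landauFun]
    rw [map_smul, norm_smul, Complex.norm_real, Real.norm_of_nonneg (by positivity),
      inv_mul_cancel₀ h.ne']
  · intro i j hij
    simp only [landauFun, map_smul, inner_smul_left, inner_smul_right]
    rw [landauState_inner, if_neg, mul_zero, mul_zero]
    rintro ⟨h1, h2⟩
    exact hij (Prod.ext h1 h2)

theorem landauState_eq {b : ℝ} (hb : 0 < b) (q k : ℕ) :
    landauState b hb q k = (‖toL2 (landauState b hb q k)‖ : ℂ) • landauFun b hb (q, k) := by
  have h := norm_pos_iff.2 (toL2_landauState_ne_zero hb q k)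
  rw [landauFun, smul_smul, ← Complex.ofReal_mul, mul_inv_cancel₀ h.ne', Complex.ofReal_one,
    one_smul]

theorem orthogonal_span_landauFun {b : ℝ} (hb : 0 < b) :
    (Submodule.span ℂ (Set.range fun i : ℕ × ℕ => toL2 (landauFun b hb i)))ᗮ = ⊥ := by
  rw [Submodule.eq_bot_iff]
  intro f hf
  refine eq_zero_of_orthogonal_landauSpan hb fun g hg => ?_
  have hle : landauSpan b hb ≤ (Submodule.span ℂ
      (Set.range fun i : ℕ × ℕ => toL2 (landauFun b hb i))).comap toL2.toLinearMap := by
    rw [landauSpan, Submodule.span_le]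
    rintro _ ⟨i, rfl⟩
    change toL2 (landauState b hb i.1 i.2) ∈ Submodule.span ℂ
      (Set.range fun i : ℕ × ℕ => toL2 (landauFun b hb i))
    rw [landauState_eq, map_smul]
    exact Submodule.smul_mem _ _ (Submodule.subset_span ⟨i, rfl⟩)
  exact Submodule.inner_right_of_mem_orthogonal (show toL2 g ∈ _ from hle hg) hf

/-- The orthonormal basis of `L²` made of states of the Landau levels. -/
noncomputable def landauBasis (b : ℝ) (hb : 0 < b) : HilbertBasis (ℕ × ℕ) ℂ L2Plane :=
  HilbertBasis.mkOfOrthogonalEqBot (orthonormal_landauFun hb) (orthogonal_span_landauFun hb)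

theorem landauBasis_apply {b : ℝ} (hb : 0 < b) (i : ℕ × ℕ) :
    landauBasis b hb i = toL2 (landauFun b hb i) := by
  rw [landauBasis, HilbertBasis.coe_mkOfOrthogonalEqBot]

theorem landauOp_landauFun {b : ℝ} (hb : 0 < b) (i : ℕ × ℕ) :
    landauOp b (landauFun b hb i) = (landauLevel b i.1 : ℂ) • landauFun b hb i := by
  rw [landauFun, map_smul, landauOp_landauState, smul_comm]

end LandauBasis

/-! ### A priori estimates for second-order magnetic operators, and their forms. -/

section MetricOperator

theorem norm_mulOp_le {g : Plane → ℂ} (hg : g.HasTemperateGrowth) {C : ℝ} (hC : ∀ x, ‖g x‖ ≤ C)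
    (f : PlaneSchwartz) : ‖toL2 (mulOp g f)‖ ≤ C * ‖toL2 f‖ := by
  have hC0 : 0 ≤ C := (norm_nonneg _).trans (hC 0)
  refine abs_le_of_sq_le_sq' ?_ (by positivity) |>.2
  rw [mul_pow, norm_toL2_sq, norm_toL2_sq, ← integral_const_mul]
  refine integral_mono (integrable_norm_sq _) ((integrable_norm_sq f).const_mul _) fun x => ?_
  simp only [mulOp_apply hg, norm_mul, mul_pow]
  have := hC x
  gcongr

/-- Smooth functions which are bounded together with their first derivatives (and whose other
derivatives grow at most polynomially). -/
structure IsBddCoeff (g : Plane → ℂ) : Prop where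
  growth : g.HasTemperateGrowth
  bdd : ∃ C, ∀ x, ‖g x‖ ≤ C
  deriv : ∀ j : Fin 2, ∃ g' : Plane → ℂ, g'.HasTemperateGrowth ∧ (∃ C, ∀ x, ‖g' x‖ ≤ C) ∧
    ∀ x, fderiv ℝ g x (EuclideanSpace.single j 1) = g' x

theorem IsBddCoeff.const (c : ℂ) : IsBddCoeff fun _ => c where
  growth := .const c
  bdd := ⟨‖c‖, fun _ => le_rfl⟩
  deriv j := ⟨fun _ => 0, .const _, ⟨0, by simp⟩, by simp⟩

theorem IsBddCoeff.of_hasCompactSupport {g : Plane → ℂ} (hg : ContDiff ℝ ∞ g)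
    (hs : HasCompactSupport g) : IsBddCoeff g where
  growth := hs.hasTemperateGrowth hg
  bdd := hs.exists_bound_of_continuous hg.continuous
  deriv j := by
    have h1 : HasCompactSupport (fun x => fderiv ℝ g x (EuclideanSpace.single j 1)) :=
      hs.fderiv_apply ℝ _
    have h2 : ContDiff ℝ ∞ (fun x => fderiv ℝ g x (EuclideanSpace.single j 1)) :=
      (hg.fderiv_right (m := ∞) (by simp)).clm_apply contDiff_const
    exact ⟨_, h1.hasTemperateGrowth h2, h1.exists_bound_of_continuous h2.continuous,
      fun x => rfl⟩

/-- The operator `∑_{j,k} Π_j m_{jk} Π_k` on Schwartz functions. -/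
noncomputable def metricSchwartz (b : ℝ) (m : Plane → Matrix (Fin 2) (Fin 2) ℂ) :
    PlaneSchwartz →L[ℂ] PlaneSchwartz :=
  ∑ j, ∑ k, momOp b j ∘L mulOp (fun x => m x j k) ∘L momOp b k

theorem metricSchwartz_apply (b : ℝ) (m : Plane → Matrix (Fin 2) (Fin 2) ℂ) (f : PlaneSchwartz) :
    metricSchwartz b m f = ∑ j, ∑ k, momOp b j (mulOp (fun x => m x j k) (momOp b k f)) := by
  simp [metricSchwartz]

theorem mulOp_const (c : ℂ) (f : PlaneSchwartz) : mulOp (fun _ => c) f = c • f := by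
  ext x; rw [mulOp_apply (.const _)]; rfl

theorem metricSchwartz_one (b : ℝ) (f : PlaneSchwartz) :
    metricSchwartz b (fun _ => 1) f = landauOp b f := by
  rw [metricSchwartz_apply, landauOp_apply]
  simp [Fin.sum_univ_two, mulOp_const]

theorem metricSchwartz_apply_eq (b : ℝ) {m : Plane → Matrix (Fin 2) (Fin 2) ℂ}
    (hm : ∀ j k, (fun x => m x j k).HasTemperateGrowth) (f : PlaneSchwartz) (x : Plane) :
    metricSchwartz b m f x = metricExpr b m f x := by
  rw [metricSchwartz_apply, metricExpr]
  simp only [Fin.sum_univ_two, add_apply, momOp_apply]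
  have : ∀ j k, (mulOp (fun x => m x j k) (momOp b k f) : Plane → ℂ) =
      fun y => m y j k * magMomentum b k f y := fun j k => by
    ext y; rw [mulOp_apply (hm j k), momOp_apply]
  simp only [this]

theorem metricSchwartz_add (b : ℝ) {m n : Plane → Matrix (Fin 2) (Fin 2) ℂ}
    (hm : ∀ j k, (fun x => m x j k).HasTemperateGrowth)
    (hn : ∀ j k, (fun x => n x j k).HasTemperateGrowth) (c : ℂ) (f : PlaneSchwartz) :
    metricSchwartz b (fun x => m x + c • n x) f = metricSchwartz b m f + c • metricSchwartz b n f := by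
  have : ∀ j k, ∀ f, mulOp (fun x => (m x + c • n x) j k) f =
      mulOp (fun x => m x j k) f + c • mulOp (fun x => n x j k) f := fun j k f => by
    have h : (fun x => (m x + c • n x) j k).HasTemperateGrowth := by
      have := (hm j k).add ((Function.HasTemperateGrowth.const c).mul (hn j k))
      exact this
    ext x
    rw [add_apply, smul_apply, mulOp_apply h, mulOp_apply (hm j k), mulOp_apply (hn j k)]
    simp [add_mul, mul_assoc]
  simp only [metricSchwartz_apply, Fin.sum_univ_two, this, map_add, map_smul]
  module

/-- The sum of the norms of the first order magnetic derivatives. -/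
noncomputable def firstNorm (b : ℝ) (f : PlaneSchwartz) : ℝ := ∑ j, ‖toL2 (momOp b j f)‖

/-- The sum of the norms of the second order magnetic derivatives. -/
noncomputable def secondNorm (b : ℝ) (f : PlaneSchwartz) : ℝ :=
  ∑ j, ∑ k, ‖toL2 (momOp b j (momOp b k f))‖

theorem firstNorm_nonneg (b : ℝ) (f : PlaneSchwartz) : 0 ≤ firstNorm b f :=
  Finset.sum_nonneg fun _ _ => norm_nonneg _

theorem secondNorm_nonneg (b : ℝ) (f : PlaneSchwartz) : 0 ≤ secondNorm b f :=
  Finset.sum_nonneg fun _ _ => Finset.sum_nonneg fun _ _ => norm_nonneg _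

theorem norm_momOp_le_firstNorm (b : ℝ) (j : Fin 2) (f : PlaneSchwartz) :
    ‖toL2 (momOp b j f)‖ ≤ firstNorm b f :=
  Finset.single_le_sum (f := fun j => ‖toL2 (momOp b j f)‖) (fun _ _ => norm_nonneg _)
    (Finset.mem_univ j)

theorem norm_momOp_momOp_le_secondNorm (b : ℝ) (j k : Fin 2) (f : PlaneSchwartz) :
    ‖toL2 (momOp b j (momOp b k f))‖ ≤ secondNorm b f :=
  (Finset.single_le_sum (f := fun k => ‖toL2 (momOp b j (momOp b k f))‖)
    (fun _ _ => norm_nonneg _) (Finset.mem_univ k)).trans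
    (Finset.single_le_sum (f := fun j => ∑ k, ‖toL2 (momOp b j (momOp b k f))‖)
    (fun _ _ => Finset.sum_nonneg fun _ _ => norm_nonneg _) (Finset.mem_univ j))

theorem norm_momOp_mulOp_le (b : ℝ) {g : Plane → ℂ} (hg : IsBddCoeff g) (j : Fin 2) :
    ∃ C, 0 ≤ C ∧ ∀ f, ‖toL2 (momOp b j (mulOp g f))‖ ≤ C * (‖toL2 f‖ + ‖toL2 (momOp b j f)‖) := by
  obtain ⟨C, hC⟩ := hg.bdd
  obtain ⟨g', h1, ⟨C', hC'⟩, h3⟩ := hg.deriv j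
  have hC0 : 0 ≤ C := (norm_nonneg _).trans (hC 0)
  have hC0' : 0 ≤ C' := (norm_nonneg _).trans (hC' 0)
  refine ⟨C + C', by positivity, fun f => ?_⟩
  rw [momOp_mulOp b hg.growth h1 h3, map_sub, map_smul]
  refine (norm_sub_le _ _).trans ?_
  rw [norm_smul, Complex.norm_I, one_mul]
  have e1 := norm_mulOp_le hg.growth hC (momOp b j f)
  have e2 := norm_mulOp_le h1 hC' f
  have e3 : 0 ≤ C * ‖toL2 f‖ := by positivity
  have e4 : 0 ≤ C' * ‖toL2 (momOp b j f)‖ := by positivity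
  nlinarith

theorem norm_metricSchwartz_le (b : ℝ) {m : Plane → Matrix (Fin 2) (Fin 2) ℂ}
    (hm : ∀ j k, IsBddCoeff fun x => m x j k) :
    ∃ C, 0 ≤ C ∧ ∀ f, ‖toL2 (metricSchwartz b m f)‖ ≤ C * (firstNorm b f + secondNorm b f) := by
  choose C hC0 hC using fun j k => norm_momOp_mulOp_le b (hm j k) j
  refine ⟨∑ j, ∑ k, C j k, Finset.sum_nonneg fun j _ => Finset.sum_nonneg fun k _ => hC0 j k,
    fun f => ?_⟩
  rw [metricSchwartz_apply, map_sum, Finset.sum_mul]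
  refine (norm_sum_le _ _).trans (Finset.sum_le_sum fun j _ => ?_)
  rw [map_sum, Finset.sum_mul]
  refine (norm_sum_le _ _).trans (Finset.sum_le_sum fun k _ => (hC j k _).trans ?_)
  exact mul_le_mul_of_nonneg_left (add_le_add (norm_momOp_le_firstNorm b k f)
    (norm_momOp_momOp_le_secondNorm b j k f)) (hC0 j k)

theorem momOp_momOp (b : ℝ) (l j : Fin 2) : ∃ c : ℂ, ∀ f,
    momOp b l (momOp b j f) = momOp b j (momOp b l f) + c • f := by
  have h := momOp_commutator b
  fin_cases l <;> fin_cases j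
  · exact ⟨0, fun f => by simp⟩
  · exact ⟨Complex.I * b, fun f => by
      rw [← h f]; exact (add_sub_cancel _ _).symm⟩
  · exact ⟨-(Complex.I * b), fun f => by
      rw [neg_smul, ← h f, neg_sub]; exact (add_sub_cancel _ _).symm⟩
  · exact ⟨0, fun f => by simp⟩

/-- Smooth functions which are bounded together with their derivatives of order at most two (and
whose other derivatives grow at most polynomially). -/
structure IsBddCoeffTwo (g : Plane → ℂ) : Prop extends IsBddCoeff g where
  deriv_bdd : ∀ j : Fin 2, ∃ g' : Plane → ℂ, IsBddCoeff g' ∧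
    ∀ x, fderiv ℝ g x (EuclideanSpace.single j 1) = g' x

theorem IsBddCoeffTwo.const (c : ℂ) : IsBddCoeffTwo fun _ => c where
  toIsBddCoeff := .const c
  deriv_bdd j := ⟨fun _ => 0, .const 0, by simp⟩

theorem IsBddCoeffTwo.of_hasCompactSupport {g : Plane → ℂ} (hg : ContDiff ℝ ∞ g)
    (hs : HasCompactSupport g) : IsBddCoeffTwo g where
  toIsBddCoeff := .of_hasCompactSupport hg hs
  deriv_bdd j := by
    have h1 : HasCompactSupport (fun x => fderiv ℝ g x (EuclideanSpace.single j 1)) :=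
      hs.fderiv_apply ℝ _
    have h2 : ContDiff ℝ ∞ (fun x => fderiv ℝ g x (EuclideanSpace.single j 1)) :=
      (hg.fderiv_right (m := ∞) (by simp)).clm_apply contDiff_const
    exact ⟨_, .of_hasCompactSupport h2 h1, fun x => rfl⟩

/-- The magnetic Sobolev norm of order two. -/
noncomputable def sobolevNorm (b : ℝ) (f : PlaneSchwartz) : ℝ :=
  ‖toL2 f‖ + firstNorm b f + secondNorm b f

/-- Commuting `momOp b l` past the other factors costs a derivative of the coefficient or a
constant, so the terms of third order cancel. -/
theorem norm_momOp_mulOp_commutator_le (b : ℝ) {g : Plane → ℂ} (hg : IsBddCoeffTwo g)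
    (l j k : Fin 2) :
    ∃ C, 0 ≤ C ∧ ∀ f, ‖toL2 (momOp b l (momOp b j (mulOp g (momOp b k f))) -
      momOp b j (mulOp g (momOp b k (momOp b l f))))‖ ≤ C * sobolevNorm b f := by
  obtain ⟨c, hc⟩ := momOp_momOp b l j
  obtain ⟨c', hc'⟩ := momOp_momOp b k l
  obtain ⟨g', hg', h3⟩ := hg.deriv_bdd l
  obtain ⟨C1, h1, hC1⟩ := norm_momOp_mulOp_le b hg' j
  obtain ⟨C2, h2, hC2⟩ := norm_momOp_mulOp_le b hg.toIsBddCoeff j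
  obtain ⟨C3, hC3⟩ := hg.bdd
  have h4 : 0 ≤ C3 := (norm_nonneg _).trans (hC3 0)
  refine ⟨C1 + ‖c‖ * C3 + ‖c'‖ * C2, by positivity, fun f => ?_⟩
  have e : momOp b l (momOp b j (mulOp g (momOp b k f))) -
      momOp b j (mulOp g (momOp b k (momOp b l f))) =
      -Complex.I • momOp b j (mulOp g' (momOp b k f)) + c • mulOp g (momOp b k f) -
        c' • momOp b j (mulOp g f) := by
    rw [hc, hc', momOp_mulOp b hg.growth hg'.growth h3]
    simp only [map_add, map_sub, map_smul]
    module
  have n1 : ‖toL2 (momOp b k f)‖ + ‖toL2 (momOp b j (momOp b k f))‖ ≤ sobolevNorm b f := by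
    have := norm_momOp_le_firstNorm b k f
    have := norm_momOp_momOp_le_secondNorm b j k f
    have := norm_nonneg (toL2 f)
    rw [sobolevNorm]; linarith
  have n2 : ‖toL2 f‖ + ‖toL2 (momOp b j f)‖ ≤ sobolevNorm b f := by
    have := norm_momOp_le_firstNorm b j f
    have := secondNorm_nonneg b f
    rw [sobolevNorm]; linarith
  have n3 : ‖toL2 (momOp b k f)‖ ≤ sobolevNorm b f := by
    have := norm_nonneg (toL2 (momOp b j (momOp b k f)))
    linarith
  rw [e, map_sub, map_add, map_smul, map_smul, map_smul]
  refine (norm_sub_le _ _).trans ?_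
  have t1 := norm_add_le (-Complex.I • toL2 (momOp b j (mulOp g' (momOp b k f))))
    (c • toL2 (mulOp g (momOp b k f)))
  rw [norm_smul, norm_smul, norm_neg, Complex.norm_I, one_mul] at t1
  rw [norm_smul]
  have u1 := (hC1 (momOp b k f)).trans (mul_le_mul_of_nonneg_left n1 h1)
  have u2 := mul_le_mul_of_nonneg_left ((norm_mulOp_le hg.growth hC3 (momOp b k f)).trans
    (mul_le_mul_of_nonneg_left n3 h4)) (norm_nonneg c)
  have u3 := mul_le_mul_of_nonneg_left ((hC2 f).trans (mul_le_mul_of_nonneg_left n2 h2))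
    (norm_nonneg c')
  nlinarith

theorem norm_momOp_metricSchwartz_commutator_le (b : ℝ) {m : Plane → Matrix (Fin 2) (Fin 2) ℂ}
    (hm : ∀ j k, IsBddCoeffTwo fun x => m x j k) :
    ∃ C, 0 ≤ C ∧ ∀ l f, ‖toL2 (momOp b l (metricSchwartz b m f) -
      metricSchwartz b m (momOp b l f))‖ ≤ C * sobolevNorm b f := by
  choose C hC0 hC using fun l j k => norm_momOp_mulOp_commutator_le b (hm j k) l j k
  have hs : ∀ f, 0 ≤ sobolevNorm b f := fun f => by
    have := firstNorm_nonneg b f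
    have := secondNorm_nonneg b f
    have := norm_nonneg (toL2 f)
    rw [sobolevNorm]; linarith
  refine ⟨∑ l, ∑ j, ∑ k, C l j k, Finset.sum_nonneg fun l _ => Finset.sum_nonneg fun j _ =>
    Finset.sum_nonneg fun k _ => hC0 l j k, fun l f => ?_⟩
  have hl : ∑ j, ∑ k, C l j k ≤ ∑ l, ∑ j, ∑ k, C l j k :=
    Finset.single_le_sum (f := fun l => ∑ j, ∑ k, C l j k) (fun l _ => Finset.sum_nonneg
      fun j _ => Finset.sum_nonneg fun k _ => hC0 l j k) (Finset.mem_univ l)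
  refine le_trans ?_ (mul_le_mul_of_nonneg_right hl (hs f))
  simp only [metricSchwartz_apply, map_sum, ← Finset.sum_sub_distrib, Finset.sum_mul]
  refine (norm_sum_le _ _).trans (Finset.sum_le_sum fun j _ => ?_)
  refine (norm_sum_le _ _).trans (Finset.sum_le_sum fun k _ => ?_)
  exact hC l j k f

/-- The quadratic form of the Landau Hamiltonian. -/
noncomputable def landauForm (b : ℝ) (f : PlaneSchwartz) : ℝ := ∑ j, ‖toL2 (momOp b j f)‖ ^ 2

theorem landauForm_nonneg (b : ℝ) (f : PlaneSchwartz) : 0 ≤ landauForm b f :=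
  Finset.sum_nonneg fun _ _ => by positivity

theorem re_inner_landauOp (b : ℝ) (f : PlaneSchwartz) :
    (inner ℂ (toL2 (landauOp b f)) (toL2 f)).re = landauForm b f := by
  rw [landauOp_apply, map_add, inner_add_left, inner_momOp b 0 (momOp b 0 f),
    inner_momOp b 1 (momOp b 1 f), landauForm, Fin.sum_univ_two, inner_self_eq_norm_sq_to_K,
    inner_self_eq_norm_sq_to_K]
  norm_cast

/-- From `H₀ = a*a + b`. -/
theorem mul_norm_sq_le_landauForm (b : ℝ) (f : PlaneSchwartz) :
    b * ‖toL2 f‖ ^ 2 ≤ landauForm b f := by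
  have h : (inner ℂ (toL2 (landauOp b f)) (toL2 f)).re =
      ‖toL2 (annOp b f)‖ ^ 2 + b * ‖toL2 f‖ ^ 2 := by
    rw [landauOp_eq, map_add, map_smul, inner_add_left, inner_creOp, inner_smul_left,
      inner_self_eq_norm_sq_to_K, inner_self_eq_norm_sq_to_K, Complex.conj_ofReal]
    simp [← Complex.ofReal_pow]
  rw [← re_inner_landauOp, h]
  have := sq_nonneg ‖toL2 (annOp b f)‖
  linarith

theorem sq_firstNorm_le (b : ℝ) (f : PlaneSchwartz) : firstNorm b f ^ 2 ≤ 2 * landauForm b f := by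
  rw [firstNorm, landauForm, Fin.sum_univ_two, Fin.sum_univ_two]
  nlinarith [sq_nonneg (‖toL2 (momOp b 0 f)‖ - ‖toL2 (momOp b 1 f)‖)]

theorem secondNorm_eq (b : ℝ) (f : PlaneSchwartz) :
    secondNorm b f = ∑ k, firstNorm b (momOp b k f) := by
  simp only [secondNorm, firstNorm]
  exact Finset.sum_comm

theorem sq_secondNorm_le (b : ℝ) (f : PlaneSchwartz) :
    secondNorm b f ^ 2 ≤ 4 * ∑ k, landauForm b (momOp b k f) := by
  have h0 := sq_firstNorm_le b (momOp b 0 f)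
  have h1 := sq_firstNorm_le b (momOp b 1 f)
  rw [secondNorm_eq, Fin.sum_univ_two, Fin.sum_univ_two]
  nlinarith [sq_nonneg (firstNorm b (momOp b 0 f) - firstNorm b (momOp b 1 f))]

/-- An elliptic estimate whose constant depends on `T` only through its coercivity and commutator
bounds; this uniformity is what the continuity method needs. Coercivity controls the norms of order
zero and one, and second-order norms follow by applying it to `momOp b l f`. -/
theorem exists_sobolevNorm_le {b κ C : ℝ} (hb : 0 < b) (hκ : 0 < κ) (hC : 0 ≤ C) :
    ∃ C', 0 < C' ∧ ∀ T : PlaneSchwartz →L[ℂ] PlaneSchwartz,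
      (∀ f, κ * landauForm b f ≤ (inner ℂ (toL2 (T f)) (toL2 f)).re) →
      (∀ l f, ‖toL2 (momOp b l (T f) - T (momOp b l f))‖ ≤ C * sobolevNorm b f) →
      ∀ f, sobolevNorm b f ≤ C' * ‖toL2 (T f)‖ := by
  set C0 := 1 / (κ * b) with hC0
  set C1 := 2 * (C0 / κ) + 1 with hC1
  have h0 : 0 < C0 := by positivity
  have h1 : 0 < C1 := by positivity
  set B := 8 / κ * (1 + C * C1) with hB
  set D := 8 / κ * (C * (C0 + C1) * C1) with hD
  have hB0 : 0 < B := by positivity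
  have hD0 : 0 ≤ D := by positivity
  refine ⟨C0 + C1 + (B + D + 1), by positivity, fun T hT hcomm f => ?_⟩
  set L := ‖toL2 (T f)‖ with hL
  set a := ‖toL2 f‖ with ha
  have hL0 : 0 ≤ L := norm_nonneg _
  have ha0 : 0 ≤ a := norm_nonneg _
  have n10 := firstNorm_nonneg b f
  have n20 := secondNorm_nonneg b f
  have q0 := mul_norm_sq_le_landauForm b f
  have q1 := hT f
  have q2 : (inner ℂ (toL2 (T f)) (toL2 f)).re ≤ L * a :=
    (Complex.re_le_norm _).trans (norm_inner_le_norm _ _)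
  have haL : a ≤ C0 * L := by
    rw [hC0, div_mul_eq_mul_div, one_mul, le_div_iff₀ (by positivity)]
    have : a * (κ * b) * a ≤ L * a := by nlinarith
    by_cases h : a = 0
    · rw [h, zero_mul]; exact hL0
    · exact le_of_mul_le_mul_right this (lt_of_le_of_ne ha0 (Ne.symm h))
  have hn1 : firstNorm b f ≤ C1 * L := by
    have e1 := sq_firstNorm_le b f
    have e2 : κ * landauForm b f ≤ C0 * L ^ 2 := by nlinarith
    have e3 : landauForm b f ≤ C0 / κ * L ^ 2 := by
      rw [div_mul_eq_mul_div, le_div_iff₀ hκ]; linarith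
    refine abs_le_of_sq_le_sq' ?_ (by positivity) |>.2
    have e4 : 2 * (C0 / κ) ≤ C1 ^ 2 := by
      have : 0 < C0 / κ := by positivity
      rw [hC1]; nlinarith
    nlinarith [sq_nonneg L]
  -- In the form of `T` at `momOp b l f`, commute `T` past `momOp b l` and move the latter to the
  -- other side: the main term pairs `T f` with a second derivative, the rest is bounded by the
  -- commutator. A quadratic inequality in `secondNorm` results.
  have key : secondNorm b f ^ 2 ≤ B * L * secondNorm b f + D * L ^ 2 := by
    have e1 : ∀ l, κ * landauForm b (momOp b l f) ≤
        L * secondNorm b f + C * sobolevNorm b f * firstNorm b f := fun l => by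
      refine (hT _).trans ?_
      have e2 : T (momOp b l f) = momOp b l (T f) - (momOp b l (T f) - T (momOp b l f)) := by abel
      rw [e2, map_sub, inner_sub_left, inner_momOp, Complex.sub_re]
      have e3 : (inner ℂ (toL2 (T f)) (toL2 (momOp b l (momOp b l f)))).re ≤
          L * secondNorm b f := (Complex.re_le_norm _).trans ((norm_inner_le_norm _ _).trans
        (mul_le_mul_of_nonneg_left (norm_momOp_momOp_le_secondNorm b l l f) hL0))
      have e4 := (Complex.abs_re_le_norm _).trans (norm_inner_le_norm (𝕜 := ℂ)
        (toL2 (momOp b l (T f) - T (momOp b l f))) (toL2 (momOp b l f)))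
      have e5 := mul_le_mul (hcomm l f) (norm_momOp_le_firstNorm b l f) (norm_nonneg _)
        ((norm_nonneg _).trans (hcomm l f))
      have := (abs_le.1 (e4.trans e5)).1
      linarith
    have e6 := sq_secondNorm_le b f
    rw [Fin.sum_univ_two] at e6
    have e7 : κ * secondNorm b f ^ 2 ≤
        8 * (L * secondNorm b f + C * sobolevNorm b f * firstNorm b f) := by
      have := mul_le_mul_of_nonneg_left e6 hκ.le
      linarith [e1 0, e1 1]
    have e8 : sobolevNorm b f * firstNorm b f ≤
        ((C0 + C1) * L + secondNorm b f) * (C1 * L) := by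
      rw [sobolevNorm]
      refine mul_le_mul ?_ hn1 n10 (by positivity)
      linarith
    have e9 : secondNorm b f ^ 2 ≤
        8 / κ * (L * secondNorm b f + C * (sobolevNorm b f * firstNorm b f)) := by
      rw [div_mul_eq_mul_div, le_div_iff₀ hκ]; linarith
    have e10 := mul_le_mul_of_nonneg_left (mul_le_mul_of_nonneg_left e8 hC)
      (show 0 ≤ 8 / κ by positivity)
    rw [hB, hD]
    linarith
  have hn2 : secondNorm b f ≤ (B + D + 1) * L := by
    by_contra! h
    have h3 : L ≤ secondNorm b f := by
      have := mul_nonneg (add_nonneg hB0.le hD0) hL0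
      linarith
    have h4 := mul_le_mul_of_nonneg_left h3 (mul_nonneg hD0 hL0)
    have h5 : 0 < secondNorm b f := lt_of_le_of_lt (by positivity) h
    have h6 := mul_lt_mul_of_pos_right h h5
    have h7 := mul_nonneg hL0 n20
    linarith
  rw [sobolevNorm]
  linarith

/-- The density of the quadratic form of `∑_{j,k} Π_j m_{jk} Π_k`. -/
noncomputable def metricDensity (b : ℝ) (m : Plane → Matrix (Fin 2) (Fin 2) ℂ) (f : PlaneSchwartz)
    (x : Plane) : ℝ :=
  (star (fun j => momOp b j f x) ⬝ᵥ (m x).mulVec fun j => momOp b j f x).re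

/-- The quadratic form of `∑_{j,k} Π_j m_{jk} Π_k`. -/
noncomputable def metricForm (b : ℝ) (m : Plane → Matrix (Fin 2) (Fin 2) ℂ) (f : PlaneSchwartz) :
    ℝ :=
  (inner ℂ (toL2 (metricSchwartz b m f)) (toL2 f)).re

theorem inner_metricSchwartz_left (b : ℝ) (m : Plane → Matrix (Fin 2) (Fin 2) ℂ)
    (f g : PlaneSchwartz) :
    inner ℂ (toL2 (metricSchwartz b m f)) (toL2 g) =
      ∑ j, ∑ k, inner ℂ (toL2 (mulOp (fun x => m x j k) (momOp b k f))) (toL2 (momOp b j g)) := by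
  simp only [metricSchwartz_apply, map_sum, sum_inner, inner_momOp b]

theorem inner_metricSchwartz (b : ℝ) {m : Plane → Matrix (Fin 2) (Fin 2) ℂ}
    (hm : ∀ j k, (fun x => m x j k).HasTemperateGrowth) (hH : ∀ x, (m x).IsHermitian)
    (f g : PlaneSchwartz) :
    inner ℂ (toL2 (metricSchwartz b m f)) (toL2 g) =
      inner ℂ (toL2 f) (toL2 (metricSchwartz b m g)) := by
  rw [← inner_conj_symm (toL2 f), inner_metricSchwartz_left, inner_metricSchwartz_left, map_sum,
    Finset.sum_comm]
  refine Finset.sum_congr rfl fun k _ => ?_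
  rw [map_sum]
  refine Finset.sum_congr rfl fun j _ => ?_
  rw [inner_conj_symm, inner_mulOp (hm j k) (hm k j) fun x => ((hH x).apply k j).symm]

theorem integrable_inner (f g : PlaneSchwartz) : Integrable fun x => inner ℂ (f x) (g x) := by
  refine (L2.integrable_inner (𝕜 := ℂ) (toL2 f) (toL2 g)).congr ?_
  filter_upwards [SchwartzMap.coeFn_toLp f 2 (volume : Measure Plane),
    SchwartzMap.coeFn_toLp g 2 (volume : Measure Plane)] with x hf hg
  rw [← hf, ← hg]
  rfl

theorem metricDensity_eq (b : ℝ) {m : Plane → Matrix (Fin 2) (Fin 2) ℂ}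
    (hm : ∀ j k, (fun x => m x j k).HasTemperateGrowth) (f : PlaneSchwartz) (x : Plane) :
    metricDensity b m f x = ∑ j, ∑ k, (inner ℂ (mulOp (fun x => m x j k) (momOp b k f) x)
      (momOp b j f x)).re := by
  simp only [metricDensity, dotProduct, Matrix.mulVec, Complex.re_sum, Finset.mul_sum]
  refine Finset.sum_congr rfl fun j _ => Finset.sum_congr rfl fun k _ => ?_
  rw [mulOp_apply (hm j k), RCLike.inner_apply']
  simp only [Pi.star_apply, RCLike.star_def, Complex.mul_re, Complex.mul_im, Complex.conj_re,
    Complex.conj_im]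
  ring

theorem integrable_metricDensity (b : ℝ) {m : Plane → Matrix (Fin 2) (Fin 2) ℂ}
    (hm : ∀ j k, (fun x => m x j k).HasTemperateGrowth) (f : PlaneSchwartz) :
    Integrable (metricDensity b m f) := by
  simp only [funext (metricDensity_eq b hm f)]
  exact integrable_finsetSum _ fun j _ => integrable_finsetSum _ fun k _ =>
    (integrable_inner _ _).re

theorem metricForm_eq (b : ℝ) {m : Plane → Matrix (Fin 2) (Fin 2) ℂ}
    (hm : ∀ j k, (fun x => m x j k).HasTemperateGrowth) (f : PlaneSchwartz) :
    metricForm b m f = ∫ x, metricDensity b m f x := by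
  simp only [metricDensity_eq b hm f]
  rw [metricForm, inner_metricSchwartz_left, Complex.re_sum, integral_finsetSum]
  · refine Finset.sum_congr rfl fun j _ => ?_
    rw [Complex.re_sum, integral_finsetSum]
    · refine Finset.sum_congr rfl fun k _ => ?_
      rw [inner_toL2]
      exact (integral_re (integrable_inner _ _)).symm
    · exact fun k _ => (integrable_inner _ _).re
  · exact fun j _ => integrable_finsetSum _ fun k _ => (integrable_inner _ _).re

theorem landauForm_eq (b : ℝ) (f : PlaneSchwartz) :
    landauForm b f = ∫ x, ∑ j, ‖momOp b j f x‖ ^ 2 := by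
  rw [integral_finsetSum _ fun _ _ => integrable_norm_sq _]
  simp only [landauForm, norm_toL2_sq]

theorem integrable_sum_norm_sq (b : ℝ) (f : PlaneSchwartz) :
    Integrable fun x => ∑ j, ‖momOp b j f x‖ ^ 2 :=
  integrable_finsetSum _ fun _ _ => integrable_norm_sq _

theorem metricDensity_nonneg (b : ℝ) {m : Plane → Matrix (Fin 2) (Fin 2) ℂ} {x : Plane}
    (hm : (m x).PosSemidef) (f : PlaneSchwartz) : 0 ≤ metricDensity b m f x :=
  hm.re_dotProduct_nonneg _

theorem metricDensity_le (b : ℝ) {m : Plane → Matrix (Fin 2) (Fin 2) ℂ} {x : Plane} {c : ℝ}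
    (hm : ‖Matrix.toEuclideanCLM (n := Fin 2) (𝕜 := ℂ) (m x)‖ ≤ c) (f : PlaneSchwartz) :
    metricDensity b m f x ≤ c * ∑ j, ‖momOp b j f x‖ ^ 2 := by
  set v : EuclideanSpace ℂ (Fin 2) := WithLp.toLp 2 fun j => momOp b j f x with hv
  have h1 : metricDensity b m f x =
      (inner ℂ v (Matrix.toEuclideanCLM (n := Fin 2) (𝕜 := ℂ) (m x) v)).re := by
    rw [metricDensity, EuclideanSpace.inner_eq_star_dotProduct, dotProduct_comm]
    rfl
  rw [h1, ← EuclideanSpace.norm_sq_eq v]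
  refine (Complex.re_le_norm _).trans ((norm_inner_le_norm _ _).trans ?_)
  have := (ContinuousLinearMap.le_opNorm (Matrix.toEuclideanCLM (n := Fin 2) (𝕜 := ℂ) (m x)) v)
  have h2 := mul_le_mul_of_nonneg_right hm (norm_nonneg v)
  have h3 := mul_le_mul_of_nonneg_left (this.trans h2) (norm_nonneg v)
  linarith

theorem metricForm_nonneg (b : ℝ) {m : Plane → Matrix (Fin 2) (Fin 2) ℂ}
    (hm : ∀ j k, (fun x => m x j k).HasTemperateGrowth) (hp : ∀ x, (m x).PosSemidef)
    (f : PlaneSchwartz) : 0 ≤ metricForm b m f := by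
  rw [metricForm_eq b hm]
  exact integral_nonneg fun x => metricDensity_nonneg b (hp x) f

theorem metricForm_le (b : ℝ) {m : Plane → Matrix (Fin 2) (Fin 2) ℂ}
    (hm : ∀ j k, (fun x => m x j k).HasTemperateGrowth) {c : ℝ}
    (hc : ∀ x, ‖Matrix.toEuclideanCLM (n := Fin 2) (𝕜 := ℂ) (m x)‖ ≤ c) (f : PlaneSchwartz) :
    metricForm b m f ≤ c * landauForm b f := by
  rw [metricForm_eq b hm, landauForm_eq, ← integral_const_mul]
  exact integral_mono (integrable_metricDensity b hm f) ((integrable_sum_norm_sq b f).const_mul _)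
    fun x => metricDensity_le b (hc x) f

end MetricOperator

/-! ### Inverses of symmetric coercive operators with dense range, and their variational principle.
-/

section Elliptic

/-- Symmetric, coercive operators on Schwartz functions with dense range in `L²`. -/
structure IsElliptic (T : PlaneSchwartz →L[ℂ] PlaneSchwartz) : Prop where
  symm : ∀ f g, inner ℂ (toL2 (T f)) (toL2 g) = inner ℂ (toL2 f) (toL2 (T g))
  coercive : ∃ κ > 0, ∀ f, κ * ‖toL2 f‖ ^ 2 ≤ (inner ℂ (toL2 (T f)) (toL2 f)).re
  dense : DenseRange fun f => toL2 (T f)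

/-- The bounded inverse of an elliptic operator. -/
noncomputable def solOp (T : PlaneSchwartz →L[ℂ] PlaneSchwartz) : L2Plane →L[ℂ] L2Plane :=
  LinearMap.extendOfNorm (toL2 : PlaneSchwartz →ₗ[ℂ] L2Plane)
    ((toL2 ∘L T : PlaneSchwartz →L[ℂ] L2Plane) : PlaneSchwartz →ₗ[ℂ] L2Plane)

variable {T : PlaneSchwartz →L[ℂ] PlaneSchwartz}

theorem norm_le_of_coercive {κ : ℝ} (hκ : 0 < κ) {f : PlaneSchwartz}
    (h : κ * ‖toL2 f‖ ^ 2 ≤ (inner ℂ (toL2 (T f)) (toL2 f)).re) :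
    ‖toL2 f‖ ≤ κ⁻¹ * ‖toL2 (T f)‖ := by
  have h1 := h.trans ((Complex.re_le_norm _).trans (norm_inner_le_norm _ _))
  rw [inv_mul_eq_div, le_div_iff₀ hκ]
  by_cases h0 : ‖toL2 f‖ = 0
  · rw [h0, zero_mul]; exact norm_nonneg _
  · have : 0 < ‖toL2 f‖ := lt_of_le_of_ne (norm_nonneg _) (Ne.symm h0)
    refine le_of_mul_le_mul_right ?_ this
    linarith

theorem IsElliptic.solOp_apply (h : IsElliptic T) (f : PlaneSchwartz) :
    solOp T (toL2 (T f)) = toL2 f := by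
  obtain ⟨κ, hκ, hc⟩ := h.coercive
  exact LinearMap.extendOfNorm_eq (f := (toL2 : PlaneSchwartz →ₗ[ℂ] L2Plane))
    (e := ((toL2 ∘L T : PlaneSchwartz →L[ℂ] L2Plane) : PlaneSchwartz →ₗ[ℂ] L2Plane))
    h.dense ⟨κ⁻¹, fun g => norm_le_of_coercive hκ (hc g)⟩ f

theorem denseRange_toL2 : DenseRange toL2 :=
  SchwartzMap.denseRange_toLpCLM (F := ℂ) (p := 2) (by simp)

theorem IsElliptic.isPositive_solOp (h : IsElliptic T) : (solOp T).IsPositive := by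
  have hs : ∀ u v, inner ℂ (solOp T u) v = inner ℂ u (solOp T v) := by
    intro u v
    refine h.dense.induction_on₂ (p := fun u v => inner ℂ (solOp T u) v = inner ℂ u (solOp T v))
      ?_ (fun f g => ?_) u v
    · exact isClosed_eq (by fun_prop) (by fun_prop)
    · rw [h.solOp_apply, h.solOp_apply, h.symm]
  rw [ContinuousLinearMap.isPositive_def]
  refine ⟨hs, fun u => ?_⟩
  obtain ⟨κ, hκ, hc⟩ := h.coercive
  refine h.dense.induction_on (p := fun u => 0 ≤ (solOp T).reApplyInnerSelf u) u ?_ fun f => ?_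
  · exact isClosed_le continuous_const (solOp T).reApplyInnerSelf_continuous
  · rw [ContinuousLinearMap.reApplyInnerSelf_apply, h.solOp_apply, ← h.symm]
    exact le_trans (by positivity) (hc f)

theorem IsElliptic.inner_solOp (h : IsElliptic T) (u v : L2Plane) :
    inner ℂ (solOp T u) v = inner ℂ u (solOp T v) :=
  h.isPositive_solOp.isSymmetric u v

/-- Completing the square. Non-negativity of the left side and density of the range of `T` yield the
two halves of the principle that `quadForm (solOp T) u` is the supremum over `f` of `2 Re⟨u, f⟩ - ⟨T
f, f⟩`. -/
theorem IsElliptic.quadForm_sub (h : IsElliptic T) (u : L2Plane) (f : PlaneSchwartz) :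
    quadForm (solOp T) (u - toL2 (T f)) = quadForm (solOp T) u - 2 * (inner ℂ u (toL2 f)).re +
      (inner ℂ (toL2 (T f)) (toL2 f)).re := by
  have e1 : inner ℂ (solOp T u) (toL2 (T f)) = inner ℂ u (toL2 f) := by
    rw [h.inner_solOp, h.solOp_apply]
  have e2 : (inner ℂ (toL2 f) u).re = (inner ℂ u (toL2 f)).re := by
    rw [← inner_conj_symm, Complex.conj_re]
  rw [quadForm, map_sub, h.solOp_apply, inner_sub_left, inner_sub_right, inner_sub_right, e1,
    ← h.symm f f]
  simp only [Complex.sub_re, quadForm, e2]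
  ring

theorem IsElliptic.le_quadForm (h : IsElliptic T) (u : L2Plane) (f : PlaneSchwartz) :
    2 * (inner ℂ u (toL2 f)).re - (inner ℂ (toL2 (T f)) (toL2 f)).re ≤ quadForm (solOp T) u := by
  have h1 : 0 ≤ quadForm (solOp T) (u - toL2 (T f)) := h.isPositive_solOp.re_inner_nonneg_left _
  rw [h.quadForm_sub] at h1
  linarith

theorem IsElliptic.quadForm_le (h : IsElliptic T) (u : L2Plane) {M : ℝ}
    (hM : ∀ f, 2 * (inner ℂ u (toL2 f)).re - (inner ℂ (toL2 (T f)) (toL2 f)).re ≤ M) :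
    quadForm (solOp T) u ≤ M := by
  have h1 : ∀ v, quadForm (solOp T) u ≤ M + quadForm (solOp T) (u - v) := fun v => by
    refine h.dense.induction_on (p := fun v => quadForm (solOp T) u ≤
      M + quadForm (solOp T) (u - v)) v ?_ fun f => ?_
    · refine isClosed_le continuous_const (continuous_const.add ?_)
      exact (continuous_quadForm _).comp (continuous_const.sub continuous_id)
    · rw [h.quadForm_sub]
      linarith [hM f]
  simpa [quadForm] using h1 u

/-- The inverse is symmetric and its range contains all Schwartz functions, which are dense. -/
theorem IsElliptic.solOp_injective (h : IsElliptic T) {v : L2Plane} (hv : solOp T v = 0) :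
    v = 0 := by
  have h1 : ∀ w, inner ℂ v w = 0 := fun w => by
    refine denseRange_toL2.induction_on (p := fun w => inner ℂ v w = 0) w ?_ fun f => ?_
    · exact isClosed_eq (by fun_prop) continuous_const
    · rw [← h.solOp_apply, ← h.inner_solOp, hv, inner_zero_left]
  exact inner_self_eq_zero.1 (h1 v)

end Elliptic

/-! ### Dense range of the perturbed operator by the continuity method. -/

section LandauElliptic

theorem denseRange_iff_inner {T : PlaneSchwartz →L[ℂ] PlaneSchwartz} :
    DenseRange (fun f => toL2 (T f)) ↔
      ∀ u : L2Plane, (∀ f, inner ℂ u (toL2 (T f)) = 0) → u = 0 := by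
  set S : Submodule ℂ L2Plane := LinearMap.range (toL2 ∘L T : PlaneSchwartz →L[ℂ] L2Plane).toLinearMap
  have h1 : DenseRange (fun f => toL2 (T f)) ↔ Sᗮ = ⊥ := by
    rw [← Submodule.topologicalClosure_eq_top_iff, ← Submodule.dense_iff_topologicalClosure_eq_top]
    rfl
  rw [h1, Submodule.eq_bot_iff]
  refine forall_congr' fun u => imp_congr_left ?_
  rw [Submodule.mem_orthogonal']
  constructor
  · exact fun h f => h _ ⟨f, rfl⟩
  · rintro h _ ⟨f, rfl⟩
    exact h f

theorem isElliptic_landauOp {b : ℝ} (hb : 0 < b) : IsElliptic (landauOp b) where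
  symm := inner_landauOp b
  coercive := ⟨b, hb, fun f => by
    rw [re_inner_landauOp]; exact mul_norm_sq_le_landauForm b f⟩
  dense := by
    rw [denseRange_iff_inner]
    intro u hu
    refine eq_zero_of_orthogonal_landauSpan hb fun g hg => ?_
    refine Submodule.span_induction (p := fun g _ => inner ℂ (toL2 g) u = 0) ?_ (by simp)
      (fun g h _ _ e1 e2 => by rw [map_add, inner_add_left, e1, e2, add_zero])
      (fun c g _ e => by rw [map_smul, inner_smul_left, e, mul_zero]) hg
    rintro _ ⟨i, rfl⟩
    have h1 := hu (landauState b hb i.1 i.2)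
    rw [landauOp_landauState, map_smul, inner_smul_right, mul_eq_zero] at h1
    rw [← inner_conj_symm, h1.resolve_left, map_zero]
    have : 0 < landauLevel b i.1 := by rw [landauLevel]; positivity
    exact_mod_cast this.ne'

/-- If `u` is orthogonal to the new range, then `|⟨u, T f⟩| = |c| |⟨u, V f⟩| ≤ |c| C ‖u‖ ‖T f‖`. By
density this holds for every vector in place of `T f`; taking `u` itself forces `u = 0`. -/
theorem DenseRange.of_perturbation {T V : PlaneSchwartz →L[ℂ] PlaneSchwartz} {c : ℂ} {C : ℝ}
    (hT : DenseRange fun f => toL2 (T f)) (hV : ∀ f, ‖toL2 (V f)‖ ≤ C * ‖toL2 (T f)‖)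
    (hc : ‖c‖ * C < 1) : DenseRange fun f => toL2 ((T + c • V) f) := by
  rw [denseRange_iff_inner]
  intro u hu
  have h1 : ∀ v, ‖inner ℂ u v‖ ≤ ‖c‖ * C * ‖u‖ * ‖v‖ := fun v => by
    refine hT.induction_on (p := fun v => ‖inner ℂ u v‖ ≤ ‖c‖ * C * ‖u‖ * ‖v‖) v ?_ fun f => ?_
    · exact isClosed_le (by fun_prop) (by fun_prop)
    · have h2 := hu f
      rw [add_apply, smul_apply, map_add, map_smul, inner_add_right, inner_smul_right] at h2
      rw [eq_neg_of_add_eq_zero_left h2, norm_neg, norm_mul]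
      have h3 := (norm_inner_le_norm (𝕜 := ℂ) u (toL2 (V f))).trans
        (mul_le_mul_of_nonneg_left (hV f) (norm_nonneg u))
      have h4 := mul_le_mul_of_nonneg_left h3 (norm_nonneg c)
      linarith
  have h2 := h1 u
  rw [inner_self_eq_norm_sq_to_K] at h2
  have h3 : ‖u‖ ^ 2 ≤ ‖c‖ * C * ‖u‖ ^ 2 := by
    have : ‖((‖u‖ : ℂ)) ^ 2‖ = ‖u‖ ^ 2 := by simp
    have h4 : ‖u‖ ^ 2 ≤ ‖c‖ * C * ‖u‖ * ‖u‖ := by rw [← this]; exact h2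
    linarith
  have h4 : ‖u‖ ^ 2 = 0 := by nlinarith [sq_nonneg ‖u‖]
  simpa using h4

variable {b κ σ : ℝ} {m : Plane → Matrix (Fin 2) (Fin 2) ℂ}

/-- The operator `H₀ + σ ∑_{j,k} Π_j m_{jk} Π_k` on Schwartz functions. -/
noncomputable def perturbedOp (b σ : ℝ) (m : Plane → Matrix (Fin 2) (Fin 2) ℂ) :
    PlaneSchwartz →L[ℂ] PlaneSchwartz :=
  landauOp b + (σ : ℂ) • metricSchwartz b m

theorem perturbedOp_apply (f : PlaneSchwartz) :
    perturbedOp b σ m f = landauOp b f + (σ : ℂ) • metricSchwartz b m f := rfl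

theorem re_inner_perturbedOp (f : PlaneSchwartz) :
    (inner ℂ (toL2 (perturbedOp b σ m f)) (toL2 f)).re =
      landauForm b f + σ * metricForm b m f := by
  rw [perturbedOp_apply, map_add, map_smul, inner_add_left, inner_smul_left, Complex.conj_ofReal,
    Complex.add_re, re_inner_landauOp, Complex.re_ofReal_mul, metricForm]

/-- Along the path `t ↦ H₀ + tσW`, `t ∈ [0,1]`, the perturbation is bounded relative to each
operator with a constant independent of `t`, so dense range propagates from `H₀` in finitely many
equal steps. -/
theorem isElliptic_perturbedOp (hb : 0 < b) (hκ : 0 < κ) (hκ1 : κ ≤ 1)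
    (hm : ∀ j k, IsBddCoeffTwo fun x => m x j k) (hH : ∀ x, (m x).IsHermitian)
    (hform : ∀ f, κ * landauForm b f ≤ landauForm b f + σ * metricForm b m f) :
    IsElliptic (perturbedOp b σ m) where
  symm f g := by
    simp only [perturbedOp_apply, map_add, map_smul, inner_add_left, inner_add_right,
      inner_smul_left, inner_smul_right, Complex.conj_ofReal, inner_landauOp,
      inner_metricSchwartz b (fun j k => (hm j k).growth) hH]
  coercive := ⟨κ * b, by positivity, fun f => by
    rw [re_inner_perturbedOp]
    have := mul_le_mul_of_nonneg_left (mul_norm_sq_le_landauForm b f) hκ.le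
    linarith [hform f]⟩
  dense := by
    obtain ⟨C0, hC0, h0⟩ := norm_momOp_metricSchwartz_commutator_le b (m := fun _ => 1)
      (fun j k => .const ((1 : Matrix (Fin 2) (Fin 2) ℂ) j k))
    obtain ⟨C1, hC1, h1⟩ := norm_momOp_metricSchwartz_commutator_le b hm
    obtain ⟨C2, hC2, h2⟩ := norm_metricSchwartz_le b fun j k => (hm j k).toIsBddCoeff
    obtain ⟨C3, hC3, h3⟩ := exists_sobolevNorm_le hb hκ (C := C0 + |σ| * C1) (by positivity)
    have hbd : ∀ t ∈ Icc (0 : ℝ) 1, ∀ f, ‖toL2 (metricSchwartz b m f)‖ ≤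
        C2 * C3 * ‖toL2 (perturbedOp b (t * σ) m f)‖ := by
      intro t ht f
      have := h3 (perturbedOp b (t * σ) m) (fun f => ?_) (fun l f => ?_) f
      · refine (h2 f).trans ?_
        rw [mul_assoc]
        refine mul_le_mul_of_nonneg_left (le_trans ?_ this) hC2
        rw [sobolevNorm]
        linarith [norm_nonneg (toL2 f)]
      -- Coercivity at `t` is a convex combination of coercivity at the two ends, with constants `1
      -- ≥ κ` and `κ`.
      · rw [re_inner_perturbedOp]
        have e1 := mul_le_mul_of_nonneg_left (hform f) ht.1
        have e2 := mul_le_mul_of_nonneg_left hκ1 (mul_nonneg (sub_nonneg.2 ht.2)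
          (landauForm_nonneg b f))
        linarith
      · have e : momOp b l (perturbedOp b (t * σ) m f) - perturbedOp b (t * σ) m (momOp b l f) =
            (momOp b l (metricSchwartz b (fun _ => 1) f) -
              metricSchwartz b (fun _ => 1) (momOp b l f)) +
            ((t * σ : ℝ) : ℂ) • (momOp b l (metricSchwartz b m f) -
              metricSchwartz b m (momOp b l f)) := by
          simp only [perturbedOp_apply, metricSchwartz_one, map_add, map_smul]
          module
        rw [e, map_add, map_smul]
        refine (norm_add_le _ _).trans ?_
        rw [norm_smul, Complex.norm_real, Real.norm_eq_abs, abs_mul, abs_of_nonneg ht.1]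
        have e1 := h0 l f
        have e2 := h1 l f
        have e3 : t * |σ| * ‖toL2 (momOp b l (metricSchwartz b m f) -
            metricSchwartz b m (momOp b l f))‖ ≤ 1 * |σ| * (C1 * sobolevNorm b f) := by
          have := ht.2
          have := ht.1
          gcongr
        linarith
    -- Steps of length `1/N` have relative size `|σ| C2 C3 / N < 1`.
    obtain ⟨N, hN⟩ := exists_nat_gt (|σ| * (C2 * C3))
    have hN0 : (0 : ℝ) < N := lt_of_le_of_lt (by positivity) hN
    have hstep : ∀ n : ℕ, n ≤ N → DenseRange fun f => toL2 (perturbedOp b (n / N * σ) m f) := by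
      intro n
      induction n with
      | zero =>
        intro _
        simpa [perturbedOp] using (isElliptic_landauOp hb).dense
      | succ n ih =>
        intro hn
        have hd := ih (by omega)
        have ht : (n / N : ℝ) ∈ Icc (0 : ℝ) 1 := by
          refine ⟨by positivity, ?_⟩
          rw [div_le_one hN0]
          exact_mod_cast (by omega : n ≤ N)
        have := DenseRange.of_perturbation (c := ((σ / N : ℝ) : ℂ)) hd (hbd _ ht) (by
          rw [Complex.norm_real, Real.norm_eq_abs, abs_div, abs_of_pos hN0, div_mul_eq_mul_div,
            div_lt_one hN0]
          exact hN)
        convert this using 4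
        simp only [perturbedOp]
        push_cast
        module
    have := hstep N le_rfl
    rwa [div_self hN0.ne', one_mul] at this

end LandauElliptic

/-! ### The closed operator is the inverse of `solOp`. -/

section Closure

/-- Cut-offs `φ(x/(n+1))` have derivatives bounded uniformly in `n`, and each Schwartz seminorm of
the error is `O(1/(n+1))`. -/
theorem exists_seq_hasCompactSupport_tendsto (f : PlaneSchwartz) :
    ∃ F : ℕ → PlaneSchwartz, (∀ n, HasCompactSupport (F n)) ∧
      Filter.Tendsto F Filter.atTop (nhds f) := by
  let φ : ContDiffBump (0 : Plane) := ⟨1, 2, by norm_num, by norm_num⟩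
  set φc : Plane → ℂ := fun x => (φ x : ℂ) with hφc
  have hφs : ContDiff ℝ ∞ φc := Complex.ofRealCLM.contDiff.comp φ.contDiff
  have hφk : HasCompactSupport φc := φ.hasCompactSupport.comp_left (g := fun t : ℝ => (t : ℂ)) rfl
  have hφ1 : ∀ x, ‖x‖ ≤ 1 → φc x = 1 := fun x hx => by
    have : φ x = 1 := φ.one_of_mem_closedBall (by simpa using hx)
    simp [hφc, this]
  choose C hC using fun j : ℕ => (hφk.iteratedFDeriv (𝕜 := ℝ) j).exists_bound_of_continuous
    (hφs.continuous_iteratedFDeriv (by exact_mod_cast le_top))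
  have hC0 : ∀ j, 0 ≤ C j := fun j => (norm_nonneg _).trans (hC j 0)
  set χ : ℕ → Plane → ℂ := fun n x => φc (((n : ℝ) + 1)⁻¹ • x) with hχ
  have hχs : ∀ n, ContDiff ℝ ∞ (χ n) := fun n => hφs.comp (contDiff_const_smul _)
  have hχk : ∀ n, HasCompactSupport (χ n) := fun n =>
    hφk.comp_smul (c := ((n : ℝ) + 1)⁻¹) (by positivity)
  have hχg : ∀ n, (χ n).HasTemperateGrowth := fun n => (hχk n).hasTemperateGrowth (hχs n)
  have hχb : ∀ n j x, ‖iteratedFDeriv ℝ j (χ n) x‖ ≤ C j := fun n j x => by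
    rw [hχ]
    simp only
    rw [iteratedFDeriv_comp_const_smul (i := j) _ (hφs.of_le (by exact_mod_cast le_top))]
    rw [norm_smul, norm_pow, Real.norm_of_nonneg (by positivity)]
    have h1 : (((n : ℝ) + 1)⁻¹) ^ j ≤ 1 := pow_le_one₀ (by positivity) (inv_le_one_of_one_le₀ (by
      have : (0 : ℝ) ≤ n := Nat.cast_nonneg n
      linarith))
    exact (mul_le_of_le_one_left (norm_nonneg _) h1).trans (hC j _)
  have hfun : ∀ n, (mulOp (χ n) f : Plane → ℂ) = fun x => χ n x • f x := fun n => by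
    ext x; rw [mulOp_apply (hχg n), smul_eq_mul]
  refine ⟨fun n => mulOp (χ n) f, fun n => ?_, ?_⟩
  · rw [hfun]; exact (hχk n).smul_right
  rw [(schwartz_withSeminorms ℂ Plane ℂ).tendsto_nhds]
  rintro ⟨k, i⟩ ε hε
  set M : ℝ := (∑ j ∈ Finset.range (i + 1), (i.choose j : ℝ) * C j *
    SchwartzMap.seminorm ℂ (k + 1) (i - j) f) + SchwartzMap.seminorm ℂ (k + 1) i f with hM
  have hM0 : 0 ≤ M := add_nonneg (Finset.sum_nonneg fun j _ => mul_nonneg (mul_nonneg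
    (Nat.cast_nonneg _) (hC0 j)) (apply_nonneg _ _)) (apply_nonneg _ _)
  have key : ∀ n : ℕ, SchwartzMap.seminorm ℂ k i (mulOp (χ n) f - f) ≤ M * ((n : ℝ) + 1)⁻¹ := by
    intro n
    refine SchwartzMap.seminorm_le_bound ℂ k i _ (by positivity) fun x => ?_
    have hn : (0 : ℝ) < (n : ℝ) + 1 := by positivity
    -- The error vanishes near points inside the ball; outside, one more power of `‖x‖` pays for the
    -- factor `1/(n+1)`.
    rcases lt_or_ge ‖x‖ ((n : ℝ) + 1) with hx | hx
    · have h0 : ((mulOp (χ n) f - f : PlaneSchwartz) : Plane → ℂ) =ᶠ[nhds x] fun _ => 0 := by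
        filter_upwards [continuous_norm.continuousAt.eventually_lt continuousAt_const hx] with y hy
        rw [sub_apply, mulOp_apply (hχg n)]
        simp only [hχ]
        rw [hφ1, one_mul, sub_self]
        rw [norm_smul, Real.norm_of_nonneg (by positivity), inv_mul_eq_div, div_le_one hn]
        exact hy.le
      rw [(h0.iteratedFDeriv ℝ i).eq_of_nhds]
      simp only [iteratedFDeriv_fun_zero, Pi.zero_apply, norm_zero, mul_zero]
      positivity
    · have h1 : ‖x‖ ^ k ≤ ‖x‖ ^ (k + 1) * ((n : ℝ) + 1)⁻¹ := by
        rw [← div_eq_mul_inv, le_div_iff₀ hn, pow_succ]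
        gcongr
      have h2 : ‖iteratedFDeriv ℝ i (mulOp (χ n) f - f : PlaneSchwartz) x‖ ≤
          (∑ j ∈ Finset.range (i + 1), (i.choose j : ℝ) * C j *
            ‖iteratedFDeriv ℝ (i - j) f x‖) + ‖iteratedFDeriv ℝ i f x‖ := by
        have e : ((mulOp (χ n) f - f : PlaneSchwartz) : Plane → ℂ) =
            (mulOp (χ n) f : Plane → ℂ) - f := rfl
        rw [e, iteratedFDeriv_sub_apply ((mulOp (χ n) f).smooth i).contDiffAt
          (f.smooth i).contDiffAt]
        refine (norm_sub_le _ _).trans (add_le_add_left ?_ _)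
        rw [hfun]
        refine (norm_iteratedFDeriv_smul_le (hχs n) (f.smooth ⊤) x
          (by exact_mod_cast le_top)).trans (Finset.sum_le_sum fun j _ => ?_)
        have := hχb n j x
        gcongr
      refine (mul_le_mul h1 h2 (norm_nonneg _) (by positivity)).trans ?_
      rw [mul_right_comm]
      refine mul_le_mul_of_nonneg_right ?_ (by positivity)
      rw [mul_add, Finset.mul_sum, hM]
      refine add_le_add (Finset.sum_le_sum fun j _ => ?_) (SchwartzMap.le_seminorm ℂ (k + 1) i f x)
      rw [mul_left_comm]
      exact mul_le_mul_of_nonneg_left (SchwartzMap.le_seminorm ℂ (k + 1) (i - j) f x)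
        (mul_nonneg (Nat.cast_nonneg _) (hC0 j))
  have hlim : Filter.Tendsto (fun n : ℕ => M * ((n : ℝ) + 1)⁻¹) Filter.atTop (nhds 0) := by
    have := (tendsto_one_div_add_atTop_nhds_zero_nat (𝕜 := ℝ)).const_mul M
    simpa using this
  filter_upwards [hlim.eventually (gt_mem_nhds hε)] with n hn
  exact (key n).trans_lt hn

variable {b : ℝ} {g : Plane → Matrix (Fin 2) (Fin 2) ℂ}

theorem mem_graph_metricMin {hg : ∀ j k, ContDiff ℝ ∞ fun x => g x j k}
    (hgt : ∀ j k, (fun x => g x j k).HasTemperateGrowth) {p : L2Plane × L2Plane} :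
    p ∈ (metricMin b g hg).graph ↔ ∃ f : PlaneSchwartz, HasCompactSupport f ∧
      p = (toL2 f, toL2 (metricSchwartz b g f)) := by
  have key : ∀ (f : testFunctions) (F : PlaneSchwartz), (F : Plane → ℂ) = f →
      toL2 F = testToL2 f ∧ toL2 (metricSchwartz b g F) = testToL2 (metricLin b g hg f) := by
    intro f F hF
    constructor
    · refine Lp.ext ?_
      refine (SchwartzMap.coeFn_toLp F 2 (volume : Measure Plane)).trans ?_
      rw [hF]
      exact (MemLp.coeFn_toLp (memLp_of_testFunction f.2)).symm
    · refine Lp.ext ?_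
      refine (SchwartzMap.coeFn_toLp _ 2 (volume : Measure Plane)).trans ?_
      have : (metricSchwartz b g F : Plane → ℂ) = metricExpr b g f := by
        ext x; rw [metricSchwartz_apply_eq b hgt, hF]
      rw [this]
      exact (MemLp.coeFn_toLp (memLp_of_testFunction (metricLin b g hg f).2)).symm
  have hmin : ∀ f : testFunctions, (testToL2 f, testToL2 (metricLin b g hg f)) ∈
      (metricMin b g hg).graph := fun f => by
    rw [LinearPMap.mem_graph_iff]
    refine ⟨⟨testToL2 f, LinearMap.mem_range_self _ _⟩, rfl, ?_⟩
    change testToL2 (metricLin b g hg ((LinearEquiv.ofInjective testToL2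
      testToL2_injective).symm _)) = _
    congr 2
    exact (LinearEquiv.ofInjective testToL2 testToL2_injective).symm_apply_apply f
  constructor
  · intro hp
    obtain ⟨⟨u, f, rfl⟩, h1, h2⟩ := (LinearPMap.mem_graph_iff _).1 hp
    obtain ⟨e1, e2⟩ := key f (f.2.2.toSchwartzMap f.2.1) rfl
    refine ⟨f.2.2.toSchwartzMap f.2.1, f.2.2, ?_⟩
    rw [e1, e2]
    refine Prod.ext h1.symm ?_
    rw [← h2]
    exact LinearPMap.mem_graph_snd_inj _ (LinearPMap.mem_graph _ _) (hmin f) rfl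
  · rintro ⟨F, hF, rfl⟩
    obtain ⟨e1, e2⟩ := key ⟨F, F.smooth ⊤, hF⟩ F rfl
    rw [e1, e2]
    exact hmin _

/-- The right side is a closed condition that holds on test functions, which gives one inclusion.
Conversely Schwartz functions are limits of test functions, and `T f` is dense, so every pair
`(solOp T v, v)` is a limit of points of the graph. -/
theorem mem_graph_metricOp (hg : ∀ j k, ContDiff ℝ ∞ fun x => g x j k)
    (hgt : ∀ j k, (fun x => g x j k).HasTemperateGrowth) (h : IsElliptic (metricSchwartz b g))
    {p : L2Plane × L2Plane} :
    p ∈ (metricOp b g hg).graph ↔ solOp (metricSchwartz b g) p.2 = p.1 := by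
  set T := metricSchwartz b g
  have hcl : IsClosed {p : L2Plane × L2Plane | solOp T p.2 = p.1} :=
    isClosed_eq (by fun_prop) (by fun_prop)
  have h1 : ((metricMin b g hg).graph.topologicalClosure : Set (L2Plane × L2Plane)) ⊆
      {p | solOp T p.2 = p.1} := by
    refine closure_minimal ?_ hcl
    intro p hp
    obtain ⟨f, _, rfl⟩ := (mem_graph_metricMin hgt).1 hp
    exact h.solOp_apply f
  -- Injectivity is not what is used in the other direction: a limit pair with first entry `0` has
  -- second entry killed by `solOp T`, hence zero.
  have h2 : (metricMin b g hg).IsClosable := by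
    refine ⟨(metricMin b g hg).graph.topologicalClosure.toLinearPMap, ?_⟩
    rw [Submodule.toLinearPMap_graph_eq]
    intro x hx hx'
    have : solOp T x.2 = x.1 := h1 hx
    rw [hx'] at this
    exact h.solOp_injective this
  rw [metricOp, ← h2.graph_closure_eq_closure_graph]
  refine ⟨fun hp => h1 hp, fun hp => ?_⟩
  have h3 : ∀ f : PlaneSchwartz, (toL2 f, toL2 (T f)) ∈
      (metricMin b g hg).graph.topologicalClosure := fun f => by
    obtain ⟨F, hF, hlim⟩ := exists_seq_hasCompactSupport_tendsto f
    refine mem_closure_of_tendsto (b := Filter.atTop)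
      (f := fun n => (toL2 (F n), toL2 (T (F n)))) ?_ ?_
    · exact ((toL2.continuous.tendsto f).comp hlim).prodMk_nhds
        (((toL2 ∘L T).continuous.tendsto f).comp hlim)
    · exact Filter.Eventually.of_forall fun n => (mem_graph_metricMin hgt).2 ⟨F n, hF n, rfl⟩
  have h4 : ∀ v : L2Plane, (solOp T v, v) ∈ (metricMin b g hg).graph.topologicalClosure :=
    fun v => by
    refine h.dense.induction_on (p := fun v => (solOp T v, v) ∈
      (metricMin b g hg).graph.topologicalClosure) v ?_ fun f => ?_
    · exact (Submodule.isClosed_topologicalClosure _).preimage (by fun_prop)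
    · rw [h.solOp_apply]; exact h3 f
  have := h4 p.2
  rwa [show solOp T p.2 = p.1 from hp] at this

theorem opEigenspace_metricOp (hg : ∀ j k, ContDiff ℝ ∞ fun x => g x j k)
    (hgt : ∀ j k, (fun x => g x j k).HasTemperateGrowth) (h : IsElliptic (metricSchwartz b g))
    {μ : ℝ} (hμ : μ ≠ 0) :
    opEigenspace (metricOp b g hg) μ = eigenKer (solOp (metricSchwartz b g)) μ⁻¹ := by
  ext u
  rw [opEigenspace, Submodule.mem_comap, mem_graph_metricOp hg hgt h, mem_eigenKer]
  have hμ' : (μ : ℂ) ≠ 0 := by exact_mod_cast hμ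
  change solOp _ ((μ : ℂ) • u) = u ↔ _
  rw [map_smul, Complex.ofReal_inv, eq_inv_smul_iff₀ hμ']

theorem opEigenspace_metricOp_zero (hg : ∀ j k, ContDiff ℝ ∞ fun x => g x j k)
    (hgt : ∀ j k, (fun x => g x j k).HasTemperateGrowth) (h : IsElliptic (metricSchwartz b g)) :
    opEigenspace (metricOp b g hg) 0 = ⊥ := by
  rw [Submodule.eq_bot_iff]
  intro u hu
  rw [opEigenspace, Submodule.mem_comap, mem_graph_metricOp hg hgt h] at hu
  change solOp _ (((0 : ℝ) : ℂ) • u) = u at hu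
  rw [← hu]
  simp

end Closure

/-! ### Comparing the difference of inverses with the form of the perturbation. -/

section FormComparison

variable {b σ : ℝ} {m : Plane → Matrix (Fin 2) (Fin 2) ℂ}

/-- Smooth compactly supported functions whose values are non-negative matrices. -/
structure IsMetricBump (m : Plane → Matrix (Fin 2) (Fin 2) ℂ) : Prop where
  smooth : ∀ j k, ContDiff ℝ ∞ fun x => m x j k
  nonneg : ∀ x, (m x).PosSemidef
  supp : HasCompactSupport m

theorem IsMetricBump.hasCompactSupport_entry (h : IsMetricBump m) (j k : Fin 2) :
    HasCompactSupport fun x => m x j k :=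
  h.supp.comp_left (g := fun A : Matrix (Fin 2) (Fin 2) ℂ => A j k) rfl

theorem IsMetricBump.isBddCoeffTwo (h : IsMetricBump m) (j k : Fin 2) :
    IsBddCoeffTwo fun x => m x j k :=
  .of_hasCompactSupport (h.smooth j k) (h.hasCompactSupport_entry j k)

theorem IsMetricBump.growth (h : IsMetricBump m) (j k : Fin 2) :
    (fun x => m x j k).HasTemperateGrowth := (h.isBddCoeffTwo j k).growth

theorem IsMetricBump.exists_norm_le (h : IsMetricBump m) :
    ∃ C, 1 ≤ C ∧ ∀ x, ‖Matrix.toEuclideanCLM (n := Fin 2) (𝕜 := ℂ) (m x)‖ ≤ C := by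
  have h1 : Continuous m := continuous_matrix fun j k => (h.smooth j k).continuous
  have h2 : Continuous (fun A : Matrix (Fin 2) (Fin 2) ℂ =>
      Matrix.toEuclideanCLM (n := Fin 2) (𝕜 := ℂ) A) :=
    LinearMap.continuous_of_finiteDimensional
      (Matrix.toEuclideanCLM (n := Fin 2) (𝕜 := ℂ)).toAlgEquiv.toLinearMap
  obtain ⟨C, hC⟩ := (h.supp.comp_left (g := fun A : Matrix (Fin 2) (Fin 2) ℂ =>
      Matrix.toEuclideanCLM (n := Fin 2) (𝕜 := ℂ) A) (map_zero _)).exists_bound_of_continuous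
      (h2.comp h1)
  exact ⟨max 1 C, le_max_left _ _, fun x => (hC x).trans (le_max_right _ _)⟩

/-- The sign `σ` is `1`, or it is `-1` and the perturbation is smaller than the Landau
Hamiltonian. -/
def IsAdmissibleSign (b σ : ℝ) (m : Plane → Matrix (Fin 2) (Fin 2) ℂ) : Prop :=
  σ = 1 ∨ σ = -1 ∧ ∃ c, 0 ≤ c ∧ c < 1 ∧ ∀ f, metricForm b m f ≤ c * landauForm b f

theorem IsAdmissibleSign.sq_eq (h : IsAdmissibleSign b σ m) : σ ^ 2 = 1 := by
  rcases h with h | h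
  · rw [h]; norm_num
  · rw [h.1]; norm_num

theorem metricForm_perturb_isElliptic (hb : 0 < b) (hm : IsMetricBump m)
    (hσ : IsAdmissibleSign b σ m) : IsElliptic (perturbedOp b σ m) := by
  have hw := metricForm_nonneg b hm.growth hm.nonneg
  rcases hσ with rfl | ⟨rfl, c, hc0, hc1, hc⟩
  · refine isElliptic_perturbedOp hb one_pos le_rfl hm.isBddCoeffTwo
      (fun x => (hm.nonneg x).isHermitian) fun f => ?_
    linarith [hw f]
  · refine isElliptic_perturbedOp hb (sub_pos.2 hc1) (by linarith) hm.isBddCoeffTwo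
      (fun x => (hm.nonneg x).isHermitian) fun f => ?_
    linarith [hc f]

theorem metricForm_add (hm : IsMetricBump m) (f g : PlaneSchwartz) :
    metricForm b m (f + g) = metricForm b m f +
      2 * (inner ℂ (toL2 (metricSchwartz b m f)) (toL2 g)).re + metricForm b m g := by
  have h1 : (inner ℂ (toL2 (metricSchwartz b m g)) (toL2 f)).re =
      (inner ℂ (toL2 (metricSchwartz b m f)) (toL2 g)).re := by
    rw [inner_metricSchwartz b hm.growth (fun x => (hm.nonneg x).isHermitian),
      ← inner_conj_symm, Complex.conj_re]
  simp only [metricForm, map_add, inner_add_left, inner_add_right, Complex.add_re, h1]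
  ring

theorem metricForm_smul (c : ℂ) (f : PlaneSchwartz) :
    metricForm b m (c • f) = ‖c‖ ^ 2 * metricForm b m f := by
  rw [metricForm, map_smul, map_smul, map_smul, inner_smul_left, inner_smul_right, ← mul_assoc,
    ← Complex.normSq_eq_conj_mul_self, Complex.re_ofReal_mul, Complex.normSq_eq_norm_sq]
  rfl

/-- Expand the non-negative form at `-εf + g` and divide by `ε`. -/
theorem metricForm_add_le (hm : IsMetricBump m) {ε : ℝ} (hε : 0 < ε) (f g : PlaneSchwartz) :
    metricForm b m (f + g) ≤ (1 + ε) * metricForm b m f + (1 + ε⁻¹) * metricForm b m g := by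
  have h1 := metricForm_nonneg b hm.growth hm.nonneg ((-(ε : ℂ)) • f + g)
  rw [metricForm_add hm, metricForm_smul, norm_neg, Complex.norm_real, Real.norm_of_nonneg hε.le,
    map_smul, map_smul, inner_smul_left, map_neg, Complex.conj_ofReal, ← Complex.ofReal_neg,
    Complex.re_ofReal_mul] at h1
  rw [metricForm_add hm]
  have h2 := mul_le_mul_of_nonneg_left h1 (inv_nonneg.2 hε.le)
  have h3 : ε⁻¹ * (ε ^ 2 * metricForm b m f + 2 * (-ε * (inner ℂ (toL2 (metricSchwartz b m f))
      (toL2 g)).re) + metricForm b m g) = ε * metricForm b m f -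
      2 * (inner ℂ (toL2 (metricSchwartz b m f)) (toL2 g)).re + ε⁻¹ * metricForm b m g := by
    field_simp
    ring
  rw [mul_zero, h3] at h2
  linarith

theorem landauForm_add (f g : PlaneSchwartz) :
    landauForm b (f + g) = landauForm b f + 2 * (inner ℂ (toL2 (landauOp b f)) (toL2 g)).re +
      landauForm b g := by
  have h1 : (inner ℂ (toL2 (landauOp b g)) (toL2 f)).re =
      (inner ℂ (toL2 (landauOp b f)) (toL2 g)).re := by
    rw [inner_landauOp, ← inner_conj_symm, Complex.conj_re]
  simp only [← re_inner_landauOp, map_add, inner_add_left, inner_add_right, Complex.add_re, h1]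
  ring

/-- The bounded non-negative operator `σ (H₀⁻¹ - (H₀ + σ ∑_{j,k} Π_j m_{jk} Π_k)⁻¹)`. -/
noncomputable def resolventDiff (b σ : ℝ) (m : Plane → Matrix (Fin 2) (Fin 2) ℂ) :
    L2Plane →L[ℂ] L2Plane :=
  (σ : ℂ) • (solOp (landauOp b) - solOp (perturbedOp b σ m))

theorem quadForm_landau (hb : 0 < b) (f : PlaneSchwartz) :
    quadForm (solOp (landauOp b)) (toL2 (landauOp b f)) = landauForm b f := by
  rw [quadForm, (isElliptic_landauOp hb).solOp_apply, ← inner_landauOp, re_inner_landauOp]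

theorem quadForm_resolventDiff (hb : 0 < b) (f : PlaneSchwartz) :
    quadForm (resolventDiff b σ m) (toL2 (landauOp b f)) =
      σ * (landauForm b f - quadForm (solOp (perturbedOp b σ m)) (toL2 (landauOp b f))) := by
  rw [resolventDiff, ← quadForm_landau hb]
  simp only [quadForm, smul_apply, sub_apply, inner_smul_left, Complex.conj_ofReal,
    Complex.re_ofReal_mul, inner_sub_left, Complex.sub_re]

/-- The functional of the variational principle at `u = H₀ f` and trial function `f + g`. With K the
operator `resolventDiff`, it turns K[H₀f] into the infimum over `g` of `landauForm g + metricForm (f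
+ g)` when `σ = 1`, and into the supremum of `metricForm (f + g) - landauForm g` when `σ = -1`. -/
theorem variational_eq (f g : PlaneSchwartz) :
    2 * (inner ℂ (toL2 (landauOp b f)) (toL2 (f + g))).re -
      (inner ℂ (toL2 (perturbedOp b σ m (f + g))) (toL2 (f + g))).re =
      landauForm b f - landauForm b g - σ * metricForm b m (f + g) := by
  rw [re_inner_perturbedOp, landauForm_add, map_add, inner_add_right, Complex.add_re,
    re_inner_landauOp]
  ring

/-- The trial function `g = 0` gives one inequality for each sign. The other follows from
`metricForm_add_le`, the term in `g` being absorbed by `landauForm b g`. -/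
theorem exists_quadForm_resolventDiff_bounds (hb : 0 < b) (hm : IsMetricBump m)
    (hσ : IsAdmissibleSign b σ m) :
    ∃ C, 1 ≤ C ∧ ∀ f,
      metricForm b m f ≤ C * quadForm (resolventDiff b σ m) (toL2 (landauOp b f)) ∧
      quadForm (resolventDiff b σ m) (toL2 (landauOp b f)) ≤ C * metricForm b m f := by
  have hell := metricForm_perturb_isElliptic hb hm hσ
  have hw := metricForm_nonneg b hm.growth hm.nonneg
  have hle : ∀ f, landauForm b f - σ * metricForm b m f ≤
      quadForm (solOp (perturbedOp b σ m)) (toL2 (landauOp b f)) := fun f => by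
    have h1 := hell.le_quadForm (toL2 (landauOp b f)) (f + 0)
    rw [variational_eq, add_zero] at h1
    have : landauForm b 0 = 0 := by simp [landauForm]
    linarith
  have hge : ∀ f M, (∀ g, landauForm b f - landauForm b g - σ * metricForm b m (f + g) ≤ M) →
      quadForm (solOp (perturbedOp b σ m)) (toL2 (landauOp b f)) ≤ M := fun f M hM => by
    refine hell.quadForm_le _ fun h => ?_
    have h1 := hM (h - f)
    rw [← variational_eq, add_sub_cancel] at h1
    exact h1
  rcases hσ with rfl | ⟨rfl, c, hc0, hc1, hc⟩
  · obtain ⟨C, hC1, hC⟩ := hm.exists_norm_le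
    have hC' := metricForm_le b hm.growth hC
    refine ⟨2 * C, by linarith, fun f => ?_⟩
    rw [quadForm_resolventDiff hb]
    constructor
    · have h1 := hge f (landauForm b f - (2 * C)⁻¹ * metricForm b m f) fun g => by
        -- Here `f` is written as `(f + g) + (-g)`, and `metricForm b m g ≤ C * landauForm b g`.
        have h2 := metricForm_add_le (b := b) hm one_pos (f + g) (-g)
        have h3 : metricForm b m (-g) = metricForm b m g := by
          rw [← neg_one_smul ℂ g, metricForm_smul]; simp
        rw [add_neg_cancel_right, h3] at h2
        have h4 := hC' g
        have h5 : metricForm b m f ≤ 2 * C * (landauForm b g + metricForm b m (f + g)) := by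
          have := mul_le_mul_of_nonneg_right hC1 (hw (f + g))
          norm_num at h2
          linarith
        have h6 : (2 * C)⁻¹ * metricForm b m f ≤ landauForm b g + metricForm b m (f + g) := by
          rw [inv_mul_le_iff₀ (by linarith)]; exact h5
        linarith
      have h2 : (2 * C) * ((2 * C)⁻¹ * metricForm b m f) = metricForm b m f :=
        mul_inv_cancel_left₀ (by linarith) _
      have h3 := mul_le_mul_of_nonneg_left h1 (show 0 ≤ 2 * C by linarith)
      linarith
    · have := mul_le_mul_of_nonneg_right hC1 (hw f)
      linarith [hle f, hw f]
  · have hε : 0 < 1 - c := sub_pos.2 hc1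
    refine ⟨1 + (1 - c)⁻¹, by linarith [inv_pos.2 hε], fun f => ?_⟩
    rw [quadForm_resolventDiff hb]
    constructor
    · have h1 := mul_nonneg (inv_pos.2 hε).le (hw f)
      have h2 := hle f
      have h3 : metricForm b m f ≤
        -1 * (landauForm b f - quadForm (solOp (perturbedOp b (-1) m)) (toL2 (landauOp b f))) := by
        linarith
      refine h3.trans (le_mul_of_one_le_left ((hw f).trans h3) ?_)
      linarith [inv_pos.2 hε]
    · have h1 := hge f (landauForm b f + (1 + (1 - c)⁻¹) * metricForm b m f) fun g => by
        have h2 := metricForm_add_le (b := b) hm hε g f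
        rw [add_comm g f] at h2
        have h3 := mul_le_mul_of_nonneg_left (hc g) (show 0 ≤ 1 + (1 - c) by linarith)
        -- The parameter `ε = 1 - c` works because `(2 - c)c = 1 - (1 - c)² ≤ 1`.
        have h4 : (1 + (1 - c)) * (c * landauForm b g) ≤ landauForm b g := by
          have := mul_nonneg (sq_nonneg (1 - c)) (landauForm_nonneg b g)
          nlinarith
        linarith
      linarith

theorem isPositive_resolventDiff (hb : 0 < b) (hm : IsMetricBump m)
    (hσ : IsAdmissibleSign b σ m) : (resolventDiff b σ m).IsPositive := by
  have hell := metricForm_perturb_isElliptic hb hm hσ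
  have hell0 := isElliptic_landauOp hb
  obtain ⟨C, hC1, hC⟩ := exists_quadForm_resolventDiff_bounds hb hm hσ
  rw [ContinuousLinearMap.isPositive_def]
  refine ⟨fun u v => ?_, fun u => ?_⟩
  · change inner ℂ ((σ : ℂ) • (solOp (landauOp b) u - solOp (perturbedOp b σ m) u)) v =
      inner ℂ u ((σ : ℂ) • (solOp (landauOp b) v - solOp (perturbedOp b σ m) v))
    rw [inner_smul_left, inner_smul_right, inner_sub_left, inner_sub_right, hell.inner_solOp,
      hell0.inner_solOp, Complex.conj_ofReal]
  · refine hell0.dense.induction_on (p := fun u =>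
      0 ≤ (resolventDiff b σ m).reApplyInnerSelf u) u ?_ fun f => ?_
    · exact isClosed_le continuous_const (resolventDiff b σ m).reApplyInnerSelf_continuous
    · have h1 := (metricForm_nonneg b hm.growth hm.nonneg f).trans (hC f).1
      exact nonneg_of_mul_nonneg_right h1 (by linarith)

theorem solOp_perturbedOp_eq (hσ : IsAdmissibleSign b σ m) :
    solOp (perturbedOp b σ m) = solOp (landauOp b) - (σ : ℂ) • resolventDiff b σ m := by
  have : ((σ : ℂ)) * σ = 1 := by
    have := hσ.sq_eq
    rw [← sq]; exact_mod_cast this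
  rw [resolventDiff, smul_smul, this, one_smul, sub_sub_cancel]

end FormComparison

/-! ### Factorial upper bound for the perturbation on one Landau level. -/

section ToeplitzUpper

theorem creOp_pow_of_commutator {b : ℝ} {Y : PlaneSchwartz →L[ℂ] PlaneSchwartz}
    (hY : ∀ f, creOp b (Y f) = Y (creOp b f) - (2 * Complex.I : ℂ) • f) (k : ℕ)
    (f : PlaneSchwartz) :
    creOp b ((Y ^ (k + 1)) f) =
      (Y ^ (k + 1)) (creOp b f) - (2 * Complex.I * (k + 1) : ℂ) • (Y ^ k) f := by
  induction k with
  | zero => simp [hY]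
  | succ k ih =>
    rw [pow_succ' Y (k + 1), mul_apply_eq_comp, hY, ih, map_sub, map_smul,
      mul_apply_eq_comp, ← mul_apply_eq_comp Y (Y ^ k), ← pow_succ' Y k]
    push_cast
    module

theorem pow_apply_of_mul {Y : PlaneSchwartz →L[ℂ] PlaneSchwartz} {y : Plane → ℂ}
    (hy : ∀ f x, Y f x = y x * f x) (k : ℕ) (f : PlaneSchwartz) (x : Plane) :
    (Y ^ k) f x = y x ^ k * f x := by
  induction k with
  | zero => simp
  | succ k ih =>
    rw [pow_succ' Y, mul_apply_eq_comp, hy, ih, pow_succ']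
    ring

theorem zOp_apply (f : PlaneSchwartz) (x : Plane) : zOp f x = coordZ x * f x :=
  mulOp_apply hasTemperateGrowth_coordZ f x

theorem annOp_zOp_pow (b : ℝ) (k : ℕ) (f : PlaneSchwartz) :
    annOp b ((zOp ^ k) f) = (zOp ^ k) (annOp b f) := by
  induction k with
  | zero => simp
  | succ k ih => rw [pow_succ', mul_apply_eq_comp, annOp_zOp, ih, mul_apply_eq_comp]

/-- Moving a creation operator past `Y ^ k` costs only a factor linear in `k`, so differentiation
leaves the growth on a bounded set geometric in `k`. Stated for general `Y` to serve both `z` and `z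
- w`. -/
theorem exists_norm_creOp_pow_pow_le {b : ℝ} {Y : PlaneSchwartz →L[ℂ] PlaneSchwartz}
    (hY : ∀ f, creOp b (Y f) = Y (creOp b f) - (2 * Complex.I : ℂ) • f) {y : Plane → ℂ}
    (hy : ∀ f x, Y f x = y x * f x) {B : Set Plane} {R : ℝ} (hR : ∀ x ∈ B, ‖y x‖ ≤ R) (n : ℕ) :
    ∀ f : PlaneSchwartz, ∃ C, 1 ≤ C ∧ ∀ k, ∀ x ∈ B,
      ‖(creOp b ^ n) ((Y ^ k) f) x‖ ≤ C ^ (k + 1) := by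
  induction n with
  | zero =>
    intro f
    obtain ⟨M, hM⟩ := f.toBoundedContinuousFunction.bddAbove_range_norm_comp
    have hM' : ∀ x, ‖f x‖ ≤ M := fun x => hM ⟨x, rfl⟩
    refine ⟨max 1 (max R M), le_max_left _ _, fun k x hx => ?_⟩
    rw [pow_zero, one_apply_eq_self, pow_apply_of_mul hy, norm_mul, norm_pow, pow_succ]
    have h1 : ‖y x‖ ≤ max 1 (max R M) :=
      (hR x hx).trans ((le_max_left _ _).trans (le_max_right _ _))
    have h2 : ‖f x‖ ≤ max 1 (max R M) := (hM' x).trans ((le_max_right _ _).trans (le_max_right _ _))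
    gcongr
  | succ n ih =>
    intro f
    obtain ⟨C1, h1, hC1⟩ := ih (creOp b f)
    obtain ⟨C2, h2, hC2⟩ := ih f
    refine ⟨C1 + (2 * C2 + 2), by linarith, fun k x hx => ?_⟩
    rw [pow_succ (creOp b) n, mul_apply_eq_comp]
    have hp := pow_add_pow_le (show 0 ≤ C1 by linarith) (show 0 ≤ 2 * C2 + 2 by linarith)
      (Nat.succ_ne_zero k)
    cases k with
    | zero =>
      have := hC1 0 x hx
      simp only [pow_zero, one_apply_eq_self] at this ⊢
      simp only [zero_add, pow_one] at this ⊢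
      linarith
    | succ k =>
      rw [creOp_pow_of_commutator hY, map_sub, map_smul, sub_apply, smul_apply]
      refine (norm_sub_le _ _).trans (le_trans (add_le_add (hC1 (k + 1) x hx) ?_) hp)
      rw [norm_smul]
      have e1 : ‖(2 * Complex.I * (k + 1) : ℂ)‖ = 2 * (k + 1) := by
        rw [norm_mul, norm_mul, Complex.norm_I]
        have : ‖((k : ℂ) + 1)‖ = k + 1 := by
          rw [← Nat.cast_succ, Complex.norm_natCast]; push_cast; rfl
        rw [this]; simp
      -- The linear factor from the commutator is absorbed into the geometric constant.
      have e2 : ((k : ℝ) + 1) ≤ 2 ^ (k + 1) := by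
        exact_mod_cast (Nat.lt_two_pow_self (n := k + 1)).le
      rw [e1]
      calc 2 * ((k : ℝ) + 1) * ‖(creOp b ^ n) ((Y ^ k) f) x‖
          ≤ 2 * 2 ^ (k + 1) * C2 ^ (k + 1) := by
            have := hC2 k x hx
            gcongr
        _ = 2 * (2 * C2) ^ (k + 1) := by rw [mul_pow]; ring
        _ ≤ (2 * C2 + 2) * (2 * C2 + 2) ^ (k + 1) := by gcongr <;> linarith
        _ = (2 * C2 + 2) ^ (k + 1).succ := by rw [Nat.succ_eq_add_one, pow_succ' _ (k + 1)]

/-- Functions `z^k` times the ground state are annihilated by `annOp`, so on them `guideCreOp` is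
multiplication by `I b z`. -/
theorem guideCreOp_pow_groundState {b : ℝ} (hb : 0 < b) (k : ℕ) :
    (guideCreOp b ^ k) (groundState b hb) =
      (Complex.I * b) ^ k • (zOp ^ k) (groundState b hb) := by
  induction k with
  | zero => simp
  | succ k ih =>
    rw [pow_succ' (guideCreOp b), mul_apply_eq_comp, ih, map_smul, guideCreOp_apply,
      annOp_zOp_pow, annOp_groundState, map_zero, zero_add, pow_succ' zOp, mul_apply_eq_comp,
      smul_smul, pow_succ]

theorem landauState_eq_zOp_pow {b : ℝ} (hb : 0 < b) (q k : ℕ) :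
    landauState b hb q k = (Complex.I * b) ^ k • (creOp b ^ q) ((zOp ^ k) (groundState b hb)) := by
  rw [landauState, guideCreOp_pow_groundState, map_smul]

theorem norm_landauState_sq {b : ℝ} (hb : 0 < b) (q k : ℕ) :
    ‖toL2 (landauState b hb q k)‖ ^ 2 =
      (2 * b) ^ (q + k) * q.factorial * k.factorial * ‖toL2 (groundState b hb)‖ ^ 2 := by
  have h := landauState_inner hb q k q k
  rw [if_pos ⟨rfl, rfl⟩, inner_self_eq_norm_sq_to_K] at h
  apply Complex.ofReal_injective
  rw [← h]
  simp

theorem momOp_zero_eq (b : ℝ) (f : PlaneSchwartz) :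
    momOp b 0 f = (1 / 2 : ℂ) • (annOp b f + creOp b f) := by
  rw [annOp_apply, creOp_apply]; module

theorem momOp_one_eq (b : ℝ) (f : PlaneSchwartz) :
    momOp b 1 f = (-Complex.I / 2 : ℂ) • (annOp b f - creOp b f) := by
  rw [annOp_apply, creOp_apply]
  have : (-Complex.I / 2 : ℂ) • (momOp b 0 f + Complex.I • momOp b 1 f -
      (momOp b 0 f - Complex.I • momOp b 1 f)) = (-(Complex.I * Complex.I)) • momOp b 1 f := by
    module
  rw [this, Complex.I_mul_I, neg_neg, one_smul]

theorem norm_momOp_apply_le (b : ℝ) (l : Fin 2) (f : PlaneSchwartz) (x : Plane) :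
    ‖momOp b l f x‖ ≤ ‖annOp b f x‖ + ‖creOp b f x‖ := by
  have h0 := norm_nonneg (annOp b f x)
  have h1 := norm_nonneg (creOp b f x)
  fin_cases l
  · change ‖momOp b 0 f x‖ ≤ _
    rw [momOp_zero_eq, smul_apply, add_apply, norm_smul]
    have := norm_add_le (annOp b f x) (creOp b f x)
    norm_num
    linarith
  · change ‖momOp b 1 f x‖ ≤ _
    rw [momOp_one_eq, smul_apply, sub_apply, norm_smul]
    have := norm_sub_le (annOp b f x) (creOp b f x)
    norm_num
    linarith

theorem exists_norm_landauState_le {b : ℝ} (hb : 0 < b) (R : ℝ) (q : ℕ) :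
    ∃ C, 1 ≤ C ∧ ∀ k x, ‖x‖ ≤ R → ‖landauState b hb q k x‖ ≤ C ^ (k + 1) := by
  obtain ⟨C, h1, hC⟩ := exists_norm_creOp_pow_pow_le (B := {x | ‖x‖ ≤ R}) (creOp_zOp b)
    zOp_apply (fun x hx => (norm_coordZ x).trans_le hx) q (groundState b hb)
  refine ⟨(b + 1) * C, by nlinarith, fun k x hx => ?_⟩
  rw [landauState_eq_zOp_pow, smul_apply, norm_smul, norm_pow, norm_mul, Complex.norm_I, one_mul,
    Complex.norm_real, Real.norm_of_nonneg hb.le, mul_pow]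
  have h2 : b ^ k ≤ (b + 1) ^ (k + 1) := by
    calc b ^ k ≤ (b + 1) ^ k := by gcongr; linarith
      _ ≤ (b + 1) ^ (k + 1) := pow_le_pow_right₀ (by linarith) (by omega)
  have := hC k x hx
  gcongr

theorem exists_norm_momOp_landauState_le {b : ℝ} (hb : 0 < b) (R : ℝ) (q : ℕ) :
    ∃ C, 1 ≤ C ∧ ∀ k l x, ‖x‖ ≤ R → ‖momOp b l (landauState b hb q k) x‖ ≤ C ^ (k + 1) := by
  obtain ⟨C1, h1, hC1⟩ := exists_norm_landauState_le hb R (q + 1)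
  have h2 : ∃ C, 1 ≤ C ∧ ∀ k x, ‖x‖ ≤ R →
      ‖annOp b (landauState b hb q k) x‖ ≤ C ^ (k + 1) := by
    cases q with
    | zero =>
      refine ⟨1, le_rfl, fun k x _ => ?_⟩
      rw [annOp_landauState_zero, one_pow]
      change ‖(0 : ℂ)‖ ≤ 1
      simp
    | succ q =>
      obtain ⟨C, hC1, hC⟩ := exists_norm_landauState_le hb R q
      refine ⟨(2 * b * (q + 1) + 1) * C, ?_, fun k x hx => ?_⟩
      · have : 0 ≤ 2 * b * (q + 1) * C := by positivity
        linarith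
      · rw [annOp_landauState_succ, smul_apply, norm_smul, mul_pow]
        have e : ‖(2 * b * (q + 1) : ℂ)‖ = 2 * b * (q + 1) := by
          rw [show (2 * b * (q + 1) : ℂ) = ((2 * b * (q + 1) : ℝ) : ℂ) by push_cast; rfl,
            Complex.norm_real, Real.norm_of_nonneg (by positivity)]
        rw [e]
        have e2 : 2 * b * (q + 1) ≤ (2 * b * (q + 1) + 1) ^ (k + 1) := by
          have : (1 : ℝ) ≤ 2 * b * (q + 1) + 1 := by
            have : 0 ≤ 2 * b * (q + 1 : ℝ) := by positivity
            linarith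
          refine le_trans ?_ (le_self_pow₀ this (Nat.succ_ne_zero k))
          linarith
        have := hC k x hx
        gcongr
  obtain ⟨C2, h2, hC2⟩ := h2
  refine ⟨C2 + C1, by linarith, fun k l x hx => ?_⟩
  refine (norm_momOp_apply_le b l _ x).trans ?_
  rw [creOp_landauState]
  exact (add_le_add (hC2 k x hx) (hC1 k x hx)).trans
    (pow_add_pow_le (by linarith) (by linarith) (Nat.succ_ne_zero k))

theorem mul_pow_succ_le {A C : ℝ} (hA : 1 ≤ A) (hC : 0 ≤ C) (k : ℕ) :
    A * C ^ (k + 1) ≤ (A * C) ^ (k + 1) := by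
  rw [mul_pow]
  exact mul_le_mul_of_nonneg_right (le_self_pow₀ hA (Nat.succ_ne_zero k)) (by positivity)

/-- On a fixed disc the unnormalized states grow geometrically, while their squared norms over the
plane are of order `(2b)^k k!`; normalization produces the factorial. -/
theorem exists_norm_momOp_landauFun_le {b : ℝ} (hb : 0 < b) (R : ℝ) (q : ℕ) :
    ∃ C, 1 ≤ C ∧ ∀ k l x, ‖x‖ ≤ R →
      ‖momOp b l (landauFun b hb (q, k)) x‖ ^ 2 ≤ C ^ (k + 1) / k.factorial := by
  obtain ⟨C, h1, hC⟩ := exists_norm_momOp_landauState_le hb R q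
  set N := ‖toL2 (groundState b hb)‖ ^ 2 with hN
  have hN0 : 0 < N := by
    have h := norm_pos_iff.2 (toL2_landauState_ne_zero hb 0 0)
    simp only [landauState, pow_zero, one_apply_eq_self] at h
    positivity
  set D := (2 * b) ^ q * q.factorial * N with hD
  have hD0 : 0 < D := by positivity
  set A := max 1 D⁻¹ with hA
  set B := max 1 (2 * b)⁻¹ with hB
  have hA1 : 1 ≤ A := le_max_left _ _
  have hB1 : 1 ≤ B := le_max_left _ _
  have hABC : 1 ≤ A * (B * C ^ 2) := by
    have := one_le_mul_of_one_le_of_one_le hB1 (one_le_pow₀ h1 (n := 2))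
    exact one_le_mul_of_one_le_of_one_le hA1 this
  refine ⟨A * (B * C ^ 2), hABC, fun k l x hx => ?_⟩
  rw [landauFun, map_smul, smul_apply, norm_smul, Complex.norm_real, Real.norm_of_nonneg
    (by positivity), mul_pow, inv_pow, norm_landauState_sq, ← hN]
  have e1 : ((2 * b) ^ (q + k) * q.factorial * k.factorial * N)⁻¹ =
      D⁻¹ * ((2 * b)⁻¹) ^ k / k.factorial := by
    rw [hD, pow_add, inv_pow]
    field_simp
  rw [e1]
  have e2 : ((2 * b)⁻¹) ^ k ≤ B ^ (k + 1) := by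
    calc ((2 * b)⁻¹) ^ k ≤ B ^ k := pow_le_pow_left₀ (by positivity) (le_max_right _ _) k
      _ ≤ B ^ (k + 1) := pow_le_pow_right₀ hB1 (by omega)
  have e3 : ‖momOp b l (landauState b hb q k) x‖ ^ 2 ≤ (C ^ 2) ^ (k + 1) := by
    rw [← pow_mul, mul_comm 2, pow_mul]
    exact pow_le_pow_left₀ (norm_nonneg _) (hC k l x hx) 2
  rw [div_mul_eq_mul_div]
  refine div_le_div_of_nonneg_right ?_ (by positivity)
  refine le_trans ?_ (mul_pow_succ_le hA1 (by positivity) k)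
  rw [mul_pow, mul_assoc]
  have e4 : D⁻¹ ≤ A := le_max_right _ _
  gcongr

/-- Since `k! i! ≤ (k + i)!`, a factorial tail is comparable to its first term. -/
theorem sum_pow_div_factorial_le {C : ℝ} (hC : 0 ≤ C) {k : ℕ} {s : Finset ℕ}
    (hs : ∀ j ∈ s, k ≤ j) :
    ∑ j ∈ s, C ^ (j + 1) / j.factorial ≤ C ^ (k + 1) / k.factorial * Real.exp C := by
  obtain ⟨n, hn⟩ := s.exists_nat_subset_range
  have h1 : s ⊆ (Finset.range n).image (fun i => k + i) := fun j hj => by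
    refine Finset.mem_image.2 ⟨j - k, ?_, by have := hs j hj; omega⟩
    have := Finset.mem_range.1 (hn hj)
    exact Finset.mem_range.2 (by omega)
  refine (Finset.sum_le_sum_of_subset_of_nonneg h1 fun _ _ _ => by positivity).trans ?_
  rw [Finset.sum_image fun a _ c _ h => Nat.add_left_cancel h]
  refine le_trans (Finset.sum_le_sum (g := fun i => C ^ (k + 1) / k.factorial *
    (C ^ i / i.factorial)) fun i _ => ?_) ?_
  · rw [div_mul_div_comm, show k + i + 1 = (k + 1) + i by ring, pow_add]
    refine div_le_div_of_nonneg_left (by positivity) (by positivity) ?_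
    exact_mod_cast Nat.le_of_dvd (Nat.factorial_pos _) (Nat.factorial_mul_factorial_dvd_factorial_add k i)
  · rw [← Finset.mul_sum]
    exact mul_le_mul_of_nonneg_left (Real.sum_le_exp_of_nonneg hC n) (by positivity)

/-- Pointwise Cauchy–Schwarz on a ball containing the support of `m`, then the factorial tail bound;
the volume of the ball enters the constant. -/
theorem exists_metricForm_combination_le {b : ℝ} (hb : 0 < b)
    {m : Plane → Matrix (Fin 2) (Fin 2) ℂ} (hm : IsMetricBump m) (q : ℕ) :
    ∃ C, 1 ≤ C ∧ ∀ (k : ℕ) (s : Finset ℕ) (c : ℕ → ℂ), (∀ j ∈ s, k ≤ j) →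
      metricForm b m (∑ j ∈ s, c j • landauFun b hb (q, j)) ≤
        C ^ (k + 1) / k.factorial * ∑ j ∈ s, ‖c j‖ ^ 2 := by
  obtain ⟨M, hM1, hM⟩ := hm.exists_norm_le
  obtain ⟨R, hR0, hR⟩ : ∃ R, 0 ≤ R ∧ ∀ x, R < ‖x‖ → m x = 0 := by
    obtain ⟨R, hR⟩ := hm.supp.isCompact.isBounded.exists_norm_le
    refine ⟨max R 0, le_max_right _ _, fun x hx => ?_⟩
    by_contra h
    exact absurd (hR x (subset_tsupport m h)) (not_le.2 ((le_max_left _ _).trans_lt hx))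
  obtain ⟨C, hC1, hC⟩ := exists_norm_momOp_landauFun_le hb R q
  set V := (volume : Measure Plane).real (Metric.closedBall 0 R) with hV
  set A := max 1 (M * 2 * Real.exp C * V) with hA
  have hA1 : 1 ≤ A := le_max_left _ _
  refine ⟨A * C, one_le_mul_of_one_le_of_one_le hA1 hC1, fun k s c hs => ?_⟩
  set φ := ∑ j ∈ s, c j • landauFun b hb (q, j) with hφ
  set S := ∑ j ∈ s, ‖c j‖ ^ 2 with hS
  have hS0 : 0 ≤ S := Finset.sum_nonneg fun _ _ => by positivity
  set E := C ^ (k + 1) / k.factorial * Real.exp C * S with hE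
  have hE0 : 0 ≤ E := by positivity
  have hpt : ∀ l x, ‖x‖ ≤ R → ‖momOp b l φ x‖ ^ 2 ≤ E := fun l x hx => by
    have e1 : momOp b l φ x = ∑ j ∈ s, c j * momOp b l (landauFun b hb (q, j)) x := by
      rw [hφ, map_sum, sum_apply]
      refine Finset.sum_congr rfl fun j _ => ?_
      rw [map_smul, smul_apply, smul_eq_mul]
    have e2 : ‖momOp b l φ x‖ ≤ ∑ j ∈ s, ‖c j‖ * ‖momOp b l (landauFun b hb (q, j)) x‖ := by
      rw [e1]
      refine (norm_sum_le _ _).trans (Finset.sum_le_sum fun j _ => (norm_mul _ _).le)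
    have e3 := pow_le_pow_left₀ (norm_nonneg _) e2 2
    refine e3.trans ((Finset.sum_mul_sq_le_sq_mul_sq _ _ _).trans ?_)
    rw [mul_comm, hE]
    refine mul_le_mul_of_nonneg_right ?_ hS0
    exact (Finset.sum_le_sum fun j _ => hC j l x hx).trans
      (sum_pow_div_factorial_le (by linarith) hs)
  have hd : ∀ x, metricDensity b m φ x ≤
      (Metric.closedBall (0 : Plane) R).indicator (fun _ => M * (2 * E)) x := fun x => by
    by_cases hx : ‖x‖ ≤ R
    · rw [indicator_of_mem (by simpa using hx)]
      refine (metricDensity_le b (hM x) φ).trans (mul_le_mul_of_nonneg_left ?_ (by linarith))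
      rw [Fin.sum_univ_two]
      linarith [hpt 0 x hx, hpt 1 x hx]
    · rw [indicator_of_notMem (by simpa using hx)]
      simp [metricDensity, hR x (not_le.1 hx)]
  rw [metricForm_eq b hm.growth]
  refine (integral_mono (integrable_metricDensity b hm.growth φ)
    ((integrable_indicator_iff measurableSet_closedBall).2
      (integrableOn_const (measure_closedBall_lt_top.ne))) hd).trans ?_
  rw [integral_indicator measurableSet_closedBall, setIntegral_const, smul_eq_mul, ← hV, hE]
  have hfin : A * C ^ (k + 1) / k.factorial * S ≤ (A * C) ^ (k + 1) / k.factorial * S := by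
    have := mul_pow_succ_le hA1 (show 0 ≤ C by linarith) k
    gcongr
  refine le_trans ?_ hfin
  have e5 : V * (M * (2 * (C ^ (k + 1) / k.factorial * Real.exp C * S))) =
      (M * 2 * Real.exp C * V) * (C ^ (k + 1) / k.factorial * S) := by ring
  rw [e5, mul_div_assoc, mul_assoc A]
  exact mul_le_mul_of_nonneg_right (le_max_right _ _) (by positivity)

end ToeplitzUpper

/-! ### Passing form bounds from finite combinations to the whole space. -/

section HilbertBasisForms

variable {H : Type*} [NormedAddCommGroup H] [InnerProductSpace ℂ H] {ι : Type*}

theorem norm_sum_hilbertBasis_sq (e : HilbertBasis ι ℂ H) (s : Finset ι) (c : ι → ℂ) :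
    ‖∑ i ∈ s, c i • e i‖ ^ 2 = ∑ i ∈ s, ‖c i‖ ^ 2 := by
  have h := e.orthonormal.inner_sum c c s
  rw [inner_self_eq_norm_sq_to_K] at h
  apply Complex.ofReal_injective
  push_cast
  refine h.trans (Finset.sum_congr rfl fun i _ => ?_)
  rw [← Complex.normSq_eq_conj_mul_self, Complex.normSq_eq_norm_sq]
  push_cast; rfl

theorem quadForm_le_of_finset_sum (e : HilbertBasis ι ℂ H) (T : H →L[ℂ] H) {δ : ℝ} (I : Set ι)
    (h : ∀ (s : Finset ι) (c : ι → ℂ), (∀ i ∈ s, i ∈ I) →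
      quadForm T (∑ i ∈ s, c i • e i) ≤ δ * ∑ i ∈ s, ‖c i‖ ^ 2) {v : H}
    (hv : ∀ i ∉ I, inner ℂ (e i) v = 0) : quadForm T v ≤ δ * ‖v‖ ^ 2 := by
  classical
  have hcl : IsClosed {v : H | quadForm T v ≤ δ * ‖v‖ ^ 2} :=
    isClosed_le (continuous_quadForm T) (by fun_prop)
  refine hcl.mem_of_tendsto (e.hasSum_repr v) (Filter.Eventually.of_forall fun s => ?_)
  have h1 : ∑ i ∈ s, e.repr v i • e i = ∑ i ∈ s.filter (· ∈ I), e.repr v i • e i := by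
    rw [Finset.sum_filter_of_ne]
    intro i _ hi
    by_contra hI
    rw [e.repr_apply_apply, hv i hI, zero_smul] at hi
    exact hi rfl
  change quadForm T _ ≤ δ * ‖_‖ ^ 2
  rw [h1, norm_sum_hilbertBasis_sq]
  exact h _ _ fun i hi => (Finset.mem_filter.1 hi).2

theorem quadForm_sum_le [CompleteSpace H] {K : H →L[ℂ] H} (hK : K.IsPositive) (s : Finset ι)
    (y : ι → H) : quadForm K (∑ i ∈ s, y i) ≤ s.card * ∑ i ∈ s, quadForm K (y i) := by
  obtain ⟨S, hS, hSK⟩ := exists_selfAdjoint_sqrt hK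
  simp only [quadForm_eq_norm_sq hS hSK, map_sum]
  exact (pow_le_pow_left₀ (norm_nonneg _) (norm_sum_le _ _) 2).trans sq_sum_le_card_mul_sum_sq

theorem quadForm_add_le [CompleteSpace H] {K : H →L[ℂ] H} (hK : K.IsPositive) (x y : H) :
    quadForm K (x + y) ≤ 2 * (quadForm K x + quadForm K y) := by
  have := quadForm_sum_le hK Finset.univ ![x, y]
  simpa [Fin.sum_univ_two] using this

end HilbertBasisForms

/-! ### Smallness of the form of the difference of inverses. -/

section LandauForms

variable {b σ : ℝ} {m : Plane → Matrix (Fin 2) (Fin 2) ℂ}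

theorem landauLevel_pos (hb : 0 < b) (q : ℕ) : 0 < landauLevel b q := by
  rw [landauLevel]; positivity

theorem landauLevel_strictMono (hb : 0 < b) : StrictMono (landauLevel b) := by
  intro p q h
  rw [landauLevel, landauLevel]
  have : (p : ℝ) < q := by exact_mod_cast h
  nlinarith

theorem solOp_landauBasis (hb : 0 < b) (i : ℕ × ℕ) :
    solOp (landauOp b) (landauBasis b hb i) =
      (((landauLevel b i.1)⁻¹ : ℝ) : ℂ) • landauBasis b hb i := by
  have h1 : (landauLevel b i.1 : ℂ) ≠ 0 := by exact_mod_cast (landauLevel_pos hb i.1).ne'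
  have h2 : landauBasis b hb i =
      toL2 (landauOp b ((landauLevel b i.1 : ℂ)⁻¹ • landauFun b hb i)) := by
    rw [map_smul, landauOp_landauFun, smul_smul, inv_mul_cancel₀ h1, one_smul,
      landauBasis_apply]
  rw [h2, (isElliptic_landauOp hb).solOp_apply, map_smul, map_smul, landauOp_landauFun,
    smul_smul, inv_mul_cancel₀ h1, one_smul, Complex.ofReal_inv]

theorem sum_landauBasis_eq (hb : 0 < b) (s : Finset (ℕ × ℕ)) (c : ℕ × ℕ → ℂ) :
    ∑ i ∈ s, c i • landauBasis b hb i = toL2 (landauOp b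
      (∑ i ∈ s, (c i * (landauLevel b i.1 : ℂ)⁻¹) • landauFun b hb i)) := by
  rw [map_sum, map_sum]
  refine Finset.sum_congr rfl fun i _ => ?_
  have h1 : (landauLevel b i.1 : ℂ) ≠ 0 := by exact_mod_cast (landauLevel_pos hb i.1).ne'
  rw [map_smul, landauOp_landauFun, smul_smul, mul_assoc, inv_mul_cancel₀ h1, mul_one, map_smul,
    landauBasis_apply]

theorem isSelfAdjoint_solOp_landau (hb : 0 < b) : IsSelfAdjoint (solOp (landauOp b)) :=
  (isElliptic_landauOp hb).isPositive_solOp.isSelfAdjoint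

/-- The projection onto the eigenspace of a Landau level. -/
noncomputable def landauProj (b : ℝ) (q : ℕ) : L2Plane →L[ℂ] L2Plane :=
  (eigenKer (solOp (landauOp b)) (landauLevel b q)⁻¹).starProjection

theorem landauProj_landauBasis (hb : 0 < b) (q : ℕ) (i : ℕ × ℕ) :
    landauProj b q (landauBasis b hb i) = if i.1 = q then landauBasis b hb i else 0 := by
  split_ifs with h
  · refine Submodule.starProjection_eq_self_iff.2 (mem_eigenKer.2 ?_)
    rw [solOp_landauBasis, h]
  · refine (Submodule.starProjection_apply_eq_zero_iff _).2 ?_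
    rw [Submodule.mem_orthogonal]
    intro u hu
    refine inner_eq_zero_of_eigen (isSelfAdjoint_solOp_landau hb) ?_ (mem_eigenKer.1 hu)
      (solOp_landauBasis hb i)
    intro h'
    exact h ((landauLevel_strictMono hb).injective (inv_injective h').symm)

theorem inner_landauProj (hb : 0 < b) (q : ℕ) (i : ℕ × ℕ) (v : L2Plane) :
    inner ℂ (landauBasis b hb i) (landauProj b q v) =
      if i.1 = q then inner ℂ (landauBasis b hb i) v else 0 := by
  rw [landauProj, ← Submodule.inner_starProjection_left_eq_right, ← landauProj,
    landauProj_landauBasis]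
  split_ifs with h
  · rfl
  · exact inner_zero_left _

theorem norm_landauProj_le (q : ℕ) (v : L2Plane) : ‖landauProj b q v‖ ≤ ‖v‖ :=
  Submodule.norm_starProjection_apply_le _ v

theorem exists_quadForm_resolventDiff_level_le (hb : 0 < b) (hm : IsMetricBump m)
    (hσ : IsAdmissibleSign b σ m) (q : ℕ) :
    ∃ C, 1 ≤ C ∧ ∀ k v, (∀ i : ℕ × ℕ, ¬(i.1 = q ∧ k ≤ i.2) →
      inner ℂ (landauBasis b hb i) v = 0) →
      quadForm (resolventDiff b σ m) v ≤ C ^ (k + 1) / k.factorial * ‖v‖ ^ 2 := by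
  classical
  obtain ⟨C1, h1, hC1⟩ := exists_quadForm_resolventDiff_bounds hb hm hσ
  obtain ⟨C2, h2, hC2⟩ := exists_metricForm_combination_le hb hm q
  set Λ := landauLevel b q with hΛ
  have hΛ0 : 0 < Λ := landauLevel_pos hb q
  set A := max 1 (C1 * (Λ⁻¹) ^ 2) with hA
  have hA1 : 1 ≤ A := le_max_left _ _
  refine ⟨A * C2, one_le_mul_of_one_le_of_one_le hA1 h2, fun k v hv => ?_⟩
  refine quadForm_le_of_finset_sum (landauBasis b hb) _ {i | i.1 = q ∧ k ≤ i.2}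
    (fun s c hs => ?_) hv
  rw [sum_landauBasis_eq hb]
  refine (hC1 _).2.trans ?_
  have hinj : Set.InjOn Prod.snd (s : Set (ℕ × ℕ)) := fun x hx y hy hxy =>
    Prod.ext ((hs x hx).1.trans (hs y hy).1.symm) hxy
  have e1 : ∑ i ∈ s, (c i * (landauLevel b i.1 : ℂ)⁻¹) • landauFun b hb i =
      ∑ j ∈ s.image Prod.snd, (c (q, j) * (Λ : ℂ)⁻¹) • landauFun b hb (q, j) := by
    rw [Finset.sum_image hinj]
    refine Finset.sum_congr rfl fun i hi => ?_
    have : i = (q, i.2) := Prod.ext (hs i hi).1 rfl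
    rw [← this, (hs i hi).1]
  have e2 : ∑ j ∈ s.image Prod.snd, ‖c (q, j) * (Λ : ℂ)⁻¹‖ ^ 2 =
      (Λ⁻¹) ^ 2 * ∑ i ∈ s, ‖c i‖ ^ 2 := by
    rw [Finset.sum_image hinj, Finset.mul_sum]
    refine Finset.sum_congr rfl fun i hi => ?_
    have : i = (q, i.2) := Prod.ext (hs i hi).1 rfl
    rw [← this, norm_mul, mul_pow, norm_inv, Complex.norm_real, Real.norm_of_nonneg hΛ0.le,
      mul_comm]
  have e3 := hC2 k (s.image Prod.snd) (fun j => c (q, j) * (Λ : ℂ)⁻¹) (fun j hj => by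
    obtain ⟨i, hi, rfl⟩ := Finset.mem_image.1 hj
    exact (hs i hi).2)
  rw [e1]
  refine (mul_le_mul_of_nonneg_left e3 (by linarith)).trans ?_
  rw [e2]
  have e4 : C1 * (C2 ^ (k + 1) / k.factorial * (Λ⁻¹ ^ 2 * ∑ i ∈ s, ‖c i‖ ^ 2)) =
      (C1 * Λ⁻¹ ^ 2) * C2 ^ (k + 1) / k.factorial * ∑ i ∈ s, ‖c i‖ ^ 2 := by ring
  rw [e4]
  have e5 : C1 * Λ⁻¹ ^ 2 * C2 ^ (k + 1) ≤ (A * C2) ^ (k + 1) :=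
    (mul_le_mul_of_nonneg_right (le_max_right _ _) (by positivity)).trans
      (mul_pow_succ_le hA1 (by linarith) k)
  have e6 : 0 ≤ ∑ i ∈ s, ‖c i‖ ^ 2 := Finset.sum_nonneg fun _ _ => by positivity
  gcongr

theorem quadForm_solOp_landau_le (hb : 0 < b) {N : ℕ} {v : L2Plane}
    (hv : ∀ i : ℕ × ℕ, i.1 < N → inner ℂ (landauBasis b hb i) v = 0) :
    quadForm (solOp (landauOp b)) v ≤ (landauLevel b N)⁻¹ * ‖v‖ ^ 2 := by
  refine quadForm_le_of_finset_sum (landauBasis b hb) _ {i | N ≤ i.1} (fun s c hs => ?_)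
    fun i hi => hv i (not_le.1 hi)
  have e1 : solOp (landauOp b) (∑ i ∈ s, c i • landauBasis b hb i) =
      ∑ i ∈ s, ((((landauLevel b i.1)⁻¹ : ℝ) : ℂ) * c i) • landauBasis b hb i := by
    rw [map_sum]
    refine Finset.sum_congr rfl fun i _ => ?_
    rw [map_smul, solOp_landauBasis, smul_smul, mul_comm]
  rw [quadForm, e1, (landauBasis b hb).orthonormal.inner_sum, Complex.re_sum, Finset.mul_sum]
  refine Finset.sum_le_sum fun i hi => ?_
  rw [map_mul, Complex.conj_ofReal, mul_assoc, Complex.re_ofReal_mul,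
    ← Complex.normSq_eq_conj_mul_self, Complex.ofReal_re, Complex.normSq_eq_norm_sq]
  refine mul_le_mul_of_nonneg_right ?_ (by positivity)
  exact inv_anti₀ (landauLevel_pos hb N) ((landauLevel_strictMono hb).monotone (hs i hi))

/-- At `u = H₀ f` the form of the perturbation is at most a multiple of `landauForm b f`, which is
the form of `H₀⁻¹` at `u`. This controls all high Landau levels at once. -/
theorem exists_quadForm_resolventDiff_le (hb : 0 < b) (hm : IsMetricBump m)
    (hσ : IsAdmissibleSign b σ m) :
    ∃ C, 0 < C ∧ ∀ u, quadForm (resolventDiff b σ m) u ≤ C * quadForm (solOp (landauOp b)) u := by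
  obtain ⟨C1, h1, hC1⟩ := exists_quadForm_resolventDiff_bounds hb hm hσ
  obtain ⟨M, hM1, hM⟩ := hm.exists_norm_le
  refine ⟨C1 * M, by positivity, fun u => ?_⟩
  refine (isElliptic_landauOp hb).dense.induction_on (p := fun u =>
    quadForm (resolventDiff b σ m) u ≤ C1 * M * quadForm (solOp (landauOp b)) u) u ?_ fun f => ?_
  · exact isClosed_le (continuous_quadForm _) (continuous_const.mul (continuous_quadForm _))
  · rw [quadForm_landau hb, mul_assoc]
    exact (hC1 f).2.trans (mul_le_mul_of_nonneg_left (metricForm_le b hm.growth hM f)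
      (by linarith))

/-- Levels beyond `N` are small because the form is dominated by that of `H₀⁻¹`; on each of the
remaining `N` levels the factorial bound makes all but finitely many states negligible. -/
theorem formSmall_resolventDiff (hb : 0 < b) (hm : IsMetricBump m)
    (hσ : IsAdmissibleSign b σ m) : FormSmall (resolventDiff b σ m) := by
  intro δ hδ
  have hK := isPositive_resolventDiff hb hm hσ
  obtain ⟨C, hC0, hC⟩ := exists_quadForm_resolventDiff_le hb hm hσ
  choose D hD1 hD using fun q => exists_quadForm_resolventDiff_level_le hb hm hσ q
  obtain ⟨N, hN⟩ : ∃ N : ℕ, C * (landauLevel b N)⁻¹ ≤ δ / 4 := by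
    obtain ⟨N, hN⟩ := exists_nat_gt (4 * C / (δ * b))
    refine ⟨N, ?_⟩
    have h1 : 4 * C < N * (δ * b) := (div_lt_iff₀ (by positivity)).1 hN
    rw [← div_eq_mul_inv, div_le_iff₀ (landauLevel_pos hb N), landauLevel]
    nlinarith [mul_pos hδ hb, mul_nonneg (mul_pos hδ hb).le (Nat.cast_nonneg (α := ℝ) N)]
  -- The square compensates two factors `N`: the one lost in `quadForm_sum_le` and the number of
  -- levels summed.
  obtain ⟨M, hM⟩ : ∃ M : ℕ, ∀ q ∈ Finset.range N,
      D q ^ (M + 1) / M.factorial < δ / (4 * (N + 1) ^ 2) := by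
    have : ∀ᶠ M : ℕ in Filter.atTop, ∀ q ∈ Finset.range N,
        D q ^ (M + 1) / M.factorial < δ / (4 * (N + 1) ^ 2) := by
      rw [Filter.eventually_all_finset]
      intro q _
      have h1 := (FloorSemiring.tendsto_pow_div_factorial_atTop (D q)).const_mul (D q)
      rw [mul_zero] at h1
      filter_upwards [h1.eventually (gt_mem_nhds (show 0 < δ / (4 * ((N : ℝ) + 1) ^ 2) by
        positivity))] with M hM
      rwa [pow_succ', mul_div_assoc]
    exact this.exists
  set G : Finset (ℕ × ℕ) := Finset.range N ×ˢ Finset.range M with hG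
  refine ⟨Submodule.span ℂ (landauBasis b hb '' (G : Set (ℕ × ℕ))),
    FiniteDimensional.span_of_finite ℂ (G.finite_toSet.image _), fun u hu => ?_⟩
  have hu' : ∀ i : ℕ × ℕ, i.1 < N → i.2 < M → inner ℂ (landauBasis b hb i) u = 0 := by
    intro i h1 h2
    have hmem : landauBasis b hb i ∈
        Submodule.span ℂ (landauBasis b hb '' (G : Set (ℕ × ℕ))) :=
      Submodule.subset_span ⟨i, by simp [hG, h1, h2], rfl⟩
    exact Submodule.inner_right_of_mem_orthogonal hmem hu
  set y := ∑ q ∈ Finset.range N, landauProj b q u with hy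
  have hiy : ∀ i : ℕ × ℕ, inner ℂ (landauBasis b hb i) y =
      if i.1 < N then inner ℂ (landauBasis b hb i) u else 0 := by
    intro i
    rw [hy, inner_sum]
    simp only [inner_landauProj]
    simp
  have hyn : ‖u - y‖ ≤ ‖u‖ := by
    have h0 : inner ℂ y (u - y) = 0 := by
      rw [hy, sum_inner]
      refine Finset.sum_eq_zero fun q hq => ?_
      have h3 : landauProj b q (u - y) = 0 := by
        rw [← (landauBasis b hb).repr.map_eq_zero_iff]
        ext i
        rw [(landauBasis b hb).repr_apply_apply, inner_landauProj, inner_sub_right, hiy]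
        split_ifs with h4 h5
        · simp
        · exact absurd (Finset.mem_range.1 hq) (h4 ▸ h5)
        · rfl
      rw [landauProj, Submodule.inner_starProjection_left_eq_right, ← landauProj, h3,
        inner_zero_right]
    have h1 : ‖y + (u - y)‖ * ‖y + (u - y)‖ = ‖y‖ * ‖y‖ + ‖u - y‖ * ‖u - y‖ :=
      norm_add_sq_eq_norm_sq_add_norm_sq_of_inner_eq_zero y (u - y) h0
    rw [add_sub_cancel] at h1
    nlinarith [norm_nonneg u, norm_nonneg (u - y), mul_self_nonneg ‖y‖]
  have hhigh : quadForm (resolventDiff b σ m) (u - y) ≤ δ / 4 * ‖u‖ ^ 2 := by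
    have h1 := quadForm_solOp_landau_le hb (N := N) (v := u - y) fun i hi => by
      rw [inner_sub_right, hiy, if_pos hi, sub_self]
    have h2 := (hC (u - y)).trans (mul_le_mul_of_nonneg_left h1 hC0.le)
    have h3 : ‖u - y‖ ^ 2 ≤ ‖u‖ ^ 2 := pow_le_pow_left₀ (norm_nonneg _) hyn 2
    have h4 := mul_le_mul_of_nonneg_right hN (sq_nonneg ‖u - y‖)
    have h5 := mul_le_mul_of_nonneg_left h3 (show 0 ≤ δ / 4 by positivity)
    linarith
  have hlow : quadForm (resolventDiff b σ m) y ≤ δ / 4 * ‖u‖ ^ 2 := by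
    refine (quadForm_sum_le hK (Finset.range N) fun q => landauProj b q u).trans ?_
    have h1 : ∀ q ∈ Finset.range N, quadForm (resolventDiff b σ m) (landauProj b q u) ≤
        δ / (4 * (N + 1) ^ 2) * ‖u‖ ^ 2 := fun q hq => by
      have h2 := hD q M (landauProj b q u) fun i hi => by
        rw [inner_landauProj]
        split_ifs with h3
        · refine hu' i (h3 ▸ Finset.mem_range.1 hq) ?_
          by_contra! h4
          exact hi ⟨h3, h4⟩
        · rfl
      refine h2.trans (mul_le_mul (hM q hq).le ?_ (by positivity) (by positivity))
      exact pow_le_pow_left₀ (norm_nonneg _) (norm_landauProj_le q u) 2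
    refine (mul_le_mul_of_nonneg_left (Finset.sum_le_sum h1) (Nat.cast_nonneg _)).trans ?_
    rw [Finset.sum_const, Finset.card_range, nsmul_eq_mul]
    have h2 : (N : ℝ) * (N * (δ / (4 * (N + 1) ^ 2) * ‖u‖ ^ 2)) =
        (N : ℝ) ^ 2 / (N + 1) ^ 2 * (δ / 4 * ‖u‖ ^ 2) := by
      field_simp
    rw [h2]
    refine mul_le_of_le_one_left (by positivity) ?_
    rw [div_le_one (by positivity)]
    have : (0 : ℝ) ≤ N := Nat.cast_nonneg N
    nlinarith
  have := quadForm_add_le hK y (u - y)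
  rw [add_sub_cancel] at this
  linarith

end LandauForms

/-! ### A disc where the perturbation is positive definite, and radial moments. -/

section ToeplitzLower

variable {b : ℝ} {m : Plane → Matrix (Fin 2) (Fin 2) ℂ}

theorem metricDensity_eq_inner (b : ℝ) (m : Plane → Matrix (Fin 2) (Fin 2) ℂ) (f : PlaneSchwartz)
    (x : Plane) :
    metricDensity b m f x = (inner ℂ (WithLp.toLp 2 fun j => momOp b j f x : EuclideanSpace ℂ (Fin 2))
      (Matrix.toEuclideanCLM (n := Fin 2) (𝕜 := ℂ) (m x)
        (WithLp.toLp 2 fun j => momOp b j f x))).re := by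
  rw [metricDensity, EuclideanSpace.inner_eq_star_dotProduct, dotProduct_comm]
  rfl

theorem exists_re_inner_ge_of_posDef {A : Matrix (Fin 2) (Fin 2) ℂ} (hA : A.PosDef) :
    ∃ c > 0, ∀ v : EuclideanSpace ℂ (Fin 2),
      c * ‖v‖ ^ 2 ≤ (inner ℂ v (Matrix.toEuclideanCLM (n := Fin 2) (𝕜 := ℂ) A v)).re := by
  set L := Matrix.toEuclideanCLM (n := Fin 2) (𝕜 := ℂ) A
  have hpos : ∀ v : EuclideanSpace ℂ (Fin 2), v ≠ 0 → 0 < (inner ℂ v (L v)).re := fun v hv => by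
    have h1 := hA.re_dotProduct_pos (x := v.ofLp) (by simpa using hv)
    rw [EuclideanSpace.inner_eq_star_dotProduct, dotProduct_comm]
    exact h1
  have hne : (Metric.sphere (0 : EuclideanSpace ℂ (Fin 2)) 1).Nonempty :=
    ⟨EuclideanSpace.single 0 1, by simp⟩
  obtain ⟨v0, hv0, hmin⟩ := (isCompact_sphere (0 : EuclideanSpace ℂ (Fin 2)) 1).exists_isMinOn hne
    (f := fun v => (inner ℂ v (L v)).re)
    (Complex.continuous_re.comp (continuous_id.inner L.continuous)).continuousOn
  have hv0' : v0 ≠ 0 := by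
    rintro rfl
    simp at hv0
  refine ⟨_, hpos v0 hv0', fun v => ?_⟩
  by_cases hv : v = 0
  · simp [hv]
  have hn : ‖v‖ ≠ 0 := norm_ne_zero_iff.2 hv
  have h1 := isMinOn_iff.1 hmin (((‖v‖⁻¹ : ℝ) : ℂ) • v) (by
    simp [norm_smul, hn])
  simp only [map_smul, inner_smul_left, inner_smul_right, Complex.conj_ofReal,
    Complex.re_ofReal_mul] at h1
  have h2 := mul_le_mul_of_nonneg_right h1 (sq_nonneg ‖v‖)
  have h3 : ‖v‖⁻¹ * (‖v‖⁻¹ * (inner ℂ v (L v)).re) * ‖v‖ ^ 2 = (inner ℂ v (L v)).re := by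
    field_simp
  linarith

/-- Where the smaller eigenvalue is non-zero the matrix is positive definite, and by continuity half
of its lower bound persists on a ball. -/
theorem exists_ball_metricDensity_ge (hm : IsMetricBump m)
    (hx : ∃ x, smallerEigenvalue (hm.nonneg x).isHermitian ≠ 0) :
    ∃ x0 : Plane, ∃ ρ > 0, ∃ c > 0, ∀ b f x, ‖x - x0‖ < ρ →
      c * ∑ j, ‖momOp b j f x‖ ^ 2 ≤ metricDensity b m f x := by
  obtain ⟨x0, hx0⟩ := hx
  have hpd : (m x0).PosDef := by
    rw [(hm.nonneg x0).isHermitian.posDef_iff_eigenvalues_pos]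
    have h0 := (hm.nonneg x0).eigenvalues_nonneg 0
    have h1 := (hm.nonneg x0).eigenvalues_nonneg 1
    have h2 : 0 < smallerEigenvalue (hm.nonneg x0).isHermitian :=
      lt_of_le_of_ne (le_min h0 h1) (Ne.symm hx0)
    rw [smallerEigenvalue, lt_min_iff] at h2
    intro i
    fin_cases i
    · exact h2.1
    · exact h2.2
  obtain ⟨c, hc, hcv⟩ := exists_re_inner_ge_of_posDef hpd
  have h1 : Continuous m := continuous_matrix fun j k => (hm.smooth j k).continuous
  have h2 : Continuous (fun x => Matrix.toEuclideanCLM (n := Fin 2) (𝕜 := ℂ) (m x)) :=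
    (LinearMap.continuous_of_finiteDimensional
      (Matrix.toEuclideanCLM (n := Fin 2) (𝕜 := ℂ)).toAlgEquiv.toLinearMap).comp h1
  obtain ⟨ρ, hρ, h3⟩ := Metric.continuousAt_iff.1 h2.continuousAt (c / 2) (by positivity)
  refine ⟨x0, ρ, hρ, c / 2, by positivity, fun b f x hx => ?_⟩
  have h4 := h3 (x := x) (by rwa [dist_eq_norm])
  rw [dist_eq_norm] at h4
  rw [metricDensity_eq_inner]
  set v : EuclideanSpace ℂ (Fin 2) := WithLp.toLp 2 fun j => momOp b j f x with hv
  have h5 : ∑ j, ‖momOp b j f x‖ ^ 2 = ‖v‖ ^ 2 := by rw [EuclideanSpace.norm_sq_eq]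
  rw [h5]
  have h6 := hcv v
  have h7 := (Complex.abs_re_le_norm _).trans (norm_inner_le_norm (𝕜 := ℂ) v
    ((Matrix.toEuclideanCLM (n := Fin 2) (𝕜 := ℂ) (m x) -
      Matrix.toEuclideanCLM (n := Fin 2) (𝕜 := ℂ) (m x0)) v))
  have h8 := ContinuousLinearMap.le_opNorm (Matrix.toEuclideanCLM (n := Fin 2) (𝕜 := ℂ) (m x) -
      Matrix.toEuclideanCLM (n := Fin 2) (𝕜 := ℂ) (m x0)) v
  have h9 := mul_le_mul_of_nonneg_left (h8.trans (mul_le_mul_of_nonneg_right h4.le (norm_nonneg v)))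
    (norm_nonneg v)
  have h10 := (abs_le.1 (h7.trans h9)).1
  rw [sub_apply, inner_sub_right, Complex.sub_re] at h10
  nlinarith

/-- A smooth radial function equal to `1` where `|x|² ≤ s` and to `0` where `|x|² ≥ 2 s`. -/
noncomputable def radialBump (s : ℝ) (x : Plane) : ℝ := Real.smoothTransition (2 - ‖x‖ ^ 2 / s)

theorem contDiff_radialBump (s : ℝ) : ContDiff ℝ ∞ (radialBump s) :=
  Real.smoothTransition.contDiff.comp (contDiff_const.sub ((contDiff_norm_sq ℝ).div_const s))

theorem radialBump_eq_one {s : ℝ} (hs : 0 < s) {x : Plane} (hx : ‖x‖ ^ 2 ≤ s) :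
    radialBump s x = 1 := by
  refine Real.smoothTransition.one_of_one_le ?_
  have : ‖x‖ ^ 2 / s ≤ 1 := (div_le_one hs).2 hx
  linarith

theorem radialBump_eq_zero {s : ℝ} (hs : 0 < s) {x : Plane} (hx : 2 * s ≤ ‖x‖ ^ 2) :
    radialBump s x = 0 := by
  refine Real.smoothTransition.zero_of_nonpos ?_
  have : 2 ≤ ‖x‖ ^ 2 / s := (le_div_iff₀ hs).2 hx
  linarith

theorem radialBump_nonneg (s : ℝ) (x : Plane) : 0 ≤ radialBump s x :=
  Real.smoothTransition.nonneg _

theorem radialBump_le_one (s : ℝ) (x : Plane) : radialBump s x ≤ 1 :=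
  Real.smoothTransition.le_one _

theorem hasCompactSupport_radialBump {s : ℝ} (hs : 0 < s) : HasCompactSupport (radialBump s) := by
  refine HasCompactSupport.intro (isCompact_closedBall (0 : Plane) (Real.sqrt (2 * s))) fun x hx => ?_
  refine radialBump_eq_zero hs ?_
  rw [mem_closedBall_zero_iff, not_le] at hx
  exact ((Real.sqrt_lt' ((Real.sqrt_nonneg _).trans_lt hx)).1 hx).le

theorem hasCompactSupport_radialBump_sub {s : ℝ} (hs : 0 < s) (x0 : Plane) :
    HasCompactSupport fun x => radialBump s (x - x0) :=
  (hasCompactSupport_radialBump hs).comp_homeomorph (Homeomorph.subRight x0)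

/-- The rotation of the plane by an element of the circle. -/
noncomputable def planeRotation (a : Circle) : Plane ≃ₗᵢ[ℝ] Plane :=
  (Complex.orthonormalBasisOneI.repr.symm.trans (rotation a)).trans Complex.orthonormalBasisOneI.repr

theorem coordZ_eq_repr (x : Plane) : coordZ x = Complex.orthonormalBasisOneI.repr.symm x := by
  rw [← Complex.orthonormalBasisOneI.sum_repr_symm x]
  simp [coordZ, mul_comm]

theorem coordZ_planeRotation (a : Circle) (x : Plane) :
    coordZ (planeRotation a x) = a * coordZ x := by
  rw [coordZ_eq_repr, coordZ_eq_repr, planeRotation]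
  simp

/-- Rotation by the angle `π/(j - i)` preserves the measure and multiplies the integrand by `-1`. -/
theorem integral_radial_eq_zero {i j : ℕ} (hij : i ≠ j) (s : ℝ) :
    ∫ x : Plane, (starRingEnd ℂ (coordZ x)) ^ i * coordZ x ^ j * (radialBump s x : ℂ) = 0 := by
  set I := ∫ x : Plane, (starRingEnd ℂ (coordZ x)) ^ i * coordZ x ^ j * (radialBump s x : ℂ)
  have hd : ((j : ℝ) - i) ≠ 0 := sub_ne_zero.2 (by exact_mod_cast hij.symm)
  set a : Circle := Circle.exp (Real.pi / ((j : ℝ) - i)) with ha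
  have h1 : (starRingEnd ℂ (a : ℂ)) ^ i * (a : ℂ) ^ j = -1 := by
    rw [ha, Circle.coe_exp, ← Complex.exp_conj, ← Complex.exp_nat_mul, ← Complex.exp_nat_mul,
      ← Complex.exp_add, ← Complex.exp_pi_mul_I]
    congr 1
    rw [map_mul, Complex.conj_ofReal, Complex.conj_I]
    have hd' : ((j : ℂ) - i) ≠ 0 := by exact_mod_cast hd
    push_cast
    field_simp
    ring
  have h2 : I = -I := by
    calc I = ∫ x : Plane, (starRingEnd ℂ (coordZ (planeRotation a x))) ^ i *
          coordZ (planeRotation a x) ^ j * (radialBump s (planeRotation a x) : ℂ) :=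
        ((planeRotation a).measurePreserving.integral_comp
          (planeRotation a).toHomeomorph.measurableEmbedding _).symm
      _ = ∫ x : Plane, (-1 : ℂ) *
          ((starRingEnd ℂ (coordZ x)) ^ i * coordZ x ^ j * (radialBump s x : ℂ)) := by
        congr 1
        ext x
        rw [coordZ_planeRotation, ← h1, radialBump, radialBump, LinearIsometryEquiv.norm_map,
          map_mul]
        ring
      _ = -I := by rw [integral_const_mul, neg_one_mul]
  exact self_eq_neg.1 h2

/-- The moments of the radial bump function. -/
noncomputable def radialMoment (s : ℝ) (j : ℕ) : ℝ := ∫ x : Plane, ‖x‖ ^ (2 * j) * radialBump s x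

/-- On the annulus `s/4 < ‖x‖² < s` the bump is `1` and the power is at least `(s/4)^j`. -/
theorem exists_radialMoment_ge {s : ℝ} (hs : 0 < s) :
    ∃ C, 1 ≤ C ∧ ∀ j, (C ^ (j + 1))⁻¹ ≤ radialMoment s j := by
  set U : Set Plane := {x | s / 4 < ‖x‖ ^ 2} ∩ {x | ‖x‖ ^ 2 < s} with hU
  have hUo : IsOpen U := (isOpen_lt continuous_const (by fun_prop)).inter
    (isOpen_lt (by fun_prop) continuous_const)
  have hUne : U.Nonempty := by
    refine ⟨EuclideanSpace.single 0 (Real.sqrt (s / 2)), ?_⟩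
    have : ‖(EuclideanSpace.single 0 (Real.sqrt (s / 2)) : Plane)‖ ^ 2 = s / 2 := by
      rw [PiLp.norm_single, Real.norm_of_nonneg (Real.sqrt_nonneg _),
        Real.sq_sqrt (by positivity)]
    constructor
    · change s / 4 < _
      rw [this]; linarith
    · change _ < s
      rw [this]; linarith
  have hUb : U ⊆ Metric.closedBall 0 (Real.sqrt s) := fun x hx => by
    rw [mem_closedBall_zero_iff]
    exact Real.le_sqrt_of_sq_le (le_of_lt hx.2)
  have hUf : volume U ≠ ⊤ := ((measure_mono hUb).trans_lt measure_closedBall_lt_top).ne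
  set V := (volume : Measure Plane).real U with hV
  have hV0 : 0 < V := ENNReal.toReal_pos (hUo.measure_pos volume hUne).ne' hUf
  set A := max 1 V⁻¹
  set B := max 1 (4 / s)
  have hA : 1 ≤ A := le_max_left _ _
  have hB : 1 ≤ B := le_max_left _ _
  refine ⟨A * B, one_le_mul_of_one_le_of_one_le hA hB, fun j => ?_⟩
  have h1 : (s / 4) ^ j * V ≤ radialMoment s j := by
    have e1 : (s / 4) ^ j * V = ∫ x, U.indicator (fun _ => (s / 4) ^ j) x := by
      rw [integral_indicator hUo.measurableSet, setIntegral_const, smul_eq_mul, mul_comm]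
    rw [e1]
    refine integral_mono ?_ ?_ fun x => ?_
    · exact (integrable_indicator_iff hUo.measurableSet).2 (integrableOn_const hUf)
    · refine Continuous.integrable_of_hasCompactSupport ?_ ?_
      · have := (contDiff_radialBump s).continuous
        fun_prop
      · exact (hasCompactSupport_radialBump hs).mul_left
    · by_cases hx : x ∈ U
      · rw [indicator_of_mem hx, radialBump_eq_one hs (le_of_lt hx.2), mul_one, pow_mul]
        exact pow_le_pow_left₀ (by positivity) (le_of_lt hx.1) j
      · rw [indicator_of_notMem hx]
        exact mul_nonneg (by positivity) (radialBump_nonneg s x)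
  refine le_trans ?_ h1
  have h2 : ((A * B) ^ (j + 1))⁻¹ ≤ (A * B ^ j)⁻¹ := by
    refine inv_anti₀ (by positivity) ?_
    rw [mul_pow]
    exact mul_le_mul (le_self_pow₀ hA (Nat.succ_ne_zero j))
      (pow_le_pow_right₀ hB (Nat.le_succ j)) (by positivity) (by positivity)
  refine h2.trans ?_
  rw [mul_inv, mul_comm]
  refine mul_le_mul ?_ ?_ (by positivity) (by positivity)
  · rw [← inv_pow]
    refine pow_le_pow_left₀ (by positivity) ?_ j
    rw [inv_le_comm₀ (by positivity) (by positivity), inv_div]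
    exact le_max_right _ _
  · rw [inv_le_comm₀ (by positivity) hV0]
    exact le_max_right _ _

theorem integral_radial_sub (s : ℝ) (x0 : Plane) (i j : ℕ) :
    ∫ x : Plane, (starRingEnd ℂ (coordZ x - coordZ x0)) ^ i * (coordZ x - coordZ x0) ^ j *
      (radialBump s (x - x0) : ℂ) = if i = j then (radialMoment s j : ℂ) else 0 := by
  have h1 : ∀ x, coordZ x - coordZ x0 = coordZ (x - x0) := fun x => by
    rw [← coordZL_apply, ← coordZL_apply, ← coordZL_apply, map_sub]
  simp only [h1]
  rw [integral_sub_right_eq_self (fun x => (starRingEnd ℂ (coordZ x)) ^ i * coordZ x ^ j *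
      (radialBump s x : ℂ)) x0]
  split_ifs with h
  · subst h
    rw [radialMoment, ← integral_complex_ofReal]
    congr 1
    ext x
    rw [← mul_pow, ← Complex.normSq_eq_conj_mul_self, Complex.normSq_eq_norm_sq, norm_coordZ]
    push_cast
    ring
  · exact integral_radial_eq_zero h s

end ToeplitzLower

/-! ### Factorial lower bound for the perturbation on one Landau level. -/

section ToeplitzLower

variable {b : ℝ} {m : Plane → Matrix (Fin 2) (Fin 2) ℂ}

/-- Multiplication by `z - w`. -/
noncomputable def zShift (w : ℂ) : PlaneSchwartz →L[ℂ] PlaneSchwartz := zOp - w • 1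

theorem zShift_apply' (w : ℂ) (f : PlaneSchwartz) : zShift w f = zOp f - w • f := rfl

theorem zShift_apply (w : ℂ) (f : PlaneSchwartz) (x : Plane) :
    zShift w f x = (coordZ x - w) * f x := by
  rw [zShift_apply', sub_apply, smul_apply, zOp_apply, smul_eq_mul, sub_mul]

theorem creOp_zShift (b : ℝ) (w : ℂ) (f : PlaneSchwartz) :
    creOp b (zShift w f) = zShift w (creOp b f) - (2 * Complex.I : ℂ) • f := by
  rw [zShift_apply', zShift_apply', map_sub, map_smul, creOp_zOp]
  abel

theorem annOp_zShift_pow (b : ℝ) (w : ℂ) (k : ℕ) (f : PlaneSchwartz) :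
    annOp b ((zShift w ^ k) f) = (zShift w ^ k) (annOp b f) := by
  induction k with
  | zero => simp
  | succ k ih =>
    rw [pow_succ', mul_apply_eq_comp, mul_apply_eq_comp, zShift_apply', map_sub, map_smul,
      annOp_zOp, ih, zShift_apply']

theorem annOp_zShift_pow_groundState (hb : 0 < b) (w : ℂ) (k : ℕ) :
    annOp b ((zShift w ^ k) (groundState b hb)) = 0 := by
  rw [annOp_zShift_pow, annOp_groundState, map_zero]

/-- Unlike in `ladder_inner`, only `f` has to be annihilated, so `g` may be a compactly supported
test function. -/
theorem ladder_inner_left {A C : PlaneSchwartz →L[ℂ] PlaneSchwartz} {κ : ℝ}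
    (hadj : ∀ f g, inner ℂ (toL2 (A f)) (toL2 g) = inner ℂ (toL2 f) (toL2 (C g)))
    (hc : ∀ f, A (C f) = C (A f) + (κ : ℂ) • f) {f : PlaneSchwartz} (hf : A f = 0)
    (g : PlaneSchwartz) (n : ℕ) :
    inner ℂ (toL2 ((C ^ n) f)) (toL2 ((C ^ n) g)) =
      (κ ^ n * n.factorial : ℂ) * inner ℂ (toL2 f) (toL2 g) := by
  induction n with
  | zero => simp
  | succ n ih =>
    rw [pow_succ' C n, mul_apply_eq_comp C (C ^ n) g, ← hadj, ← pow_succ' C n,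
      ladder_lower hc hf, map_smul, inner_smul_left, ih, Nat.factorial_succ]
    simp only [map_mul, map_add, Complex.conj_ofReal, map_natCast, map_one]
    push_cast; ring

theorem zOp_pow_groundState_eq_sum (hb : 0 < b) (w : ℂ) (j : ℕ) :
    (zOp ^ j) (groundState b hb) = ∑ i ∈ Finset.range (j + 1),
      (w ^ (j - i) * j.choose i : ℂ) • (zShift w ^ i) (groundState b hb) := by
  ext x
  rw [pow_apply_of_mul zOp_apply, sum_apply]
  simp only [smul_apply, pow_apply_of_mul (zShift_apply w), smul_eq_mul]
  conv_lhs => rw [← sub_add_cancel (coordZ x) w, add_pow, Finset.sum_mul]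
  refine Finset.sum_congr rfl fun i _ => ?_
  ring

theorem zShift_pow_groundState_eq_sum (hb : 0 < b) (w : ℂ) (j : ℕ) :
    (zShift w ^ j) (groundState b hb) = ∑ i ∈ Finset.range (j + 1),
      ((-w) ^ (j - i) * j.choose i : ℂ) • (zOp ^ i) (groundState b hb) := by
  ext x
  rw [pow_apply_of_mul (zShift_apply w), sum_apply]
  simp only [smul_apply, pow_apply_of_mul zOp_apply, smul_eq_mul]
  rw [sub_eq_add_neg, add_pow, Finset.sum_mul]
  refine Finset.sum_congr rfl fun i _ => ?_
  ring

theorem norm_zOp_pow_groundState_sq (hb : 0 < b) (l : ℕ) :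
    ‖toL2 ((zOp ^ l) (groundState b hb))‖ ^ 2 =
      (2 / b) ^ l * l.factorial * ‖toL2 (groundState b hb)‖ ^ 2 := by
  have h := norm_landauState_sq hb 0 l
  rw [landauState, pow_zero, one_apply_eq_self, guideCreOp_pow_groundState, map_smul, norm_smul,
    mul_pow, norm_pow, norm_mul, Complex.norm_I, one_mul, Complex.norm_real,
    Real.norm_of_nonneg hb.le] at h
  have h2 : (2 / b) ^ l * (b ^ l) ^ 2 = (2 * b) ^ l := by
    rw [← pow_mul, mul_comm l 2, pow_mul, ← mul_pow]
    congr 1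
    field_simp
  have h3 : (b ^ l) ^ 2 ≠ 0 := by positivity
  apply mul_left_cancel₀ h3
  rw [h, zero_add, ← h2]
  simp only [Nat.factorial_zero, Nat.cast_one]
  ring

theorem exists_norm_zShift_pow_groundState_le (hb : 0 < b) (w : ℂ) :
    ∃ C, 1 ≤ C ∧ ∀ j : ℕ, ‖toL2 ((zShift w ^ j) (groundState b hb))‖ ≤
      C ^ (j + 1) * Real.sqrt j.factorial := by
  set N := ‖toL2 (groundState b hb)‖
  set A := max 1 N
  set B := max 1 (‖w‖ + Real.sqrt (2 / b))
  have hA : 1 ≤ A := le_max_left _ _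
  have hB : 1 ≤ B := le_max_left _ _
  refine ⟨A * B, one_le_mul_of_one_le_of_one_le hA hB, fun j => ?_⟩
  have h1 : ∀ i, ‖toL2 ((zOp ^ i) (groundState b hb))‖ =
      Real.sqrt (2 / b) ^ i * Real.sqrt i.factorial * N := fun i => by
    refine (sq_eq_sq₀ (norm_nonneg _) (by positivity)).1 ?_
    rw [norm_zOp_pow_groundState_sq, mul_pow, mul_pow, Real.sq_sqrt (by positivity), ← pow_mul,
      mul_comm i, pow_mul, Real.sq_sqrt (by positivity)]
  have h2 : ‖toL2 ((zShift w ^ j) (groundState b hb))‖ ≤ ∑ i ∈ Finset.range (j + 1),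
      Real.sqrt (2 / b) ^ i * ‖w‖ ^ (j - i) * j.choose i * (Real.sqrt j.factorial * N) := by
    rw [zShift_pow_groundState_eq_sum, map_sum]
    refine (norm_sum_le _ _).trans (Finset.sum_le_sum fun i hi => ?_)
    rw [map_smul, norm_smul, h1, norm_mul, norm_pow, norm_neg, Complex.norm_natCast]
    have h3 : Real.sqrt i.factorial ≤ Real.sqrt j.factorial :=
      Real.sqrt_le_sqrt (by
        exact_mod_cast Nat.factorial_le (Nat.lt_succ_iff.1 (Finset.mem_range.1 hi)))
    calc ‖w‖ ^ (j - i) * (j.choose i : ℝ) * (Real.sqrt (2 / b) ^ i * Real.sqrt i.factorial * N)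
        ≤ ‖w‖ ^ (j - i) * (j.choose i : ℝ) * (Real.sqrt (2 / b) ^ i * Real.sqrt j.factorial * N) := by
          gcongr
      _ = _ := by ring
  rw [← Finset.sum_mul, ← add_pow, add_comm] at h2
  refine h2.trans ?_
  have h4 : (‖w‖ + Real.sqrt (2 / b)) ^ j ≤ B ^ (j + 1) :=
    (pow_le_pow_left₀ (by positivity) (le_max_right _ _) j).trans
      (pow_le_pow_right₀ hB (Nat.le_succ j))
  have h5 : N ≤ A ^ (j + 1) := (le_max_right _ _).trans (le_self_pow₀ hA (Nat.succ_ne_zero j))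
  rw [mul_pow]
  calc (‖w‖ + Real.sqrt (2 / b)) ^ j * (Real.sqrt j.factorial * N)
      ≤ B ^ (j + 1) * (Real.sqrt j.factorial * A ^ (j + 1)) := by gcongr
    _ = _ := by ring

theorem momOp_eventuallyEq_zero {f : PlaneSchwartz} {x : Plane}
    (h : (f : Plane → ℂ) =ᶠ[nhds x] fun _ => 0) (j : Fin 2) :
    (momOp b j f : Plane → ℂ) =ᶠ[nhds x] fun _ => 0 := by
  filter_upwards [h.fderiv (𝕜 := ℝ), h] with y hy hy0
  rw [momOp_apply, magMomentum, hy, hy0]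
  simp

theorem creOp_pow_eventuallyEq_zero {f : PlaneSchwartz} {x : Plane}
    (h : (f : Plane → ℂ) =ᶠ[nhds x] fun _ => 0) (n : ℕ) :
    ((creOp b ^ n) f : Plane → ℂ) =ᶠ[nhds x] fun _ => 0 := by
  induction n with
  | zero => simpa using h
  | succ n ih =>
    rw [pow_succ', mul_apply_eq_comp, creOp_apply]
    filter_upwards [momOp_eventuallyEq_zero (b := b) ih 0, momOp_eventuallyEq_zero (b := b) ih 1]
      with y h0 h1
    rw [sub_apply, smul_apply, h0, h1]
    simp

theorem norm_creOp_apply_sq_le (f : PlaneSchwartz) (x : Plane) :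
    ‖creOp b f x‖ ^ 2 ≤ 2 * ∑ j, ‖momOp b j f x‖ ^ 2 := by
  rw [creOp_apply, sub_apply, smul_apply, Fin.sum_univ_two]
  have h := norm_sub_le (momOp b 0 f x) (Complex.I • momOp b 1 f x)
  rw [norm_smul, Complex.norm_I, one_mul] at h
  have h2 := pow_le_pow_left₀ (norm_nonneg _) h 2
  nlinarith [sq_nonneg (‖momOp b 0 f x‖ - ‖momOp b 1 f x‖)]

theorem norm_toL2_le_of_ball {f : PlaneSchwartz} {x0 : Plane} {r D : ℝ} (hD : 0 ≤ D)
    (h0 : ∀ x, r ≤ ‖x - x0‖ → f x = 0) (h : ∀ x, ‖x - x0‖ < r → ‖f x‖ ≤ D) :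
    ‖toL2 f‖ ≤ D * Real.sqrt ((volume : Measure Plane).real (Metric.ball x0 r)) := by
  refine abs_le_of_sq_le_sq' ?_ (by positivity) |>.2
  rw [norm_toL2_sq, mul_pow, Real.sq_sqrt measureReal_nonneg]
  have h1 : ∀ x, ‖f x‖ ^ 2 ≤ (Metric.ball x0 r).indicator (fun _ => D ^ 2) x := fun x => by
    by_cases hx : x ∈ Metric.ball x0 r
    · rw [indicator_of_mem hx]
      exact pow_le_pow_left₀ (norm_nonneg _) (h x (mem_ball_iff_norm.1 hx)) 2
    · rw [indicator_of_notMem hx, h0 x (by simpa [dist_eq_norm] using hx)]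
      simp
  refine (integral_mono (integrable_norm_sq f)
    ((integrable_indicator_iff Metric.isOpen_ball.measurableSet).2
      (integrableOn_const measure_ball_lt_top.ne)) h1).trans ?_
  rw [integral_indicator Metric.isOpen_ball.measurableSet, setIntegral_const, smul_eq_mul, mul_comm]

/-- On the disc the form controls `creOp b` of its argument, that is `a*^{q+1} h` with `h` the given
combination. Pairing this with `ψ j = a*^{q+1} ((z - z₀)^j g)` and using `a h = 0` reduces to the
pairing of `h` with `(z - z₀)^j g`, which by orthogonality of powers isolates the single coefficient
`α j`. Everything else is geometric in `j`. -/
theorem exists_norm_coeff_le (hb : 0 < b) (hm : IsMetricBump m) {x0 : Plane} {ρ c : ℝ}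
    (hρ : 0 < ρ) (hc : 0 < c) (hd : ∀ f x, ‖x - x0‖ < ρ →
      c * ∑ j, ‖momOp b j f x‖ ^ 2 ≤ metricDensity b m f x) (q : ℕ) :
    ∃ C, 1 ≤ C ∧ ∀ (k : ℕ) (α : ℕ → ℂ), ∀ j < k, ‖α j‖ ≤ C ^ (j + 1) *
      Real.sqrt (metricForm b m ((creOp b ^ q)
        (∑ i ∈ Finset.range k, α i • (zShift (coordZ x0) ^ i) (groundState b hb)))) := by
  -- With this choice `g` lives in `‖x - x0‖² ≤ 2s`, where the cutoff `ζ` is `1`, and `ζ` vanishes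
  -- from `‖x - x0‖² = 4s = ρ²` on.
  set s := ρ ^ 2 / 4 with hs
  have hs0 : 0 < s := by positivity
  set Y := zShift (coordZ x0) with hY
  set e := groundState b hb with he
  -- the test functions
  have hg1 : ContDiff ℝ ∞ fun x : Plane =>
      ((radialBump s (x - x0) * Real.exp (b / 4 * ‖x‖ ^ 2) : ℝ) : ℂ) := by
    refine Complex.ofRealCLM.contDiff.comp (ContDiff.mul ?_ ?_)
    · exact (contDiff_radialBump s).comp (contDiff_id.sub contDiff_const)
    · exact Real.contDiff_exp.comp (contDiff_const.mul (contDiff_norm_sq ℝ))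
  have hg2 : HasCompactSupport fun x : Plane =>
      ((radialBump s (x - x0) * Real.exp (b / 4 * ‖x‖ ^ 2) : ℝ) : ℂ) :=
    ((hasCompactSupport_radialBump_sub hs0 x0).mul_right).comp_left
      (g := fun t : ℝ => (t : ℂ)) rfl
  set g : PlaneSchwartz := hg2.toSchwartzMap hg1 with hg
  have hgx : ∀ x, g x = ((radialBump s (x - x0) * Real.exp (b / 4 * ‖x‖ ^ 2) : ℝ) : ℂ) :=
    fun x => rfl
  -- The exponent is `q + 1`, since the density dominates first magnetic derivatives of `a*^q h`.
  -- The weight `exp(b‖x‖²/4)` in `g` cancels the Gaussian, leaving a purely radial weight.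
  set ψ : ℕ → PlaneSchwartz := fun j => (creOp b ^ (q + 1)) ((Y ^ j) g) with hψ
  have hψ0 : ∀ j x, 2 * s < ‖x - x0‖ ^ 2 → ψ j x = 0 := fun j x hx => by
    refine (creOp_pow_eventuallyEq_zero ?_ (q + 1)).eq_of_nhds
    have hx' : Continuous fun y : Plane => ‖y - x0‖ ^ 2 := by fun_prop
    filter_upwards [continuousAt_const.eventually_lt hx'.continuousAt hx] with y hy
    rw [pow_apply_of_mul (zShift_apply _), hgx, radialBump_eq_zero hs0 (le_of_lt hy)]
    simp
  have hρs : ∀ x, ‖x - x0‖ < ρ ↔ ‖x - x0‖ ^ 2 < 4 * s := fun x => by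
    rw [hs, mul_div_cancel₀ _ (by norm_num : (4 : ℝ) ≠ 0)]
    exact (sq_lt_sq₀ (norm_nonneg _) hρ.le).symm
  obtain ⟨C1, h1, hC1⟩ := exists_norm_creOp_pow_pow_le (b := b) (creOp_zShift b (coordZ x0))
    (zShift_apply (coordZ x0)) (B := {x | ‖x - x0‖ < ρ}) (R := ρ) (fun x hx => by
      rw [← coordZL_apply, ← coordZL_apply, ← map_sub, coordZL_apply, norm_coordZ]
      exact le_of_lt hx) (q + 1) g
  set V := Real.sqrt ((volume : Measure Plane).real (Metric.ball x0 ρ)) with hV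
  have hψn : ∀ j, ‖toL2 (ψ j)‖ ≤ C1 ^ (j + 1) * V := fun j => by
    refine norm_toL2_le_of_ball (by positivity) (fun x hx => hψ0 j x ?_) fun x hx => hC1 j x hx
    have := mt (hρs x).2 (not_lt.2 hx)
    linarith
  -- the cutoff
  have hζ1 : ContDiff ℝ ∞ fun x : Plane => (radialBump (2 * s) (x - x0) : ℂ) :=
    Complex.ofRealCLM.contDiff.comp
      ((contDiff_radialBump (2 * s)).comp (contDiff_id.sub contDiff_const))
  have hζ2 : HasCompactSupport fun x : Plane => (radialBump (2 * s) (x - x0) : ℂ) :=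
    (hasCompactSupport_radialBump_sub (by positivity) x0).comp_left (g := fun t : ℝ => (t : ℂ)) rfl
  set ζ : Plane → ℂ := fun x => (radialBump (2 * s) (x - x0) : ℂ) with hζ
  have hζg : ζ.HasTemperateGrowth := hζ2.hasTemperateGrowth hζ1
  have hζψ : ∀ j, mulOp ζ (ψ j) = ψ j := fun j => by
    ext x
    rw [mulOp_apply hζg]
    by_cases hx : ‖x - x0‖ ^ 2 ≤ 2 * s
    · simp only [hζ]
      rw [radialBump_eq_one (by positivity) hx, Complex.ofReal_one, one_mul]
    · rw [hψ0 j x (not_le.1 hx), mul_zero]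
  have hζn : ∀ f, ‖toL2 (mulOp ζ (creOp b f))‖ ≤ Real.sqrt (2 / c * metricForm b m f) := fun f => by
    refine Real.le_sqrt_of_sq_le ?_
    rw [norm_toL2_sq, metricForm_eq b hm.growth, ← integral_const_mul]
    refine integral_mono (integrable_norm_sq _)
      ((integrable_metricDensity b hm.growth f).const_mul _) fun x => ?_
    simp only [mulOp_apply hζg, norm_mul, mul_pow]
    by_cases hx : ‖x - x0‖ < ρ
    · have e1 := norm_creOp_apply_sq_le (b := b) f x
      have e2 := hd f x hx
      have e3 : ‖ζ x‖ ^ 2 ≤ 1 := by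
        rw [hζ]
        simp only [Complex.norm_real]
        rw [Real.norm_of_nonneg (radialBump_nonneg _ _)]
        exact pow_le_one₀ (radialBump_nonneg _ _) (radialBump_le_one _ _)
      have e4 := mul_le_of_le_one_left (sq_nonneg ‖creOp b f x‖) e3
      refine e4.trans (e1.trans ?_)
      rw [div_mul_eq_mul_div, le_div_iff₀ hc]
      linarith
    · have : ζ x = 0 := by
        have := mt (hρs x).2 hx
        simp only [hζ]
        rw [radialBump_eq_zero (by positivity) (by linarith), Complex.ofReal_zero]
      rw [this]
      have := metricDensity_nonneg b (hm.nonneg x) f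
      simp only [norm_zero, ne_eq, OfNat.ofNat_ne_zero, not_false_eq_true, zero_pow, zero_mul]
      exact mul_nonneg (by positivity) this
  -- the moments
  obtain ⟨C2, h2, hC2⟩ := exists_radialMoment_ge hs0
  have hmom : ∀ i j, inner ℂ (toL2 ((Y ^ i) e)) (toL2 ((Y ^ j) g)) =
      if i = j then (radialMoment s j : ℂ) else 0 := fun i j => by
    rw [inner_toL2, ← integral_radial_sub s x0]
    congr 1
    ext x
    rw [pow_apply_of_mul (zShift_apply _), pow_apply_of_mul (zShift_apply _), hgx,
      RCLike.inner_apply', map_mul, map_pow, he, groundState, gaussSchwartz_apply,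
      Complex.conj_ofReal]
    have : Real.exp (-(b / 4) * ‖x‖ ^ 2) * Real.exp (b / 4 * ‖x‖ ^ 2) = 1 := by
      rw [← Real.exp_add]; simp
    have h' : ((Real.exp (-(b / 4) * ‖x‖ ^ 2) : ℝ) : ℂ) *
        ((Real.exp (b / 4 * ‖x‖ ^ 2) : ℝ) : ℂ) = 1 := by
      rw [← Complex.ofReal_mul, this, Complex.ofReal_one]
    push_cast at h' ⊢
    linear_combination ((starRingEnd ℂ (coordZ x - coordZ x0)) ^ i * (coordZ x - coordZ x0) ^ j *
      (radialBump s (x - x0) : ℂ)) * h'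
  set P := (2 * b) ^ (q + 1) * (q + 1).factorial with hP
  have hP0 : 0 < P := by positivity
  set G := max 1 (P⁻¹ * Real.sqrt (2 / c) * V) with hG
  have hG1 : 1 ≤ G := le_max_left _ _
  refine ⟨G * (C2 * C1), one_le_mul_of_one_le_of_one_le hG1
    (one_le_mul_of_one_le_of_one_le h2 h1), fun k α j hj => ?_⟩
  set h := ∑ i ∈ Finset.range k, α i • (Y ^ i) e with hh
  have hann : annOp b h = 0 := by
    rw [hh, map_sum]
    refine Finset.sum_eq_zero fun i _ => ?_
    rw [map_smul, annOp_zShift_pow_groundState, smul_zero]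
  have hin : inner ℂ (toL2 (mulOp ζ (creOp b ((creOp b ^ q) h)))) (toL2 (ψ j)) =
      (P : ℂ) * (starRingEnd ℂ (α j) * radialMoment s j) := by
    rw [inner_mulOp hζg hζg (fun x => by simp only [hζ, Complex.conj_ofReal]), hζψ,
      ← mul_apply_eq_comp, ← pow_succ', hψ]
    simp only
    rw [ladder_inner_left (inner_annOp b) (annOp_creOp' b) hann, hh, map_sum, sum_inner]
    simp only [map_smul, inner_smul_left, hmom]
    rw [Finset.sum_eq_single j (fun i _ hij => by rw [if_neg hij, mul_zero])
      (fun hj' => absurd (Finset.mem_range.2 hj) hj'), if_pos rfl, hP]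
    push_cast
    rfl
  have hCS := norm_inner_le_norm (𝕜 := ℂ) (toL2 (mulOp ζ (creOp b ((creOp b ^ q) h)))) (toL2 (ψ j))
  have hκ : 0 < radialMoment s j := lt_of_lt_of_le (by positivity) (hC2 j)
  rw [hin, norm_mul, norm_mul, Complex.norm_real, Complex.norm_real, RCLike.norm_conj,
    Real.norm_of_nonneg hP0.le, Real.norm_of_nonneg hκ.le] at hCS
  set S := Real.sqrt (metricForm b m ((creOp b ^ q) h)) with hS
  have hS0 : 0 ≤ S := Real.sqrt_nonneg _
  have hζn' := hζn ((creOp b ^ q) h)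
  rw [Real.sqrt_mul (by positivity), ← hS] at hζn'
  have e1 : P * (‖α j‖ * radialMoment s j) ≤ Real.sqrt (2 / c) * S * (C1 ^ (j + 1) * V) :=
    hCS.trans (mul_le_mul hζn' (hψn j) (norm_nonneg _) (by positivity))
  have e2 : ‖α j‖ * (C2 ^ (j + 1))⁻¹ ≤ ‖α j‖ * radialMoment s j :=
    mul_le_mul_of_nonneg_left (hC2 j) (norm_nonneg _)
  have e3 : ‖α j‖ * (C2 ^ (j + 1))⁻¹ ≤ P⁻¹ * (Real.sqrt (2 / c) * S * (C1 ^ (j + 1) * V)) := by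
    rw [le_inv_mul_iff₀ hP0]
    exact (mul_le_mul_of_nonneg_left e2 hP0.le).trans e1
  rw [← div_eq_mul_inv, div_le_iff₀ (by positivity)] at e3
  refine e3.trans ?_
  have e4 : P⁻¹ * (Real.sqrt (2 / c) * S * (C1 ^ (j + 1) * V)) * C2 ^ (j + 1) =
      (P⁻¹ * Real.sqrt (2 / c) * V) * (C2 * C1) ^ (j + 1) * S := by
    rw [mul_pow]; ring
  rw [e4]
  refine mul_le_mul_of_nonneg_right ?_ hS0
  exact (mul_le_mul_of_nonneg_right (le_max_right _ _) (by positivity)).trans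
    (mul_pow_succ_le hG1 (by positivity) j)

/-- Polynomials in `z` of degree less than `k` may be recentred at `w`. -/
theorem exists_landauFun_combination_eq (hb : 0 < b) (w : ℂ) (q k : ℕ) (c : ℕ → ℂ) :
    ∃ α : ℕ → ℂ, ∑ j ∈ Finset.range k, c j • landauFun b hb (q, j) =
      (creOp b ^ q) (∑ i ∈ Finset.range k, α i • (zShift w ^ i) (groundState b hb)) := by
  set S := Submodule.span ℂ ((fun i => (creOp b ^ q) ((zShift w ^ i) (groundState b hb))) ''
    (Finset.range k : Set ℕ)) with hS
  have h1 : ∀ j ∈ Finset.range k, landauFun b hb (q, j) ∈ S := fun j hj => by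
    rw [landauFun]
    refine Submodule.smul_mem _ _ ?_
    simp only
    rw [landauState_eq_zOp_pow, zOp_pow_groundState_eq_sum hb w, map_sum]
    refine Submodule.smul_mem _ _ (Submodule.sum_mem _ fun i hi => ?_)
    rw [map_smul]
    refine Submodule.smul_mem _ _ (Submodule.subset_span ⟨i, ?_, rfl⟩)
    have := Finset.mem_range.1 hi
    have := Finset.mem_range.1 hj
    exact Finset.mem_coe.2 (Finset.mem_range.2 (by omega))
  have h2 : ∑ j ∈ Finset.range k, c j • landauFun b hb (q, j) ∈ S :=
    Submodule.sum_mem _ fun j hj => Submodule.smul_mem _ _ (h1 j hj)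
  obtain ⟨α, hα⟩ := (Submodule.mem_span_image_finset_iff_exists_fun ℂ).1 h2
  refine ⟨fun i => if h : i ∈ Finset.range k then α ⟨i, h⟩ else 0, ?_⟩
  rw [← hα, map_sum, ← Finset.sum_attach (Finset.range k)]
  refine Finset.sum_congr rfl fun i _ => ?_
  simp only [map_smul, dif_pos i.2]

/-- The coefficients in powers of `z - z₀` are bounded by the square root of the form, and the norms
of those powers by `C^{j+1} √(j!)`; the triangle inequality then bounds the norm of the combination.
-/
theorem exists_sum_sq_le_metricForm (hb : 0 < b) (hm : IsMetricBump m)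
    (hx : ∃ x, smallerEigenvalue (hm.nonneg x).isHermitian ≠ 0) (q : ℕ) :
    ∃ C, 1 ≤ C ∧ ∀ (k : ℕ) (c : ℕ → ℂ), ∑ j ∈ Finset.range k, ‖c j‖ ^ 2 ≤
      C ^ (k + 1) * k.factorial *
        metricForm b m (∑ j ∈ Finset.range k, c j • landauFun b hb (q, j)) := by
  obtain ⟨x0, ρ, hρ, c0, hc0, hd⟩ := exists_ball_metricDensity_ge hm hx
  obtain ⟨C1, h1, hC1⟩ := exists_norm_coeff_le hb hm hρ hc0 (hd b) q
  obtain ⟨C2, h2, hC2⟩ := exists_norm_zShift_pow_groundState_le hb (coordZ x0)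
  set P := Real.sqrt ((2 * b) ^ q * q.factorial) with hP
  set A := max 1 P with hA
  have hA1 : 1 ≤ A := le_max_left _ _
  set B := A * (C1 * C2) with hB
  have hB1 : 1 ≤ B := one_le_mul_of_one_le_of_one_le hA1 (one_le_mul_of_one_le_of_one_le h1 h2)
  refine ⟨(2 * B) ^ 2, one_le_pow₀ (by linarith), fun k c => ?_⟩
  obtain ⟨α, hα⟩ := exists_landauFun_combination_eq hb (coordZ x0) q k c
  set f := ∑ j ∈ Finset.range k, c j • landauFun b hb (q, j) with hf
  have hw := metricForm_nonneg b hm.growth hm.nonneg f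
  set S := Real.sqrt (metricForm b m f) with hS
  have hS0 : 0 ≤ S := Real.sqrt_nonneg _
  have hα' : ∀ j < k, ‖α j‖ ≤ C1 ^ (j + 1) * S := fun j hj => by
    have := hC1 k α j hj
    rwa [← hα] at this
  have hnf : ∑ j ∈ Finset.range k, ‖c j‖ ^ 2 = ‖toL2 f‖ ^ 2 := by
    have h := ((orthonormal_landauFun hb).comp (fun j : ℕ => (q, j))
      (fun i j h => (Prod.ext_iff.1 h).2)).inner_sum c c (Finset.range k)
    have e : ∑ j ∈ Finset.range k, c j • ((fun i : ℕ × ℕ => toL2 (landauFun b hb i)) ∘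
        fun j : ℕ => (q, j)) j = toL2 f := by
      rw [hf, map_sum]
      simp
    rw [e, inner_self_eq_norm_sq_to_K] at h
    apply Complex.ofReal_injective
    push_cast
    refine Eq.trans ?_ h.symm
    refine Finset.sum_congr rfl fun i _ => ?_
    rw [← Complex.normSq_eq_conj_mul_self, Complex.normSq_eq_norm_sq]
    push_cast; rfl
  have hcre : ∀ j, ‖toL2 ((creOp b ^ q) ((zShift (coordZ x0) ^ j) (groundState b hb)))‖ =
      P * ‖toL2 ((zShift (coordZ x0) ^ j) (groundState b hb))‖ := fun j => by
    refine (sq_eq_sq₀ (norm_nonneg _) (by positivity)).1 ?_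
    have h := ladder_inner_left (inner_annOp b) (annOp_creOp' b)
      (annOp_zShift_pow_groundState hb (coordZ x0) j)
      ((zShift (coordZ x0) ^ j) (groundState b hb)) q
    rw [inner_self_eq_norm_sq_to_K, inner_self_eq_norm_sq_to_K] at h
    rw [mul_pow, hP, Real.sq_sqrt (by positivity)]
    apply Complex.ofReal_injective
    push_cast at h ⊢
    exact h
  have hterm : ∀ j ∈ Finset.range k,
      ‖toL2 (α j • (creOp b ^ q) ((zShift (coordZ x0) ^ j) (groundState b hb)))‖ ≤
        B ^ k * (Real.sqrt k.factorial * S) := fun j hj => by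
    have hjk := Finset.mem_range.1 hj
    rw [map_smul, norm_smul, hcre]
    have e1 : Real.sqrt j.factorial ≤ Real.sqrt k.factorial :=
      Real.sqrt_le_sqrt (by exact_mod_cast Nat.factorial_le hjk.le)
    calc ‖α j‖ * (P * ‖toL2 ((zShift (coordZ x0) ^ j) (groundState b hb))‖)
        ≤ (C1 ^ (j + 1) * S) * (A * (C2 ^ (j + 1) * Real.sqrt k.factorial)) := by
          refine mul_le_mul (hα' j hjk) ?_ (by positivity) (by positivity)
          refine mul_le_mul (le_max_right _ _) ((hC2 j).trans ?_) (norm_nonneg _) (by positivity)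
          gcongr
      _ = (A * (C1 * C2) ^ (j + 1)) * (Real.sqrt k.factorial * S) := by rw [mul_pow]; ring
      _ ≤ B ^ (j + 1) * (Real.sqrt k.factorial * S) := by
          refine mul_le_mul_of_nonneg_right ?_ (by positivity)
          exact mul_pow_succ_le hA1 (by positivity) j
      _ ≤ B ^ k * (Real.sqrt k.factorial * S) := by
          refine mul_le_mul_of_nonneg_right ?_ (by positivity)
          exact pow_le_pow_right₀ hB1 (by omega)
  have hnorm : ‖toL2 f‖ ≤ (2 * B) ^ (k + 1) * (Real.sqrt k.factorial * S) := by
    rw [hα, map_sum, map_sum]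
    refine (norm_sum_le _ _).trans ?_
    have e1 : ∀ j ∈ Finset.range k, ‖toL2 ((creOp b ^ q)
        (α j • (zShift (coordZ x0) ^ j) (groundState b hb)))‖ ≤
        B ^ k * (Real.sqrt k.factorial * S) := fun j hj => by
      rw [map_smul]; exact hterm j hj
    refine (Finset.sum_le_sum e1).trans ?_
    rw [Finset.sum_const, Finset.card_range, nsmul_eq_mul, ← mul_assoc]
    refine mul_le_mul_of_nonneg_right ?_ (by positivity)
    -- The number of terms is absorbed into the geometric constant.
    have e2 : (k : ℝ) ≤ 2 ^ (k + 1) := by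
      exact_mod_cast (Nat.lt_two_pow_self.le.trans (Nat.pow_le_pow_right (by norm_num) (Nat.le_succ k)))
    rw [mul_pow 2 B (k + 1)]
    exact mul_le_mul e2 (pow_le_pow_right₀ hB1 (Nat.le_succ k)) (by positivity) (by positivity)
  rw [hnf]
  refine (pow_le_pow_left₀ (norm_nonneg _) hnorm 2).trans (le_of_eq ?_)
  rw [mul_pow, mul_pow (Real.sqrt _), Real.sq_sqrt (by positivity), hS, Real.sq_sqrt hw,
    ← pow_mul, ← pow_mul, mul_comm (k + 1) 2]
  ring

end ToeplitzLower

/-! ### Listing positive numbers in decreasing order, and asymptotics from counting bounds. -/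

section Listing

/-- Order `X` lexicographically by decreasing value and an injective label that breaks ties. Every
element has finitely many predecessors, and their number embeds `X` in `ℕ` compatibly with the
order. -/
theorem exists_equiv_antitone {X : Type*} [Infinite X] (f : X → ℝ)
    (hpos : ∀ x, 0 < f x) (hfin : ∀ ε > 0, {x | ε ≤ f x}.Finite) :
    ∃ e : ℕ ≃ X, Antitone (f ∘ e) := by
  have hc : Countable X := by
    rw [← Set.countable_univ_iff]
    have h : (Set.univ : Set X) ⊆ ⋃ n : ℕ, {x | 1 / ((n : ℝ) + 1) ≤ f x} := by
      intro x _
      obtain ⟨n, hn⟩ := exists_nat_one_div_lt (hpos x)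
      exact Set.mem_iUnion.2 ⟨n, hn.le⟩
    exact (Set.countable_iUnion fun n => (hfin _ (by positivity)).countable).mono h
  obtain ⟨g, hg⟩ := exists_injective_nat X
  let key : X → ℝᵒᵈ ×ₗ ℕ := fun x => toLex (OrderDual.toDual (f x), g x)
  have hkey : Function.Injective key := fun x y h => hg (congrArg (fun p => (ofLex p).2) h)
  have hle : ∀ {x y}, key x ≤ key y → f y ≤ f x := by
    intro x y h
    rcases Prod.Lex.toLex_le_toLex.1 h with h | h
    · exact (OrderDual.toDual_lt_toDual.1 h).le
    · exact (OrderDual.toDual_le_toDual.1 h.1.le)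
  let rk : X → ℕ := fun x => {y | key y < key x}.ncard
  have hrk : ∀ {x y}, key x < key y → rk x < rk y := by
    intro x y h
    refine Set.ncard_lt_ncard ⟨fun z hz => lt_trans hz h, fun hs => lt_irrefl (key x) (hs h)⟩ ?_
    exact (hfin _ (hpos y)).subset fun z hz => hle (le_of_lt hz)
  have hinj : Function.Injective rk := fun x y h => by
    rcases lt_trichotomy (key x) (key y) with h1 | h1 | h1
    · exact absurd h (hrk h1).ne
    · exact hkey h1
    · exact absurd h (hrk h1).ne'
  have : Infinite (Set.range rk) := Set.infinite_coe_iff.2 (Set.infinite_range_of_injective hinj)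
  classical
  let e1 : ℕ ≃o Set.range rk := Nat.Subtype.orderIsoOfNat (Set.range rk)
  let e2 : X ≃ Set.range rk := Equiv.ofInjective rk hinj
  refine ⟨e1.toEquiv.trans e2.symm, fun i j hij => hle ?_⟩
  by_contra hlt
  have h1 := hrk (not_le.1 hlt)
  have h2 : ∀ k, rk (e2.symm (e1 k)) = e1 k := fun k =>
    congrArg Subtype.val (e2.apply_symm_apply (e1 k))
  simp only [Equiv.trans_apply, RelIso.coe_fn_toEquiv, h2] at h1
  exact absurd (e1.monotone hij) (not_le.2 h1)

/-- The sequence `d` lists the points of `I`, each `x` being repeated `n x` times. -/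
structure ListsWithMult (n : ℝ → ℕ∞) (I : Set ℝ) (d : ℕ → ℝ) : Prop where
  mem : ∀ k, d k ∈ I
  card : ∀ x ∈ I, {k | d k = x}.encard = n x

variable {n : ℝ → ℕ∞} {I : Set ℝ}

theorem ListsWithMult.sum_eq {d : ℕ → ℝ} (hd : ListsWithMult n I d) (S : Finset ℝ) (hS : ∀ x ∈ S, x ∈ I) :
    ∑ x ∈ S, n x = {k | d k ∈ S}.encard := by
  classical
  induction S using Finset.induction_on with
  | empty => simp
  | insert a S ha ih =>
    rw [Finset.sum_insert ha, ih fun x hx => hS x (Finset.mem_insert_of_mem hx),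
      ← hd.card a (hS a (Finset.mem_insert_self _ _)), ← Set.encard_union_eq]
    · congr 1
      ext k
      simp
    · rw [Set.disjoint_left]
      rintro k hk h
      rw [Set.mem_ofPred_eq] at hk h
      exact ha (hk ▸ h)

theorem exists_antitone_lists (hI : ∀ x ∈ I, 0 < x)
    (hU : ∀ ε > 0, ∃ N : ℕ, ∀ S : Finset ℝ, (∀ x ∈ S, x ∈ I ∧ ε ≤ x) → ∑ x ∈ S, n x ≤ N)
    (hL : ∀ k : ℕ, ∃ S : Finset ℝ, (∀ x ∈ S, x ∈ I) ∧ (k : ℕ∞) ≤ ∑ x ∈ S, n x) :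
    ∃ d : ℕ → ℝ, Antitone d ∧ ListsWithMult n I d := by
  classical
  have hne : ∀ x ∈ I, n x ≠ ⊤ := by
    intro x hx h
    obtain ⟨N, hN⟩ := hU x (hI x hx)
    have := hN {x} (by simpa using hx)
    rw [Finset.sum_singleton, h, top_le_iff] at this
    exact ENat.natCast_ne_top N this
  have hfin : ∀ ε > 0, {x : I | ε ≤ (x : ℝ) ∧ n x ≠ 0}.Finite := by
    intro ε hε
    obtain ⟨N, hN⟩ := hU ε hε
    by_contra h
    obtain ⟨S, hS, hc⟩ := Set.Infinite.exists_subset_card_eq h (N + 1)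
    have h1 := hN (S.map (Function.Embedding.subtype _)) (by
      intro x hx
      obtain ⟨y, hy, rfl⟩ := Finset.mem_map.1 hx
      exact ⟨y.2, (hS hy).1⟩)
    rw [Finset.sum_map] at h1
    have h2 : ∑ x ∈ S, (1 : ℕ∞) ≤ ∑ x ∈ S, n x := Finset.sum_le_sum fun x hx =>
      Order.one_le_iff_ne_zero.2 (hS hx).2
    rw [Finset.sum_const, hc, nsmul_one] at h2
    have h3 := h2.trans h1
    exact absurd (Nat.cast_le.1 h3) (by omega)
  -- Each point is repeated according to its multiplicity; `toNat` loses nothing because `hne` makes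
  -- all multiplicities finite.
  let X : Type := Σ x : I, Fin (n x).toNat
  have hXfin : ∀ ε > 0, {p : X | ε ≤ (p.1 : ℝ)}.Finite := by
    intro ε hε
    have : {p : X | ε ≤ (p.1 : ℝ)} ⊆
        ((hfin ε hε).toFinset.sigma fun x => (Finset.univ : Finset (Fin (n x).toNat))) := by
      intro p hp
      rw [Finset.mem_coe, Finset.mem_sigma]
      refine ⟨(Set.Finite.mem_toFinset _).2 ⟨hp, fun h => ?_⟩, Finset.mem_univ _⟩
      have := p.2.2
      simp [h] at this
    exact (Finset.finite_toSet _).subset this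
  have hinf : Infinite X := by
    by_contra h
    rw [not_infinite_iff_finite] at h
    have := Fintype.ofFinite X
    obtain ⟨S, hS, hk⟩ := hL (Fintype.card X + 1)
    have h1 : ∑ x ∈ S, n x = ((∑ x ∈ S.attach, (n (x : ℝ)).toNat : ℕ) : ℕ∞) := by
      rw [Nat.cast_sum, ← Finset.sum_attach S n]
      refine Finset.sum_congr rfl fun x hx => ?_
      exact (ENat.natCast_toNat (hne x (hS x x.2))).symm
    rw [h1, Nat.cast_le] at hk
    let T : Finset X := (S.attach.map ⟨fun x : {x // x ∈ S} => (⟨x, hS x x.2⟩ : I), fun x y h =>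
      Subtype.ext (congrArg (fun z : I => (z : ℝ)) h)⟩).sigma fun x => Finset.univ
    have h2 := Finset.card_le_univ T
    rw [Finset.card_sigma, Finset.sum_map] at h2
    simp only [Finset.card_univ, Fintype.card_fin] at h2
    change ∑ x ∈ S.attach, (n (x : ℝ)).toNat ≤ _ at h2
    omega
  obtain ⟨e, he⟩ := exists_equiv_antitone (fun p : X => (p.1 : ℝ)) (fun p => hI _ p.1.2) hXfin
  refine ⟨_, he, ⟨fun k => (e k).1.2, fun x hx => ?_⟩⟩
  have h1 : {k | ((fun p : X => (p.1 : ℝ)) ∘ e) k = x} =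
      e.symm '' (Set.range fun i : Fin (n x).toNat => (⟨⟨x, hx⟩, i⟩ : X)) := by
    ext k
    rw [Equiv.image_symm_eq_preimage, Set.mem_preimage, Set.mem_range]
    constructor
    · intro h
      rcases hp : e k with ⟨⟨y, hy⟩, i⟩
      have : y = x := by
        have h' : ((e k).1 : ℝ) = x := h
        rwa [hp] at h'
      subst this
      exact ⟨i, rfl⟩
    · rintro ⟨i, hi⟩
      change ((e k).1 : ℝ) = x
      rw [← hi]
  rw [h1, e.symm.injective.encard_image, ← Set.image_univ,
    Function.Injective.encard_image (f := fun i : Fin (n x).toNat => (⟨⟨x, hx⟩, i⟩ : X))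
      (fun i j h => eq_of_heq (Sigma.mk.inj h).2), Set.encard_univ,
    ENat.card_eq_coe_fintype_card, Fintype.card_fin, ENat.natCast_toNat (hne x hx)]

theorem factorial_add_le_mul_pow (k n : ℕ) :
    (k + n).factorial ≤ k.factorial * (k + n) ^ n := by
  rw [← Nat.factorial_mul_descFactorial (Nat.le_add_left n k), Nat.add_sub_cancel]
  exact Nat.mul_le_mul_left _ (Nat.descFactorial_le_pow _ _)

theorem log_factorial_le (k : ℕ) : Real.log (Nat.factorial k) ≤ k * Real.log k := by
  rw [← Real.log_pow]
  exact Real.log_le_log (by positivity) (by exact_mod_cast Nat.factorial_le_pow k)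

theorem le_log_factorial (k : ℕ) : k * Real.log k - k ≤ Real.log (Nat.factorial k) := by
  rcases Nat.eq_zero_or_pos k with rfl | hk
  · simp
  have h := Real.pow_div_factorial_le_exp (k : ℝ) (Nat.cast_nonneg k) k
  have hk' : (0 : ℝ) < k := Nat.cast_pos.2 hk
  have h1 := Real.log_le_log (by positivity) h
  rw [Real.log_exp, Real.log_div (by positivity) (by positivity), Real.log_pow] at h1
  linarith

/-- `k log k - k ≤ log k! ≤ k log k`, and a bounded shift of the index changes `log k!` by `O(log
k)`. -/
theorem log_isBigO_of_bounds {d : ℕ → ℝ} {C c : ℝ} {n₀ n₁ : ℕ} (hC : 1 ≤ C) (hc : 0 < c)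
    (hpos : ∀ k, 0 < d k)
    (hU : ∀ k, d (k + n₀) ≤ C ^ (k + 1) / (Nat.factorial k))
    (hL : ∀ k, c ^ (k + n₁ + 1) / (Nat.factorial (k + n₁)) ≤ d k) :
    (fun k : ℕ => Real.log (d k) - (-(k : ℝ) * Real.log k)) =O[Filter.atTop]
      fun k : ℕ => (k : ℝ) := by
  refine Asymptotics.IsBigO.of_bound (2 * Real.log C + 1 + n₀ + (n₁ + 2) * |Real.log c| +
    n₁ * (n₁ + 1)) ?_
  filter_upwards [Filter.eventually_ge_atTop (n₀ + 1)] with k hk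
  have hk1 : 1 ≤ k := by omega
  have hkR : (1 : ℝ) ≤ k := by exact_mod_cast hk1
  have hlogk : Real.log k ≤ k := (Real.log_le_self (by linarith))
  have hlogk0 : 0 ≤ Real.log k := Real.log_nonneg hkR
  have hlC : 0 ≤ Real.log C := Real.log_nonneg hC
  rw [Real.norm_eq_abs, Real.norm_of_nonneg (by linarith : (0 : ℝ) ≤ k), abs_le]
  have hn0 : (0 : ℝ) ≤ n₀ := Nat.cast_nonneg _
  have hn1 : (0 : ℝ) ≤ n₁ := Nat.cast_nonneg _
  constructor
  · have h1 := Real.log_le_log (by positivity) (hL k)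
    rw [Real.log_div (by positivity) (by positivity), Real.log_pow] at h1
    have h2 : Real.log (Nat.factorial (k + n₁)) ≤ k * Real.log k + n₁ * (k + n₁) := by
      have h3 : ((k + n₁).factorial : ℝ) ≤ k.factorial * ((k : ℝ) + n₁) ^ n₁ := by
        exact_mod_cast factorial_add_le_mul_pow k n₁
      have h4 := Real.log_le_log (by positivity) h3
      rw [Real.log_mul (by positivity) (by positivity), Real.log_pow] at h4
      have h5 : Real.log ((k : ℝ) + n₁) ≤ k + n₁ := Real.log_le_self (by linarith)
      have := log_factorial_le k
      nlinarith
    have h6 : -(((n₁ : ℝ) + 2) * k * |Real.log c|) ≤ ((k + n₁ + 1 : ℕ) : ℝ) * Real.log c := by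
      have h7 := neg_abs_le (Real.log c)
      have h8 : ((k + n₁ + 1 : ℕ) : ℝ) ≤ ((n₁ : ℝ) + 2) * k := by push_cast; nlinarith
      have h9 := abs_nonneg (Real.log c)
      have h10 : (0 : ℝ) ≤ ((k + n₁ + 1 : ℕ) : ℝ) := Nat.cast_nonneg _
      nlinarith
    have h11 : (n₁ : ℝ) * (k + n₁) ≤ n₁ * (n₁ + 1) * k := by nlinarith [mul_nonneg hn1 hn1]
    nlinarith [mul_nonneg hn0 (by linarith : (0 : ℝ) ≤ k), mul_nonneg hlC (by linarith : (0 : ℝ) ≤ k)]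
  · obtain ⟨l, rfl⟩ : ∃ l, k = l + n₀ := ⟨k - n₀, by omega⟩
    have h1 := Real.log_le_log (hpos _) (hU l)
    rw [Real.log_div (by positivity) (by positivity), Real.log_pow] at h1
    have h2 : ((l + n₀ : ℕ) : ℝ) * Real.log (l + n₀ : ℕ) - (l + n₀ : ℕ) -
        n₀ * (l + n₀ : ℕ) ≤ Real.log (Nat.factorial l) := by
      have h3 : ((l + n₀).factorial : ℝ) ≤ l.factorial * ((l + n₀ : ℕ) : ℝ) ^ n₀ := by
        exact_mod_cast factorial_add_le_mul_pow l n₀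
      have h4 := Real.log_le_log (by positivity) h3
      rw [Real.log_mul (by positivity) (by positivity), Real.log_pow] at h4
      have h5 := le_log_factorial (l + n₀)
      nlinarith
    have h6 : ((l + 1 : ℕ) : ℝ) * Real.log C ≤ 2 * ((l + n₀ : ℕ) : ℝ) * Real.log C := by
      have h8 : ((l + 1 : ℕ) : ℝ) ≤ 2 * ((l + n₀ : ℕ) : ℝ) := by push_cast at hkR ⊢; linarith
      exact mul_le_mul_of_nonneg_right h8 hlC
    have h7 : 0 ≤ (((n₁ : ℝ) + 2) * |Real.log c| + n₁ * (n₁ + 1)) * ((l + n₀ : ℕ) : ℝ) := by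
      positivity
    nlinarith

/-- A multiset of positive numbers with factorial upper and lower counting bounds is listed by
a non-increasing sequence, whose logarithm is then `-k log k + O(k)`. -/
theorem lists_asymptotics (hI : ∀ x ∈ I, 0 < x) {C c : ℝ} {n₀ n₁ : ℕ} (hC : 1 ≤ C) (hc : 0 < c)
    (hU : ∀ (k : ℕ) (S : Finset ℝ), (∀ x ∈ S, x ∈ I ∧ C ^ (k + 1) / (Nat.factorial k) < x) →
      ∑ x ∈ S, n x ≤ (k + n₀ : ℕ))
    (hL : ∀ k : ℕ, ∃ S : Finset ℝ, (∀ x ∈ S, x ∈ I ∧ c ^ (k + 1) / (Nat.factorial k) < x) ∧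
      (k : ℕ∞) ≤ ∑ x ∈ S, n x + n₁) :
    (∃ d : ℕ → ℝ, Antitone d ∧ ListsWithMult n I d) ∧ ∀ d : ℕ → ℝ, Antitone d → ListsWithMult n I d →
      (fun k : ℕ => Real.log (d k) - (-(k : ℝ) * Real.log k)) =O[Filter.atTop]
        fun k : ℕ => (k : ℝ) := by
  have hL' : ∀ k : ℕ, ∃ S : Finset ℝ, (∀ x ∈ S, x ∈ I ∧
      c ^ (k + n₁ + 1) / (Nat.factorial (k + n₁)) < x) ∧ (k : ℕ∞) ≤ ∑ x ∈ S, n x := by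
    intro k
    obtain ⟨S, h1, h2⟩ := hL (k + n₁)
    refine ⟨S, h1, ?_⟩
    rw [Nat.cast_add] at h2
    exact (ENat.add_le_add_iff_right (ENat.natCast_ne_top n₁)).1 h2
  refine ⟨exists_antitone_lists hI (fun ε hε => ?_) (fun k => ?_), fun d hd hl => ?_⟩
  · have h := (FloorSemiring.tendsto_pow_div_factorial_atTop C).const_mul C
    rw [mul_zero] at h
    obtain ⟨k, hk⟩ := (h.eventually (gt_mem_nhds hε)).exists
    refine ⟨k + n₀, fun S hS => hU k S fun x hx => ⟨(hS x hx).1, lt_of_lt_of_le ?_ (hS x hx).2⟩⟩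
    rwa [pow_succ', mul_div_assoc]
  · obtain ⟨S, h1, h2⟩ := hL' k
    exact ⟨S, fun x hx => (h1 x hx).1, h2⟩
  · refine log_isBigO_of_bounds (n₀ := n₀) (n₁ := n₁ + 1) hC hc (fun k => hI _ (hl.mem k))
      (fun k => ?_) (fun k => ?_)
    -- Otherwise the first `k + n₀ + 1` terms would all exceed the threshold, against the upper
    -- count.
    · by_contra hlt
      classical
      have h1 := hU k ((Finset.range (k + n₀ + 1)).image d) (by
        intro x hx
        obtain ⟨j, hj, rfl⟩ := Finset.mem_image.1 hx
        refine ⟨hl.mem j, (not_le.1 hlt).trans_le (hd ?_)⟩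
        have := Finset.mem_range.1 hj
        omega)
      rw [hl.sum_eq _ (by
        intro x hx
        obtain ⟨j, hj, rfl⟩ := Finset.mem_image.1 hx
        exact hl.mem j)] at h1
      have h2 : ((Finset.range (k + n₀ + 1) : Finset ℕ) : Set ℕ).encard ≤
          {j | d j ∈ (Finset.range (k + n₀ + 1)).image d}.encard :=
        Set.encard_le_encard fun j hj => Finset.mem_image_of_mem d hj
      rw [Set.encard_coe_eq_coe_finsetCard, Finset.card_range] at h2
      have h3 := h2.trans h1
      exact absurd (Nat.cast_le.1 h3) (by omega)
    -- Among `k + 1` listed terms above the threshold one has index at least `k`, and `d k` is no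
    -- smaller; this accounts for the shift `n₁ + 1`.
    · obtain ⟨S, h1, h2⟩ := hL' (k + 1)
      rw [hl.sum_eq S fun x hx => (h1 x hx).1] at h2
      have h3 : ∃ j ∈ {j | d j ∈ S}, k ≤ j := by
        by_contra! h
        have h4 : {j | d j ∈ S} ⊆ ((Finset.range k : Finset ℕ) : Set ℕ) := fun j hj =>
          Finset.mem_coe.2 (Finset.mem_range.2 (h j hj))
        have h5 := h2.trans (Set.encard_le_encard h4)
        rw [Set.encard_coe_eq_coe_finsetCard, Finset.card_range] at h5
        exact absurd (Nat.cast_le.1 h5) (by omega)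
      obtain ⟨j, hj, hkj⟩ := h3
      have h6 := (h1 _ hj).2
      rw [show k + 1 + n₁ = k + (n₁ + 1) by ring] at h6
      exact h6.le.trans (hd hkj)

end Listing

/-! ### Counting the eigenvalues of the perturbed inverse near an inverse Landau level. -/

section Counting

variable {b σ α : ℝ} {q : ℕ} {m : Plane → Matrix (Fin 2) (Fin 2) ℂ}

/-- The point `α` lies on the side of `1 / Λ_q` determined by `σ`, and no inverse Landau level
lies strictly between `α` and `1 / Λ_q`. -/
structure IsGapEndpoint (b σ : ℝ) (q : ℕ) (α : ℝ) : Prop where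
  pos : 0 < α
  side : 0 < σ * ((landauLevel b q)⁻¹ - α)
  gap : ∃ η > 0, ∀ j : ℕ, (landauLevel b j)⁻¹ = α ∨ (landauLevel b j)⁻¹ = (landauLevel b q)⁻¹ ∨
    η ≤ ((landauLevel b j)⁻¹ - α) * ((landauLevel b j)⁻¹ - (landauLevel b q)⁻¹)

/-- The multiplicity of an eigenvalue of a bounded operator. -/
noncomputable def eigenRank (A : L2Plane →L[ℂ] L2Plane) (t : ℝ) : ℕ∞ :=
  Cardinal.toENat (Module.rank ℂ (eigenKer A t))

theorem eigenRank_eq {A : L2Plane →L[ℂ] L2Plane} {t : ℝ} (h : FiniteDimensional ℂ (eigenKer A t)) :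
    eigenRank A t = Module.finrank ℂ (eigenKer A t) := by
  rw [eigenRank, ← Module.finrank_eq_rank, Cardinal.toENat_nat]

theorem finrank_le_eigenRank (A : L2Plane →L[ℂ] L2Plane) (t : ℝ) :
    (Module.finrank ℂ (eigenKer A t) : ℕ∞) ≤ eigenRank A t := by
  by_cases h : FiniteDimensional ℂ (eigenKer A t)
  · exact (eigenRank_eq h).ge
  · rw [Module.finrank_of_not_finite h]
    exact zero_le

theorem sum_eigenRank_le {A : L2Plane →L[ℂ] L2Plane} {S : Finset ℝ} {N : ℕ}
    (h : (∀ t ∈ S, FiniteDimensional ℂ (eigenKer A t)) ∧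
      ∑ t ∈ S, Module.finrank ℂ (eigenKer A t) ≤ N) : ∑ t ∈ S, eigenRank A t ≤ N := by
  rw [Finset.sum_congr rfl fun t ht => eigenRank_eq (h.1 t ht)]
  exact_mod_cast h.2

theorem isSelfAdjoint_solOp_perturbedOp (hb : 0 < b) (hm : IsMetricBump m)
    (hσ : IsAdmissibleSign b σ m) : IsSelfAdjoint (solOp (perturbedOp b σ m)) :=
  (metricForm_perturb_isElliptic hb hm hσ).isPositive_solOp.isSelfAdjoint

theorem exists_quadForm_gapOp_perturbed_le (hb : 0 < b) (hm : IsMetricBump m)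
    (hσ : IsAdmissibleSign b σ m) {β η : ℝ} (hs : 0 < σ * (β - α)) (hη0 : 0 < η)
    (hη : ∀ j : ℕ, (landauLevel b j)⁻¹ = α ∨ (landauLevel b j)⁻¹ = β ∨
      η ≤ ((landauLevel b j)⁻¹ - α) * ((landauLevel b j)⁻¹ - β)) :
    ∃ F : Submodule ℂ L2Plane, FiniteDimensional ℂ F ∧ ∀ u ∈ Fᗮ,
      quadForm (gapOp (solOp (perturbedOp b σ m)) α β) u ≤ 2 * (σ * (β - α)) *
        quadForm (resolventDiff b σ m) ((eigenKer (solOp (landauOp b)) β).starProjection u) :=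
  quadForm_gapOp_le (landauBasis b hb) hσ.sq_eq (isSelfAdjoint_solOp_landau hb)
    (solOp_landauBasis hb) (isSelfAdjoint_solOp_perturbedOp hb hm hσ) (solOp_perturbedOp_eq hσ)
    (isPositive_resolventDiff hb hm hσ) hs (formSmall_resolventDiff hb hm hσ) hη0
    fun i => hη i.1

theorem formSmall_gapOp_perturbed (hb : 0 < b) (hm : IsMetricBump m)
    (hσ : IsAdmissibleSign b σ m) (hα : IsGapEndpoint b σ q α) :
    FormSmall (gapOp (solOp (perturbedOp b σ m)) α (landauLevel b q)⁻¹) := by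
  intro δ hδ
  obtain ⟨η, hη0, hη⟩ := hα.gap
  obtain ⟨F1, hF1, h1⟩ := exists_quadForm_gapOp_perturbed_le hb hm hσ hα.side hη0 hη
  have hs := hα.side
  set s := σ * ((landauLevel b q)⁻¹ - α)
  obtain ⟨F2, hF2, h2⟩ := formSmall_resolventDiff hb hm hσ (δ / (2 * s)) (by positivity)
  obtain ⟨G, hG, h3⟩ := finiteDimensional_preimage_orthogonal (F := F2) (landauProj b q)
  refine ⟨F1 ⊔ G, inferInstance, fun u hu => ?_⟩
  have h4 := h1 u (Submodule.orthogonal_le le_sup_left hu)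
  have h5 := h2 _ (h3 u (Submodule.orthogonal_le le_sup_right hu))
  have h6 : ‖landauProj b q u‖ ^ 2 ≤ ‖u‖ ^ 2 := by
    gcongr
    exact norm_landauProj_le q u
  refine h4.trans ?_
  calc 2 * s * quadForm (resolventDiff b σ m) (landauProj b q u)
      ≤ 2 * s * (δ / (2 * s) * ‖u‖ ^ 2) := by gcongr; exact h5.trans (by gcongr)
    _ = δ * ‖u‖ ^ 2 := by field_simp

/-- Adjoining the first `k` states of the level to the exceptional space leaves only indices at
least `k` in the projection, where the factorial bound applies. The exceptional dimension does not
depend on `k`. -/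
theorem exists_sum_eigenRank_near_le (hb : 0 < b) (hm : IsMetricBump m)
    (hσ : IsAdmissibleSign b σ m) (hα : IsGapEndpoint b σ q α) :
    ∃ (C : ℝ) (n₀ : ℕ), 1 ≤ C ∧ ∀ (k : ℕ) (S : Finset ℝ),
      (∀ t ∈ S, C ^ (k + 1) / k.factorial ≤ gapPoly α (landauLevel b q)⁻¹ t) →
      ∑ t ∈ S, eigenRank (solOp (perturbedOp b σ m)) t ≤ (k + n₀ : ℕ) := by
  classical
  obtain ⟨η, hη0, hη⟩ := hα.gap
  obtain ⟨F1, hF1, h1⟩ := exists_quadForm_gapOp_perturbed_le hb hm hσ hα.side hη0 hη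
  have hs := hα.side
  set s := σ * ((landauLevel b q)⁻¹ - α)
  obtain ⟨C, hC1, hC⟩ := exists_quadForm_resolventDiff_level_le hb hm hσ q
  -- Using `2s + 1` instead of `2s` gives the strict inequality needed for counting.
  have hs1 : 1 ≤ 2 * s + 1 := by linarith
  refine ⟨(2 * s + 1) * C, Module.finrank ℂ F1, one_le_mul_of_one_le_of_one_le hs1 hC1,
    fun k S hS => ?_⟩
  set B : Finset L2Plane := (Finset.range k).image fun j => landauBasis b hb (q, j) with hB
  have hfd : FiniteDimensional ℂ (Submodule.span ℂ (B : Set L2Plane)) := inferInstance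
  have hfr : Module.finrank ℂ (F1 ⊔ Submodule.span ℂ (B : Set L2Plane) : Submodule ℂ L2Plane) ≤
      k + Module.finrank ℂ F1 := by
    refine (Submodule.finrank_add_le_finrank_add_finrank _ _).trans ?_
    have h2 := finrank_span_finset_le_card (R := ℂ) B
    rw [Set.finrank] at h2
    have h3 := (Finset.card_image_le (s := Finset.range k)
      (f := fun j => landauBasis b hb (q, j)))
    rw [Finset.card_range] at h3
    have h4 := h2.trans h3
    omega
  have key := finite_and_sum_finrank_le (isSelfAdjoint_solOp_perturbedOp hb hm hσ)
    (F := F1 ⊔ Submodule.span ℂ (B : Set L2Plane)) (α := α) (β := (landauLevel b q)⁻¹)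
    (s := ((2 * s + 1) * C) ^ (k + 1) / k.factorial) (fun u hu hu0 => ?_) S hS
  · exact sum_eigenRank_le ⟨key.1, key.2.trans hfr⟩
  · have h4 := h1 u (Submodule.orthogonal_le le_sup_left hu)
    have h5 := hC k (landauProj b q u) (fun i hi => by
      rw [inner_landauProj hb]
      split_ifs with hq
      · have hik : i.2 < k := by
          by_contra h
          exact hi ⟨hq, not_lt.1 h⟩
        have hmem : landauBasis b hb i ∈ Submodule.span ℂ (B : Set L2Plane) := by
          refine Submodule.subset_span (Finset.mem_coe.2 (Finset.mem_image.2
            ⟨i.2, Finset.mem_range.2 hik, ?_⟩))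
          rw [← hq]
        exact Submodule.inner_right_of_mem_orthogonal hmem
          (Submodule.orthogonal_le le_sup_right hu)
      · rfl)
    have h6 : ‖landauProj b q u‖ ^ 2 ≤ ‖u‖ ^ 2 := by
      gcongr
      exact norm_landauProj_le q u
    have hu1 : 0 < ‖u‖ ^ 2 := by positivity
    have hCk : 0 < C ^ (k + 1) / k.factorial := by positivity
    calc quadForm (gapOp (solOp (perturbedOp b σ m)) α (landauLevel b q)⁻¹) u
        ≤ 2 * s * (C ^ (k + 1) / k.factorial * ‖u‖ ^ 2) := by
          refine h4.trans ?_
          gcongr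
          exact h5.trans (by gcongr)
      _ < (2 * s + 1) * (C ^ (k + 1) / k.factorial * ‖u‖ ^ 2) := by
          have := mul_pos hCk hu1
          linarith
      _ = ((2 * s + 1) * C ^ (k + 1)) / k.factorial * ‖u‖ ^ 2 := by ring
      _ ≤ ((2 * s + 1) * C) ^ (k + 1) / k.factorial * ‖u‖ ^ 2 := by
          gcongr
          exact mul_pow_succ_le hs1 (by linarith) k

theorem starProjection_eigenKer_landau_eq_zero (hb : 0 < b) {β : ℝ}
    (hβ : ∀ j : ℕ, (landauLevel b j)⁻¹ ≠ β) (u : L2Plane) :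
    (eigenKer (solOp (landauOp b)) β).starProjection u = 0 := by
  have hbot : ∀ v ∈ eigenKer (solOp (landauOp b)) β, v = 0 := by
    intro v hv
    have h : (landauBasis b hb).repr v = 0 := by
      ext i
      rw [HilbertBasis.repr_apply_apply]
      exact inner_eq_zero_of_eigen (isSelfAdjoint_solOp_landau hb) (hβ i.1)
        (solOp_landauBasis hb i) (mem_eigenKer.1 hv)
    exact (LinearIsometryEquiv.map_eq_zero_iff _).1 h
  exact hbot _ (Submodule.starProjection_apply_mem _ _)

/-- The perturbation pushes the eigenvalues at `α` out of the gap, so none accumulate there.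
Formally, the upper bound is applied with `β` replaced by the midpoint: no inverse Landau level
equals it, the projection is zero, and the form is non-positive up to finite dimension. -/
theorem exists_sum_eigenRank_far_le (hb : 0 < b) (hm : IsMetricBump m)
    (hσ : IsAdmissibleSign b σ m) (hα : IsGapEndpoint b σ q α) :
    ∃ n₂ : ℕ, ∀ S : Finset ℝ, (∀ t ∈ S, 0 < gapPoly α ((α + (landauLevel b q)⁻¹) / 2) t) →
      ∑ t ∈ S, eigenRank (solOp (perturbedOp b σ m)) t ≤ n₂ := by
  obtain ⟨η, hη0, hη⟩ := hα.gap
  have hs := hα.side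
  set β := (landauLevel b q)⁻¹
  have hσ2 := hσ.sq_eq
  have hne : (0 : ℝ) < (β - α) ^ 2 := by
    have : (β - α) ^ 2 = (σ * (β - α)) ^ 2 := by rw [mul_pow, hσ2, one_mul]
    rw [this]; positivity
  -- The product `(x - α)(x - (α + β)/2)` is the average of `(x - α)²` and `(x - α)(x - β)`; at `x =
  -- β` it equals `(β - α)²/2`.
  have hη' : ∀ j : ℕ, (landauLevel b j)⁻¹ = α ∨ min (η / 2) ((β - α) ^ 2 / 2) ≤
      ((landauLevel b j)⁻¹ - α) * ((landauLevel b j)⁻¹ - (α + β) / 2) := by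
    intro j
    rcases hη j with h | h | h
    · exact Or.inl h
    · right
      refine (min_le_right _ _).trans (le_of_eq ?_)
      rw [h]; ring
    · right
      refine (min_le_left _ _).trans ?_
      nlinarith [sq_nonneg ((landauLevel b j)⁻¹ - α)]
  have hη1 : 0 < min (η / 2) ((β - α) ^ 2 / 2) := lt_min (by positivity) (by positivity)
  obtain ⟨F, hF, h1⟩ := exists_quadForm_gapOp_perturbed_le hb hm hσ (β := (α + β) / 2)
    (by nlinarith) hη1 (fun j => (hη' j).imp_right Or.inr)
  refine ⟨Module.finrank ℂ F, fun S hS => ?_⟩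
  rcases S.eq_empty_or_nonempty with rfl | hne'
  · simp
  -- The least value over `S` is a positive threshold; it depends on `S`, but the bound on the count
  -- does not.
  obtain ⟨t0, ht0, hmin⟩ := S.exists_min_image (gapPoly α ((α + β) / 2)) hne'
  refine sum_eigenRank_le (finite_and_sum_finrank_le (isSelfAdjoint_solOp_perturbedOp hb hm hσ)
    (fun u hu hu0 => ?_) S hmin)
  refine (h1 u hu).trans_lt ?_
  rw [starProjection_eigenKer_landau_eq_zero hb, quadForm, map_zero, inner_zero_left,
    Complex.zero_re, mul_zero]
  · have := hS t0 ht0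
    have : 0 < ‖u‖ ^ 2 := by positivity
    positivity
  · intro j hj
    rcases hη' j with h | h
    · rw [h] at hj
      have : β - α = 0 := by linarith
      rw [this] at hne
      simp at hne
    · rw [hj, sub_self, mul_zero] at h
      linarith

/-- On the span of the first `k` states of the level, intersected with a fixed space of finite
codimension, the form of `gapOp` dominates that of `resolventDiff`, hence that of the perturbation,
which has the factorial lower bound. -/
theorem exists_le_sum_eigenRank (hb : 0 < b) (hm : IsMetricBump m)
    (hx : ∃ x, smallerEigenvalue (hm.nonneg x).isHermitian ≠ 0)
    (hσ : IsAdmissibleSign b σ m) (hα : IsGapEndpoint b σ q α) :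
    ∃ (c : ℝ) (n₁ : ℕ), 0 < c ∧ ∀ k : ℕ, ∃ S : Finset ℝ,
      (∀ t ∈ S, c ^ (k + 1) / k.factorial < gapPoly α (landauLevel b q)⁻¹ t) ∧
      (k : ℕ∞) ≤ ∑ t ∈ S, eigenRank (solOp (perturbedOp b σ m)) t + n₁ := by
  classical
  have hA := isSelfAdjoint_solOp_perturbedOp hb hm hσ
  have hs := hα.side
  obtain ⟨F, hF, hge⟩ := quadForm_gapOp_ge hσ.sq_eq hA (solOp_perturbedOp_eq hσ)
    (isPositive_resolventDiff hb hm hσ) hs (formSmall_resolventDiff hb hm hσ)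
  obtain ⟨G, hG, hGF⟩ := finiteDimensional_preimage_orthogonal (F := F) (resolventDiff b σ m)
  obtain ⟨C1, h1, hC1⟩ := exists_quadForm_resolventDiff_bounds hb hm hσ
  obtain ⟨C2, h2, hC2⟩ := exists_sum_sq_le_metricForm hb hm hx q
  have hΛ := landauLevel_pos hb q
  set Λ := landauLevel b q
  set s := σ * (Λ⁻¹ - α) with hs_def
  -- The constant of the comparison, increased by one to make the final inequality strict.
  set D := 1 + 2 * Λ ^ 2 * C1 / s with hD
  have hD0 : 0 < 2 * Λ ^ 2 * C1 / s := by positivity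
  have hD1 : 1 ≤ D := by linarith
  refine ⟨(D * C2)⁻¹, Module.finrank ℂ G, by positivity, fun k => ?_⟩
  have hon : Orthonormal ℂ fun j : Fin k => landauBasis b hb (q, (j : ℕ)) :=
    (landauBasis b hb).orthonormal.comp (fun j : Fin k => (q, (j : ℕ))) fun i j hij =>
      Fin.ext (Prod.ext_iff.1 hij).2
  set V : Submodule ℂ L2Plane :=
    Submodule.span ℂ (Set.range fun j : Fin k => landauBasis b hb (q, (j : ℕ))) with hV
  have hVk : Module.finrank ℂ V = k := by
    rw [finrank_span_eq_card hon.linearIndependent, Fintype.card_fin]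
  have hVfd : FiniteDimensional ℂ V := FiniteDimensional.span_of_finite ℂ (Set.finite_range _)
  let φ : V →ₗ[ℂ] G := (G.orthogonalProjectionOnto : L2Plane →ₗ[ℂ] G) ∘ₗ V.subtype
  -- The vectors of `V` orthogonal to `G`; the loss of dimension is at most that of `G`, uniformly
  -- in `k`.
  set L : Submodule ℂ L2Plane := φ.ker.map V.subtype with hL
  have hLfr : k ≤ Module.finrank ℂ L + Module.finrank ℂ G := by
    have e1 := LinearMap.finrank_range_add_finrank_ker φ
    have e2 : Module.finrank ℂ L = Module.finrank ℂ φ.ker := Submodule.finrank_map_subtype_eq _ _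
    have e3 := Submodule.finrank_le φ.range
    omega
  have hquad : ∀ u ∈ L, u ≠ 0 → ((D * C2)⁻¹) ^ (k + 1) / k.factorial * ‖u‖ ^ 2 <
      quadForm (gapOp (solOp (perturbedOp b σ m)) α Λ⁻¹) u := by
    intro u hu hu0
    obtain ⟨v, hv, rfl⟩ := Submodule.mem_map.1 hu
    have hvG : (v : L2Plane) ∈ Gᗮ := by
      rw [← Submodule.orthogonalProjectionOnto_eq_zero_iff]
      exact hv
    obtain ⟨c, hc⟩ := (Submodule.mem_span_range_iff_exists_fun ℂ).1 v.2
    change (v : L2Plane) ≠ 0 at hu0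
    change _ * ‖(v : L2Plane)‖ ^ 2 < quadForm _ (v : L2Plane)
    set u : L2Plane := (v : L2Plane) with hu_def
    let c' : ℕ → ℂ := fun j => if h : j < k then c ⟨j, h⟩ else 0
    have hc' : u = ∑ j ∈ Finset.range k, c' j • landauBasis b hb (q, j) := by
      rw [← hc, Finset.sum_range]
      refine Finset.sum_congr rfl fun j _ => ?_
      simp [c']
    have hA0 : solOp (landauOp b) u = ((Λ⁻¹ : ℝ) : ℂ) • u := by
      rw [hc', map_sum, Finset.smul_sum]
      refine Finset.sum_congr rfl fun j _ => ?_
      rw [map_smul, solOp_landauBasis hb, smul_comm]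
    have hq := hge u hA0 (hGF u hvG)
    let ι : ℕ ↪ ℕ × ℕ := ⟨fun j => (q, j), fun i j hij => (Prod.ext_iff.1 hij).2⟩
    have hsum : u = ∑ i ∈ (Finset.range k).map ι, c' i.2 • landauBasis b hb i := by
      rw [Finset.sum_map]; exact hc'
    have hnorm : ‖u‖ ^ 2 = ∑ j ∈ Finset.range k, ‖c' j‖ ^ 2 := by
      rw [hsum, norm_sum_hilbertBasis_sq (landauBasis b hb) _ fun i => c' i.2, Finset.sum_map]
      rfl
    have hf : u = toL2 (landauOp b (∑ j ∈ Finset.range k,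
        (c' j * (Λ : ℂ)⁻¹) • landauFun b hb (q, j))) := by
      rw [hsum, sum_landauBasis_eq hb _ fun i => c' i.2, Finset.sum_map]
      rfl
    have h4 := hC2 k fun j => c' j * (Λ : ℂ)⁻¹
    have h5 := (hC1 (∑ j ∈ Finset.range k, (c' j * (Λ : ℂ)⁻¹) • landauFun b hb (q, j))).1
    rw [← hf] at h5
    have h6 : ∑ j ∈ Finset.range k, ‖c' j * (Λ : ℂ)⁻¹‖ ^ 2 = (Λ⁻¹) ^ 2 * ‖u‖ ^ 2 := by
      rw [hnorm, Finset.mul_sum]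
      refine Finset.sum_congr rfl fun j _ => ?_
      rw [norm_mul, mul_pow, norm_inv, Complex.norm_real, Real.norm_of_nonneg hΛ.le, mul_comm]
    rw [h6] at h4
    have hu2 : 0 < ‖u‖ ^ 2 := by positivity
    have h7 : Λ⁻¹ ^ 2 * ‖u‖ ^ 2 ≤
        C2 ^ (k + 1) * k.factorial * (C1 * quadForm (resolventDiff b σ m) u) :=
      h4.trans (mul_le_mul_of_nonneg_left h5 (by positivity))
    have h8 : C2 ^ (k + 1) * k.factorial * (C1 * quadForm (resolventDiff b σ m) u) ≤
        C2 ^ (k + 1) * k.factorial * C1 * (2 / s * quadForm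
          (gapOp (solOp (perturbedOp b σ m)) α Λ⁻¹) u) := by
      rw [← mul_assoc]
      refine mul_le_mul_of_nonneg_left ?_ (by positivity)
      rw [div_mul_eq_mul_div, le_div_iff₀ hs]
      linarith
    set Q := quadForm (gapOp (solOp (perturbedOp b σ m)) α Λ⁻¹) u with hQ
    have h9 : ‖u‖ ^ 2 ≤ (D - 1) * C2 ^ (k + 1) * k.factorial * Q := by
      have e1 := h7.trans h8
      rw [inv_pow, inv_mul_le_iff₀ (by positivity)] at e1
      refine e1.trans (le_of_eq ?_)
      rw [hD]
      field_simp
      ring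
    have hQ0 : 0 < Q := by
      by_contra hneg
      have : (D - 1) * C2 ^ (k + 1) * k.factorial * Q ≤ 0 :=
        mul_nonpos_of_nonneg_of_nonpos (by have : 0 ≤ D - 1 := by linarith
                                           positivity) (not_lt.1 hneg)
      linarith
    rw [inv_pow, div_mul_eq_mul_div, inv_mul_eq_div, div_div, div_lt_iff₀ (by positivity)]
    refine h9.trans_lt ?_
    have e2 : (D - 1) * C2 ^ (k + 1) < (D * C2) ^ (k + 1) := by
      refine lt_of_lt_of_le ?_ (mul_pow_succ_le hD1 (by linarith) k)
      have : 0 < C2 ^ (k + 1) := by positivity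
      nlinarith
    have : 0 < (k.factorial : ℝ) * Q := by positivity
    nlinarith
  obtain ⟨S, hS1, hS2⟩ := exists_finset_le_sum_finrank hA (by positivity)
    (formSmall_gapOp_perturbed hb hm hσ hα) hquad
  refine ⟨S, hS1, ?_⟩
  have h3 : (Module.finrank ℂ L : ℕ∞) ≤ ∑ t ∈ S, eigenRank (solOp (perturbedOp b σ m)) t := by
    refine le_trans ?_ (Finset.sum_le_sum fun t _ => finrank_le_eigenRank _ t)
    exact_mod_cast hS2
  calc (k : ℕ∞) ≤ (Module.finrank ℂ L + Module.finrank ℂ G : ℕ) := by exact_mod_cast hLfr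
    _ ≤ _ := by rw [Nat.cast_add]; exact add_le_add_left h3 _

end Counting

/-! ### From eigenvalues of the inverse to distances from the Landau level. -/

section Assembly

variable {b σ α : ℝ} {q : ℕ} {m : Plane → Matrix (Fin 2) (Fin 2) ℂ}

theorem gapPoly_pos_iff {β t : ℝ} (hσ : σ ^ 2 = 1) (hs : 0 < σ * (β - α)) :
    0 < gapPoly α β t ↔ 0 < σ * (t - α) ∧ 0 < σ * (β - t) := by
  have h : gapPoly α β t = (σ * (t - α)) * (σ * (β - t)) := by
    rw [gapPoly]
    linear_combination (-(t - α) * (β - t)) * hσ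
  rw [h]
  constructor
  · intro hp
    rcases mul_pos_iff.1 hp with hp | hp
    · exact hp
    · nlinarith [hp.1, hp.2]
  · exact fun hp => mul_pos hp.1 hp.2

/-- At the inverse of `Λ + σx` the polynomial is the distance `x` times factors that stay bounded,
and bounded away from zero as long as `t` is not near `α`. -/
theorem gapPoly_inv_eq {Λ x : ℝ} (hΛ : Λ ≠ 0) (hx : Λ + σ * x ≠ 0) :
    gapPoly α Λ⁻¹ (Λ + σ * x)⁻¹ =
      (σ * ((Λ + σ * x)⁻¹ - α)) * ((Λ + σ * x)⁻¹ * Λ⁻¹) * x := by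
  have h : (Λ + σ * x)⁻¹ - Λ⁻¹ = -(σ * x) * ((Λ + σ * x)⁻¹ * Λ⁻¹) := by
    field_simp
    ring
  rw [gapPoly, h]
  ring

/-- The eigenvalues of the perturbed resolvent between `α` and `1 / Λ_q`, in terms of the distance
`x` of the corresponding spectral parameter `Λ_q + σ x` to `Λ_q`. -/
theorem eigenvalue_distance_asymptotics (hb : 0 < b) (hm : IsMetricBump m)
    (hx : ∃ x, smallerEigenvalue (hm.nonneg x).isHermitian ≠ 0)
    (hσ : IsAdmissibleSign b σ m) (hα : IsGapEndpoint b σ q α) {I : Set ℝ} {n : ℝ → ℕ∞}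
    (hI : ∀ x ∈ I, 0 < x)
    (hn : ∀ x ∈ I, n x ≠ 0 → 0 < gapPoly α (landauLevel b q)⁻¹ (landauLevel b q + σ * x)⁻¹ ∧
      n x = eigenRank (solOp (perturbedOp b σ m)) (landauLevel b q + σ * x)⁻¹)
    (hn' : ∀ t, 0 < gapPoly α (landauLevel b q)⁻¹ t →
      eigenRank (solOp (perturbedOp b σ m)) t ≠ 0 → σ * (t⁻¹ - landauLevel b q) ∈ I ∧
      n (σ * (t⁻¹ - landauLevel b q)) = eigenRank (solOp (perturbedOp b σ m)) t) :
    (∃ d : ℕ → ℝ, Antitone d ∧ ListsWithMult n I d) ∧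
      ∀ d : ℕ → ℝ, Antitone d → ListsWithMult n I d →
      (fun k : ℕ => Real.log (d k) - (-(k : ℝ) * Real.log k)) =O[Filter.atTop]
        fun k : ℕ => (k : ℝ) := by
  classical
  obtain ⟨C, n₀, hC1, hC⟩ := exists_sum_eigenRank_near_le hb hm hσ hα
  obtain ⟨n₂, hfar⟩ := exists_sum_eigenRank_far_le hb hm hσ hα
  obtain ⟨c, n₁, hc0, hc⟩ := exists_le_sum_eigenRank hb hm hx hσ hα
  have hσ2 := hσ.sq_eq
  have hσ0 : σ ≠ 0 := by rintro rfl; norm_num at hσ2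
  have hσσ : σ * σ = 1 := by rw [← sq, hσ2]
  have hs := hα.side
  have hα0 := hα.pos
  have hΛ := landauLevel_pos hb q
  set Λ := landauLevel b q
  set A := solOp (perturbedOp b σ m)
  have hβ : 0 < Λ⁻¹ := inv_pos.2 hΛ
  have habs : ∀ y : ℝ, 0 < σ * y → |y| = σ * y := fun y hy => by
    have : |σ| = 1 := by
      rw [← sq_eq_sq₀ (abs_nonneg _) zero_le_one, sq_abs, hσ2, one_pow]
    rw [← abs_of_pos hy, abs_mul, this, one_mul]
  have hbetween : ∀ t, 0 < σ * (t - α) → 0 < σ * (Λ⁻¹ - t) → min α Λ⁻¹ ≤ t ∧ t ≤ max α Λ⁻¹ := by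
    intro t h1 h2
    rcases hσ with rfl | ⟨rfl, _⟩
    · exact ⟨(min_le_left _ _).trans (by linarith), le_trans (by linarith) (le_max_right _ _)⟩
    · exact ⟨(min_le_right _ _).trans (by linarith), le_trans (by linarith) (le_max_left _ _)⟩
  set s := σ * (Λ⁻¹ - α) with hs_def
  set τ := min α Λ⁻¹ with hτ
  have hτ0 : 0 < τ := lt_min hα0 hβ
  -- A lower bound for those factors on the half of the gap adjacent to `1/Λ`, where `σ(t - α) ≥
  -- s/2`; `M` below is an upper bound on the whole gap.
  set κ := s / 2 * (τ * Λ⁻¹) with hκ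
  have hκ0 : 0 < κ := by positivity
  set M := max 1 (s * (max α Λ⁻¹ * Λ⁻¹)) with hM
  have hM1 : 1 ≤ M := le_max_left _ _
  have hD1 : 1 ≤ max 1 κ⁻¹ := le_max_left _ _
  refine lists_asymptotics hI (C := max 1 κ⁻¹ * C) (c := c * M⁻¹) (n₀ := n₀ + n₂) (n₁ := n₁)
    (one_le_mul_of_one_le_of_one_le hD1 hC1) (by positivity) (fun k S hS => ?_) (fun k => ?_)
  · set T : ℝ → ℝ := fun x => (Λ + σ * x)⁻¹ with hT
    have hTinj : Function.Injective T := fun x y h =>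
      mul_left_cancel₀ hσ0 (add_left_cancel (inv_injective h))
    -- Points of zero multiplicity are discarded first: they contribute nothing, and they need not
    -- correspond to points between `α` and `1/Λ`.
    have hS' : ∀ x ∈ S.filter fun x => n x ≠ 0, 0 < gapPoly α Λ⁻¹ (T x) ∧ n x = eigenRank A (T x) :=
      fun x hx => hn x (hS x (Finset.mem_filter.1 hx).1).1 (Finset.mem_filter.1 hx).2
    set U := (S.filter fun x => n x ≠ 0).image T with hU
    have hsum : ∑ x ∈ S, n x = ∑ t ∈ U, eigenRank A t := by
      rw [hU, Finset.sum_image hTinj.injOn, ← Finset.sum_filter_ne_zero]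
      exact Finset.sum_congr rfl fun x hx => (hS' x hx).2
    -- The half adjacent to `1/Λ` carries the factorial count; the half adjacent to `α` contributes
    -- at most `n₂`, whatever `k`.
    rw [hsum, ← Finset.sum_filter_add_sum_filter_not U (fun t => 0 ≤ σ * (t - (α + Λ⁻¹) / 2)),
      ← add_assoc, Nat.cast_add]
    refine add_le_add (hC k _ fun t ht => ?_) (hfar _ fun t ht => ?_)
    · obtain ⟨ht, hnear⟩ := Finset.mem_filter.1 ht
      obtain ⟨x, hxS, rfl⟩ := Finset.mem_image.1 ht
      have hp := (hS' x hxS).1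
      have hxk := hS x (Finset.mem_filter.1 hxS).1
      obtain ⟨h1, h2⟩ := (gapPoly_pos_iff hσ2 hs).1 hp
      have h3 := (hbetween _ h1 h2).1
      have hx0 := hI x hxk.1
      have hne : Λ + σ * x ≠ 0 := fun h => by
        have : T x = 0 := by rw [hT]; simp [h]
        linarith
      have h4 : κ * x ≤ gapPoly α Λ⁻¹ (T x) := by
        rw [hT]
        simp only
        rw [gapPoly_inv_eq hΛ.ne' hne, hκ]
        change s / 2 * (τ * Λ⁻¹) * x ≤ σ * (T x - α) * (T x * Λ⁻¹) * x
        have h5 : s / 2 ≤ σ * (T x - α) := by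
          rw [hs_def]
          linarith
        gcongr
      refine le_trans ?_ h4
      have h6 : C ^ (k + 1) ≤ κ * (max 1 κ⁻¹ * C) ^ (k + 1) := by
        have h7 : κ⁻¹ * C ^ (k + 1) ≤ (max 1 κ⁻¹ * C) ^ (k + 1) :=
          (mul_le_mul_of_nonneg_right (le_max_right _ _) (by positivity)).trans
            (mul_pow_succ_le hD1 (by linarith) k)
        rwa [inv_mul_le_iff₀ hκ0] at h7
      calc C ^ (k + 1) / k.factorial ≤ κ * (max 1 κ⁻¹ * C) ^ (k + 1) / k.factorial := by gcongr
        _ = κ * ((max 1 κ⁻¹ * C) ^ (k + 1) / k.factorial) := by ring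
        _ ≤ κ * x := by gcongr; exact hxk.2.le
    · obtain ⟨ht, hnear⟩ := Finset.mem_filter.1 ht
      obtain ⟨x, hxS, rfl⟩ := Finset.mem_image.1 ht
      obtain ⟨h1, h2⟩ := (gapPoly_pos_iff hσ2 hs).1 (hS' x hxS).1
      refine (gapPoly_pos_iff hσ2 (by rw [hs_def] at hs; linarith)).2 ⟨h1, ?_⟩
      linarith [not_le.1 hnear]
  · obtain ⟨S, hS, hk⟩ := hc k
    set X : ℝ → ℝ := fun t => σ * (t⁻¹ - Λ) with hX
    have hXinj : Function.Injective X := fun t u h =>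
      inv_injective (sub_left_injective (mul_left_cancel₀ hσ0 h))
    have hpos : ∀ t ∈ S, 0 < gapPoly α Λ⁻¹ t := fun t ht => lt_trans (by positivity) (hS t ht)
    refine ⟨(S.filter fun t => eigenRank A t ≠ 0).image X, fun x hxS => ?_, ?_⟩
    · obtain ⟨t, ht, rfl⟩ := Finset.mem_image.1 hxS
      obtain ⟨ht, hne⟩ := Finset.mem_filter.1 ht
      obtain ⟨hXI, -⟩ := hn' t (hpos t ht) hne
      refine ⟨hXI, ?_⟩
      obtain ⟨h1, h2⟩ := (gapPoly_pos_iff hσ2 hs).1 (hpos t ht)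
      obtain ⟨h3, h4⟩ := hbetween t h1 h2
      have ht0 : 0 < t := hτ0.trans_le h3
      have hx0 : 0 < X t := hI _ hXI
      have e1 : Λ + σ * X t = t⁻¹ := by
        rw [hX]
        linear_combination (t⁻¹ - Λ) * hσσ
      have h5 : gapPoly α Λ⁻¹ t ≤ M * X t := by
        have e2 := gapPoly_inv_eq (σ := σ) (α := α) (x := X t) hΛ.ne' (by
          rw [e1]; exact inv_ne_zero ht0.ne')
        rw [e1, inv_inv] at e2
        rw [e2]
        refine mul_le_mul_of_nonneg_right (le_trans ?_ (le_max_right _ _)) hx0.le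
        have h6 : σ * (t - α) ≤ s := by rw [hs_def]; linarith
        gcongr
      have h7 := (hS t ht).trans_le h5
      have h8 : (c * M⁻¹) ^ (k + 1) ≤ c ^ (k + 1) * M⁻¹ := by
        rw [mul_pow]
        gcongr
        exact pow_le_of_le_one (by positivity) (inv_le_one_of_one_le₀ hM1) (by omega)
      calc (c * M⁻¹) ^ (k + 1) / k.factorial ≤ c ^ (k + 1) * M⁻¹ / k.factorial := by gcongr
        _ = c ^ (k + 1) / k.factorial / M := by ring
        _ < X t := by rw [div_lt_iff₀ (by positivity)]; linarith
    · rw [Finset.sum_image hXinj.injOn]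
      refine hk.trans (le_of_eq ?_)
      rw [← Finset.sum_filter_ne_zero]
      congr 1
      refine Finset.sum_congr rfl fun t ht => ?_
      obtain ⟨ht, hne⟩ := Finset.mem_filter.1 ht
      exact (hn' t (hpos t ht) hne).2.symm

theorem eigenMultiplicity_metricOp (hb : 0 < b) (hm : IsMetricBump m)
    (hσ : IsAdmissibleSign b σ m) {g : Plane → Matrix (Fin 2) (Fin 2) ℂ}
    (hg : ∀ j k, ContDiff ℝ ∞ fun x => g x j k) (hgm : ∀ x, g x = 1 + (σ : ℂ) • m x) (μ : ℝ) :
    eigenMultiplicity (metricOp b g hg) μ =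
      if μ = 0 then 0 else eigenRank (solOp (perturbedOp b σ m)) μ⁻¹ := by
  obtain rfl : g = fun x => 1 + (σ : ℂ) • m x := funext hgm
  have h1 : ∀ j k, (fun _ : Plane => (1 : Matrix (Fin 2) (Fin 2) ℂ) j k).HasTemperateGrowth :=
    fun j k => .const _
  have hgt : ∀ j k, (fun x => (1 + (σ : ℂ) • m x) j k).HasTemperateGrowth := fun j k =>
    (h1 j k).add ((Function.HasTemperateGrowth.const (σ : ℂ)).mul (hm.growth j k))
  have he : metricSchwartz b (fun x => 1 + (σ : ℂ) • m x) = perturbedOp b σ m := by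
    ext1 f
    rw [metricSchwartz_add b h1 hm.growth, metricSchwartz_one, perturbedOp_apply]
  have hell : IsElliptic (metricSchwartz b fun x => 1 + (σ : ℂ) • m x) := by
    rw [he]
    exact metricForm_perturb_isElliptic hb hm hσ
  split_ifs with h
  · rw [eigenMultiplicity, h, opEigenspace_metricOp_zero hg hgt hell]
    simp
  · rw [eigenMultiplicity, opEigenspace_metricOp hg hgt hell h, he, eigenRank]

theorem eigenRank_eq_zero_of_neg (hb : 0 < b) (hm : IsMetricBump m) (hσ : IsAdmissibleSign b σ m)
    {t : ℝ} (ht : t < 0) : eigenRank (solOp (perturbedOp b σ m)) t = 0 := by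
  have : eigenKer (solOp (perturbedOp b σ m)) t = ⊥ := by
    rw [Submodule.eq_bot_iff]
    intro u hu
    have h := (metricForm_perturb_isElliptic hb hm hσ).isPositive_solOp.re_inner_nonneg_left u
    rw [mem_eigenKer.1 hu, inner_smul_left, Complex.conj_ofReal, inner_self_eq_norm_sq_to_K] at h
    by_contra h0
    have hp : 0 < ‖u‖ ^ 2 := by positivity
    have e : RCLike.re ((t : ℂ) * ((‖u‖ : ℂ)) ^ 2) = t * ‖u‖ ^ 2 := by
      rw [← Complex.ofReal_pow, ← Complex.ofReal_mul]
      exact Complex.ofReal_re _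
    have h' : 0 ≤ t * ‖u‖ ^ 2 := e ▸ h
    nlinarith
  rw [eigenRank, this]
  simp

theorem eigenRank_eq_zero_of_norm_lt {A : L2Plane →L[ℂ] L2Plane} {t : ℝ} (ht : ‖A‖ < t) :
    eigenRank A t = 0 := by
  have : eigenKer A t = ⊥ := by
    rw [Submodule.eq_bot_iff]
    intro u hu
    have h := A.le_opNorm u
    rw [mem_eigenKer.1 hu, norm_smul, Complex.norm_real,
      Real.norm_of_nonneg ((norm_nonneg A).trans ht.le)] at h
    by_contra h0
    have hp : 0 < ‖u‖ := by positivity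
    nlinarith
  rw [eigenRank, this]
  simp

theorem ListsEigenvalues.listsWithMult {T : L2Plane →ₗ.[ℂ] L2Plane} {J : Set ℝ} {lam : ℕ → ℝ}
    (h : ListsEigenvalues T J lam) {Λ : ℝ} (hσ : σ ^ 2 = 1) :
    ListsWithMult (fun x => eigenMultiplicity T (Λ + σ * x)) {x | Λ + σ * x ∈ J}
      (fun k => σ * (lam k - Λ)) := by
  have e : ∀ y, Λ + σ * (σ * (y - Λ)) = y := fun y => by linear_combination (y - Λ) * hσ
  refine ⟨fun k => ?_, fun x hx => ?_⟩
  · rw [Set.mem_ofPred_eq, e]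
    exact h.mem k
  · rw [← h.card _ hx]
    congr 1
    ext k
    rw [Set.mem_ofPred_eq, Set.mem_ofPred_eq]
    constructor
    · rintro rfl
      exact (e _).symm
    · intro hk
      rw [hk]
      linear_combination x * hσ

theorem ListsWithMult.listsEigenvalues {T : L2Plane →ₗ.[ℂ] L2Plane} {J : Set ℝ} {d : ℕ → ℝ} {Λ : ℝ}
    (h : ListsWithMult (fun x => eigenMultiplicity T (Λ + σ * x)) {x | Λ + σ * x ∈ J} d)
    (hσ : σ ^ 2 = 1) : ListsEigenvalues T J fun k => Λ + σ * d k := by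
  have e : ∀ y, Λ + σ * (σ * (y - Λ)) = y := fun y => by linear_combination (y - Λ) * hσ
  refine ⟨h.mem, fun μ hμ => ?_⟩
  have h1 := h.card (σ * (μ - Λ)) (by rw [Set.mem_ofPred_eq, e]; exact hμ)
  simp only [e] at h1
  rw [← h1]
  congr 1
  ext k
  rw [Set.mem_ofPred_eq, Set.mem_ofPred_eq]
  constructor
  · rintro rfl
    linear_combination (-(d k)) * hσ
  · intro hk
    rw [hk, e]

theorem landauLevel_inv_lt (hb : 0 < b) {i j : ℕ} (h : i < j) :
    (landauLevel b j)⁻¹ < (landauLevel b i)⁻¹ :=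
  inv_strictAnti₀ (landauLevel_pos hb i) (landauLevel_strictMono hb h)

/-- Inverse levels other than the two given ones stay at least one neighbouring spacing away from
both, so the product is bounded below by the square of a spacing. -/
theorem exists_gap_between (hb : 0 < b) (q : ℕ) :
    ∃ η > 0, ∀ j : ℕ, (landauLevel b j)⁻¹ = (landauLevel b q)⁻¹ ∨
      (landauLevel b j)⁻¹ = (landauLevel b (q + 1))⁻¹ ∨
      η ≤ ((landauLevel b j)⁻¹ - (landauLevel b q)⁻¹) *
        ((landauLevel b j)⁻¹ - (landauLevel b (q + 1))⁻¹) := by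
  have h01 := landauLevel_inv_lt hb (Nat.lt_succ_self q)
  have h12 := landauLevel_inv_lt hb (Nat.lt_succ_self (q + 1))
  set x : ℕ → ℝ := fun j => (landauLevel b j)⁻¹ with hx
  have hanti : ∀ {i j : ℕ}, i ≤ j → x j ≤ x i := fun {i j} h => by
    rcases h.lt_or_eq with h | rfl
    · exact (landauLevel_inv_lt hb h).le
    · exact le_rfl
  change x (q + 1) < x q at h01
  change x (q + 2) < x (q + 1) at h12
  change ∃ η > 0, ∀ j : ℕ, x j = x q ∨ x j = x (q + 1) ∨ η ≤ (x j - x q) * (x j - x (q + 1))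
  have hlow : ∀ j, q + 2 ≤ j → (x (q + 1) - x (q + 2)) ^ 2 ≤ (x j - x q) * (x j - x (q + 1)) := by
    intro j hj
    have := hanti hj
    nlinarith
  rcases Nat.eq_zero_or_pos q with rfl | hq
  · refine ⟨(x 1 - x 2) ^ 2, by have : 0 < x 1 - x 2 := sub_pos.2 h12
                                positivity, fun j => ?_⟩
    rcases Nat.lt_or_ge j 2 with hj | hj
    · interval_cases j
      · exact Or.inl rfl
      · exact Or.inr (Or.inl rfl)
    · exact Or.inr (Or.inr (hlow j hj))
  · obtain ⟨p, rfl⟩ : ∃ p, q = p + 1 := ⟨q - 1, by omega⟩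
    have hp : x (p + 1) < x p := landauLevel_inv_lt hb (Nat.lt_succ_self p)
    have hp1 : 0 < x p - x (p + 1) := sub_pos.2 hp
    have hp2 : 0 < x (p + 1 + 1) - x (p + 1 + 2) := sub_pos.2 h12
    refine ⟨min ((x (p + 1 + 1) - x (p + 1 + 2)) ^ 2) ((x p - x (p + 1)) ^ 2),
      lt_min (by positivity) (by positivity), fun j => ?_⟩
    rcases Nat.lt_or_ge p j with hj | hj
    · rcases Nat.lt_or_ge j (p + 3) with hj' | hj'
      · have : j = p + 1 ∨ j = p + 1 + 1 := by omega
        rcases this with rfl | rfl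
        · exact Or.inl rfl
        · exact Or.inr (Or.inl rfl)
      · exact Or.inr (Or.inr ((min_le_left _ _).trans (hlow j hj')))
    · refine Or.inr (Or.inr ((min_le_right _ _).trans ?_))
      have := hanti hj
      nlinarith

theorem isGapEndpoint_next (hb : 0 < b) (q : ℕ) :
    IsGapEndpoint b 1 q (landauLevel b (q + 1))⁻¹ where
  pos := inv_pos.2 (landauLevel_pos hb _)
  side := by
    have := landauLevel_inv_lt hb (Nat.lt_succ_self q)
    linarith
  gap := by
    obtain ⟨η, h0, h⟩ := exists_gap_between hb q
    refine ⟨η, h0, fun j => ?_⟩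
    rcases h j with h | h | h
    · exact Or.inr (Or.inl h)
    · exact Or.inl h
    · exact Or.inr (Or.inr (h.trans_eq (mul_comm _ _)))

theorem isGapEndpoint_prev (hb : 0 < b) (q : ℕ) :
    IsGapEndpoint b (-1) (q + 1) (landauLevel b q)⁻¹ where
  pos := inv_pos.2 (landauLevel_pos hb _)
  side := by
    have := landauLevel_inv_lt hb (Nat.lt_succ_self q)
    linarith
  gap := exists_gap_between hb q

theorem isGapEndpoint_zero (hb : 0 < b) {α : ℝ} (hα : (landauLevel b 0)⁻¹ < α) :
    IsGapEndpoint b (-1) 0 α where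
  pos := (inv_pos.2 (landauLevel_pos hb _)).trans hα
  side := by linarith
  gap := by
    have h1 := landauLevel_inv_lt hb (Nat.lt_succ_self 0)
    refine ⟨(α - (landauLevel b 0)⁻¹) * ((landauLevel b 0)⁻¹ - (landauLevel b (0 + 1))⁻¹),
      mul_pos (sub_pos.2 hα) (sub_pos.2 h1), fun j => ?_⟩
    rcases Nat.eq_zero_or_pos j with rfl | hj
    · exact Or.inr (Or.inl rfl)
    · have h2 : (landauLevel b j)⁻¹ ≤ (landauLevel b (0 + 1))⁻¹ :=
        inv_anti₀ (landauLevel_pos hb _) ((landauLevel_strictMono hb).monotone hj)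
      right; right
      nlinarith

end Assembly

/-! ### The main theorem: both signs, in terms of the distances `σ(λ - Λ_q)`. -/

theorem theorem2p1 (b : ℝ) (hb : 0 < b)
    (m : Plane → Matrix (Fin 2) (Fin 2) ℂ)
    (hm_smooth : ∀ j k, ContDiff ℝ ∞ fun x => m x j k)
    (hm_nonneg : ∀ x, (m x).PosSemidef)
    (hm_supp : HasCompactSupport m)
    (hm_less : ∃ x, smallerEigenvalue (hm_nonneg x).isHermitian ≠ 0)
    (q : ℕ) :
    ((∃ lam : ℕ → ℝ,
        Antitone lam ∧ ListsEigenvalues (landauPlus b m hm_smooth) (gapAbove b q) lam) ∧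
      ∀ lam : ℕ → ℝ, Antitone lam →
        ListsEigenvalues (landauPlus b m hm_smooth) (gapAbove b q) lam →
        (fun k : ℕ => Real.log (lam k - landauLevel b q) - (-(k : ℝ) * Real.log k))
          =O[Filter.atTop] fun k : ℕ => (k : ℝ)) ∧
    ((∃ c < 1, ∀ x, ‖Matrix.toEuclideanCLM (n := Fin 2) (𝕜 := ℂ) (m x)‖ ≤ c) →
      (∃ lam : ℕ → ℝ,
        Monotone lam ∧ ListsEigenvalues (landauMinus b m hm_smooth) (gapBelow b q) lam) ∧
      ∀ lam : ℕ → ℝ, Monotone lam →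
        ListsEigenvalues (landauMinus b m hm_smooth) (gapBelow b q) lam →
        (fun k : ℕ => Real.log (-(lam k - landauLevel b q)) - (-(k : ℝ) * Real.log k))
          =O[Filter.atTop] fun k : ℕ => (k : ℝ)) := by
  have hm : IsMetricBump m := ⟨hm_smooth, hm_nonneg, hm_supp⟩
  have hΛ := landauLevel_pos hb q
  constructor
  · have hσ : IsAdmissibleSign b 1 m := Or.inl rfl
    have hmult := eigenMultiplicity_metricOp hb hm hσ (contDiff_one_add hm_smooth)
      (fun x => by rw [Complex.ofReal_one, one_smul])
    have hα := isGapEndpoint_next hb q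
    have hΛ' := landauLevel_pos hb (q + 1)
    obtain ⟨⟨d, hd1, hd2⟩, hasy⟩ := eigenvalue_distance_asymptotics hb hm hm_less hσ hα
      (I := {x | landauLevel b q + 1 * x ∈ gapAbove b q})
      (n := fun x => eigenMultiplicity (landauPlus b m hm_smooth) (landauLevel b q + 1 * x))
      (fun x hx => by have := hx.1; linarith)
      (fun x hx hne => by
        have h0 : landauLevel b q + 1 * x ≠ 0 := (hΛ.trans hx.1).ne'
        refine ⟨(gapPoly_pos_iff hσ.sq_eq hα.side).2 ⟨?_, ?_⟩, ?_⟩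
        · have := inv_strictAnti₀ (hΛ.trans hx.1) hx.2
          linarith
        · have := inv_strictAnti₀ hΛ hx.1
          linarith
        · simp only [landauPlus, hmult, if_neg h0])
      (fun t ht hne => by
        obtain ⟨h1, h2⟩ := (gapPoly_pos_iff hσ.sq_eq hα.side).1 ht
        have ht0 : 0 < t := hα.pos.trans (by linarith)
        have e : landauLevel b q + 1 * (1 * (t⁻¹ - landauLevel b q)) = t⁻¹ := by ring
        refine ⟨?_, ?_⟩
        · rw [Set.mem_ofPred_eq, e]
          exact ⟨(lt_inv_comm₀ hΛ ht0).2 (by linarith), (inv_lt_comm₀ ht0 hΛ').2 (by linarith)⟩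
        · simp only [e]
          rw [landauPlus, hmult, if_neg (inv_ne_zero ht0.ne'), inv_inv])
    refine ⟨⟨_, fun i j hij => ?_, hd2.listsEigenvalues hσ.sq_eq⟩, fun lam h1 h2 => ?_⟩
    · have := hd1 hij
      linarith
    · have := hasy _ (fun i j hij => by have := h1 hij; linarith)
        (h2.listsWithMult hσ.sq_eq)
      simpa only [one_mul] using this
  · rintro ⟨c, hc1, hc⟩
    have hσ : IsAdmissibleSign b (-1) m := Or.inr ⟨rfl, max c 0, le_max_right _ _,
      max_lt hc1 one_pos, fun f => metricForm_le b hm.growth (fun x => (hc x).trans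
        (le_max_left _ _)) f⟩
    have hmult := eigenMultiplicity_metricOp hb hm hσ (contDiff_one_sub hm_smooth)
      (fun x => by rw [Complex.ofReal_neg, Complex.ofReal_one, neg_one_smul, sub_eq_add_neg])
    -- Passing to the distances `Λ_q - λ` turns the non-decreasing eigenvalues of `H₋` into a
    -- non-increasing positive sequence.
    have main : (∃ d : ℕ → ℝ, Antitone d ∧ ListsWithMult
        (fun x => eigenMultiplicity (landauMinus b m hm_smooth) (landauLevel b q + (-1) * x))
        {x | landauLevel b q + (-1) * x ∈ gapBelow b q} d) ∧
        ∀ d : ℕ → ℝ, Antitone d → ListsWithMult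
        (fun x => eigenMultiplicity (landauMinus b m hm_smooth) (landauLevel b q + (-1) * x))
        {x | landauLevel b q + (-1) * x ∈ gapBelow b q} d →
        (fun k : ℕ => Real.log (d k) - (-(k : ℝ) * Real.log k)) =O[Filter.atTop]
          fun k : ℕ => (k : ℝ) := by
      have e : ∀ t, landauLevel b q + (-1) * ((-1) * (t⁻¹ - landauLevel b q)) = t⁻¹ :=
        fun t => by ring
      cases q with
      | zero =>
        set A := solOp (perturbedOp b (-1) m) with hA
        -- With no level below `Λ_0`, the endpoint is put beyond the norm of the inverse, so that no
        -- eigenvalue in `(-∞, Λ_0)` is missed; non-positive numbers are not eigenvalues, by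
        -- positivity and injectivity.
        have hα : IsGapEndpoint b (-1) 0 (‖A‖ + (landauLevel b 0)⁻¹ + 1) :=
          isGapEndpoint_zero hb (by linarith [norm_nonneg A])
        refine eigenvalue_distance_asymptotics hb hm hm_less hσ hα ?_ ?_ ?_
        · intro x hx
          have : landauLevel b 0 + (-1) * x < landauLevel b 0 := hx
          linarith
        · intro x hx hne
          have hx' : landauLevel b 0 + (-1) * x < landauLevel b 0 := hx
          simp only [landauMinus, hmult] at hne ⊢
          have h0 : landauLevel b 0 + (-1) * x ≠ 0 := fun h => hne (if_pos h)
          rw [if_neg h0] at hne ⊢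
          have hpos : 0 < landauLevel b 0 + (-1) * x := by
            by_contra h
            exact hne (eigenRank_eq_zero_of_neg hb hm hσ
              (inv_lt_zero.2 (lt_of_le_of_ne (not_lt.1 h) h0)))
          have hle : (landauLevel b 0 + (-1) * x)⁻¹ ≤ ‖A‖ := by
            by_contra h
            exact hne (eigenRank_eq_zero_of_norm_lt (not_le.1 h))
          refine ⟨(gapPoly_pos_iff hσ.sq_eq hα.side).2 ⟨?_, ?_⟩, rfl⟩
          · have := inv_pos.2 hΛ
            linarith
          · have := inv_strictAnti₀ hpos hx'
            linarith
        · intro t ht hne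
          obtain ⟨h1, h2⟩ := (gapPoly_pos_iff hσ.sq_eq hα.side).1 ht
          have ht0 : 0 < t := (inv_pos.2 hΛ).trans (by linarith)
          refine ⟨?_, ?_⟩
          · rw [Set.mem_ofPred_eq, e]
            exact (inv_lt_comm₀ ht0 hΛ).2 (by linarith)
          · simp only [e]
            rw [landauMinus, hmult, if_neg (inv_ne_zero ht0.ne'), inv_inv]
      | succ p =>
        have hα := isGapEndpoint_prev hb p
        have hΛ' := landauLevel_pos hb p
        refine eigenvalue_distance_asymptotics hb hm hm_less hσ hα ?_ ?_ ?_
        · intro x hx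
          have := hx.2
          linarith
        · intro x hx hne
          have h0 : landauLevel b (p + 1) + (-1) * x ≠ 0 := (hΛ'.trans hx.1).ne'
          refine ⟨(gapPoly_pos_iff hσ.sq_eq hα.side).2 ⟨?_, ?_⟩, ?_⟩
          · have := inv_strictAnti₀ hΛ' hx.1
            linarith
          · have := inv_strictAnti₀ (hΛ'.trans hx.1) hx.2
            linarith
          · simp only [landauMinus, hmult, if_neg h0]
        · intro t ht hne
          obtain ⟨h1, h2⟩ := (gapPoly_pos_iff hσ.sq_eq hα.side).1 ht
          have ht0 : 0 < t := (inv_pos.2 hΛ).trans (by linarith)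
          refine ⟨?_, ?_⟩
          · rw [Set.mem_ofPred_eq, e]
            exact ⟨(lt_inv_comm₀ hΛ' ht0).2 (by linarith), (inv_lt_comm₀ ht0 hΛ).2 (by linarith)⟩
          · simp only [e]
            rw [landauMinus, hmult, if_neg (inv_ne_zero ht0.ne'), inv_inv]
    obtain ⟨⟨d, hd1, hd2⟩, hasy⟩ := main
    refine ⟨⟨_, fun i j hij => ?_, hd2.listsEigenvalues hσ.sq_eq⟩, fun lam h1 h2 => ?_⟩
    · have := hd1 hij
      linarith
    · have := hasy _ (fun i j hij => by have := h1 hij; linarith)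
        (h2.listsWithMult hσ.sq_eq)
      simpa only [neg_one_mul] using this
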